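/- **Setting.** Let $n\ge 1$, let $\mathcal V$ be a (graded-)commutative $\mathbb N$-graded $\mathbb Q$-algebra, finite-dimensional in each degree and concentrated in even degrees, and let $e\in\mathcal V_{2n}$. For $g\ge 0$ let $H(g)$ be the $2g$-dimensional rational vector space with its standard nonsingular $(-1)^n$-symmetric pairing $\lambda$ (hyperbolic for $n$ even, symplectic for $n$ odd). For a finite set $S$ put $K^\vee(S)=(H(g)^{\otimes S})^\vee$. Let $\mathcal P(S,\mathcal V)'_{\ge 0}$ be the graded vector space spanned by the partitions of $S$ into finitely many (possibly empty) parts $P_i$, each labelled by a homogeneous $c_i\in\mathcal V$ with $|c_i|+n(|P_i|-2)>0$, modulo linearity in each label; such a labelled partition has degree $\sum_i\big(|c_i|+n(|P_i|-2)\big)$. The downward Brauer category $\mathsf{dBr}$ (for $n$ even), respectively the downward signed Brauer category $\mathsf{dsBr}$ (for $n$ odd), has the finite sets as objects, and its morphisms are generated by the bijections and by the contractions $S\to S\setminus\{x,y\}$ of ordered pairs of distinct elements of $S$. Bijections act in the evident way. The contraction of $(x,y)$ acts * on $K^\vee$, contravariantly, by precomposition with $\lambda_{x,y}\colon H(g)^{\otimes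 S}\to H(g)^{\otimes S\setminus\{x,y\}}$, which applies $\lambda$ to the factors $x$ and $y$; * on $\mathcal P(-,\mathcal V)'_{\ge 0}$, by merging the parts containing $x$ and $y$ and multiplying their labels if these parts are different, by multiplying the label by $e$ if they are the same, and by removing $x$ and $y$ in both cases; * on $(\det\mathbb Q^S)^{\otimes n}$, by the inverse of $(x\wedge y\wedge -)^{\otimes n}$. Disjoint union makes these functors lax monoidal, and so the coend $$R^{\mathcal V}=K^\vee\otimes^{\mathsf{d(s)Br}}\big(\mathcal P(-,\mathcal V)'_{\ge 0}\otimes{\det}^{\otimes n}\big)$$ is a graded $\mathbb Q$-algebra, the grading being that of $\mathcal P(-,\mathcal V)'_{\ge 0}$. For $c\in\mathcal V$ homogeneous and $r\ge 0$ with $|c|+n(r-2)>0$, and $v_1,\dots,v_r\in H(g)$, let $\kappa_c(v_1\otimes\cdots\otimes v_r)\in R^{\mathcal V}$ be the class, of degree $|c|+n(r-2)$, of $$\big(\lambda(v_1,-)\otimes\cdots\otimes\lambda(v_r,-)\big)\otimes\{(\{1,\dots,r\};c)\}\otimes(1\wedge\cdots\wedge r)^{\otimes n}.$$ **Theorem.**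 In a range of degrees tending to infinity with $g$, $R^{\mathcal V}$ is the graded-commutative ring generated by the classes $\kappa_c(v_1\otimes\cdots\otimes v_r)$ with $c$ a homogeneous element of $\mathcal V$, $r\ge 0$, and $|c|+n(r-2)>0$, subject to 1. linearity in $c$ and in each $v_i$; 2. $\kappa_c(v_{\sigma(1)}\otimes\cdots\otimes v_{\sigma(r)})=\operatorname{sign}(\sigma)^n\,\kappa_c(v_1\otimes\cdots\otimes v_r)$ for every permutation $\sigma$; 3. $\sum_i\kappa_x(v\otimes a_i)\cdot\kappa_y(a_i^\#\otimes w)=\kappa_{x\cdot y}(v\otimes w)$ and $\sum_i\kappa_x(v\otimes a_i\otimes a_i^\#)=\kappa_{e\cdot x}(v)$, for all $v=v_1\otimes\cdots\otimes v_r$, $w=w_1\otimes\cdots\otimes w_{r'}$ and $x,y$ for which the classes on the left-hand sides are among the generators, where $(a_i)$ and $(a_i^\#)$, $1\le i\le 2g$, are dual bases of $H(g)$ with $\lambda(a_i,a_j^\#)=\delta_{ij}$. That is: for every $g$ there is a homomorphism of $\mathbb Q$-algebras $\varphi_g$ to $R^{\mathcal V}$, from the graded-commutative $\mathbb Q$-algebra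 presented by these generators and relations, which sends each generator $\kappa_c(v_1\otimes\cdots\otimes v_r)$ to the class of the same name; and for every $N$ there is a $g_0$ such that for all $g\ge g_0$ the map $\varphi_g$ is bijective in each degree $k\le N$. -/

import Mathlib

noncomputable section

namespace TorelliRing

open scoped DirectSum TensorProduct

/-! ### Modules given by generators and linear relations -/

/-- The rational vector space with basis `X`, modulo the subspace spanned by `rel`. -/
def PresMod {X : Type*} (rel : Set (X →₀ ℚ)) : Type _ :=
  (X →₀ ℚ) ⧸ Submodule.span ℚ rel

namespace PresMod

variable {X Y Z : Type*} {relX : Set (X →₀ ℚ)} {relY : Set (Y →₀ ℚ)} {relZ : Set (Z →₀ ℚ)}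
variable {M : Type*} [AddCommGroup M] [Module ℚ M]

instance : AddCommGroup (PresMod relX) :=
  inferInstanceAs (AddCommGroup ((X →₀ ℚ) ⧸ Submodule.span ℚ relX))

instance : Module ℚ (PresMod relX) :=
  inferInstanceAs (Module ℚ ((X →₀ ℚ) ⧸ Submodule.span ℚ relX))

/-- The quotient map. -/
def proj (relX : Set (X →₀ ℚ)) : (X →₀ ℚ) →ₗ[ℚ] PresMod relX :=
  (Submodule.span ℚ relX).mkQ

/-- The class of a generator. -/
def mk (relX : Set (X →₀ ℚ)) (x : X) : PresMod relX := proj relX (Finsupp.single x 1)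

theorem proj_rel {r : X →₀ ℚ} (hr : r ∈ relX) : proj relX r = 0 :=
  (Submodule.Quotient.mk_eq_zero _).2 (Submodule.subset_span hr)

/-- A linear map out of a presented module. -/
def lift (f : X → M) (h : ∀ r ∈ relX, Finsupp.linearCombination ℚ f r = 0) :
    PresMod relX →ₗ[ℚ] M :=
  (Submodule.span ℚ relX).liftQ (Finsupp.linearCombination ℚ f)
    (Submodule.span_le.2 fun r hr => h r hr)

@[simp] theorem lift_mk (f : X → M) (h : ∀ r ∈ relX, Finsupp.linearCombination ℚ f r = 0)
    (x : X) : lift f h (mk relX x) = f x := by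
  change (Submodule.span ℚ relX).liftQ _ _ ((Submodule.span ℚ relX).mkQ _) = _
  simp

theorem ext {f f' : PresMod relX →ₗ[ℚ] M} (h : ∀ x, f (mk relX x) = f' (mk relX x)) :
    f = f' := by
  refine Submodule.linearMap_qext _ (Finsupp.lhom_ext' fun x => LinearMap.ext_ring ?_)
  exact h x

/-- A bilinear map out of two presented modules. -/
def lift₂ (f : X → Y → M)
    (h₁ : ∀ r ∈ relX, ∀ y, Finsupp.linearCombination ℚ (fun x => f x y) r = 0)
    (h₂ : ∀ x, ∀ r ∈ relY, Finsupp.linearCombination ℚ (f x) r = 0) :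
    PresMod relX →ₗ[ℚ] PresMod relY →ₗ[ℚ] M :=
  lift (fun x => lift (f x) (h₂ x)) fun r hr => ext fun y => by
    have := h₁ r hr y
    rw [Finsupp.linearCombination_apply, Finsupp.sum] at this ⊢
    rw [LinearMap.sum_apply]
    simpa using this

@[simp] theorem lift₂_mk (f : X → Y → M) (h₁) (h₂) (x : X) (y : Y) :
    lift₂ (relX := relX) (relY := relY) f h₁ h₂ (mk relX x) (mk relY y) = f x y := by
  simp [lift₂]

end PresMod

/-! ### The representation `H(g)` and the dual kernel `K^∨` -/

/-- `H(g)`, with its hyperbolic basis indexed by two copies of `Fin g`. -/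
abbrev H (g : ℕ) : Type := (Fin g ⊕ Fin g) → ℚ

/-- The nonsingular `(-1)^n`-symmetric pairing `λ` on `H(g)`: hyperbolic for `n` even and the
standard symplectic form for `n` odd. -/
def pairing (n g : ℕ) : H g →ₗ[ℚ] H g →ₗ[ℚ] ℚ :=
  LinearMap.mk₂ ℚ
    (fun u w => ∑ i : Fin g, (u (.inl i) * w (.inr i) + (-1) ^ n * (u (.inr i) * w (.inl i))))
    (fun u u' w => by simp only [Pi.add_apply, ← Finset.sum_add_distrib]; congr 1; ext i; ring)
    (fun c u w => by
      simp only [Pi.smul_apply, smul_eq_mul, Finset.mul_sum]; congr 1; ext i; ring)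
    (fun u w w' => by simp only [Pi.add_apply, ← Finset.sum_add_distrib]; congr 1; ext i; ring)
    (fun c u w => by
      simp only [Pi.smul_apply, smul_eq_mul, Finset.mul_sum]; congr 1; ext i; ring)

/-- `K^∨(S)`, the linear dual of `H(g)^{⊗ S}`: multilinear forms in `S`-indexed families of
vectors of `H(g)`. -/
abbrev KDual (g : ℕ) (S : Type) : Type := MultilinearMap ℚ (fun _ : S => H g) ℚ

namespace KDual

variable {g : ℕ} {S T U : Type}

/-- The monoidality `K^∨(S) ⊗ K^∨(T) → K^∨(S ⊔ T)`. -/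
def mul : KDual g S →ₗ[ℚ] KDual g T →ₗ[ℚ] KDual g (S ⊕ T) :=
  LinearMap.mk₂ ℚ (fun ξ η => (LinearMap.mul' ℚ ℚ).compMultilinearMap (ξ.domCoprod η))
    (fun _ _ _ => by ext; simp [MultilinearMap.domCoprod, add_mul])
    (fun _ _ _ => by ext; simp [MultilinearMap.domCoprod, mul_assoc])
    (fun _ _ _ => by ext; simp [MultilinearMap.domCoprod, mul_add])
    (fun _ _ _ => by ext; simp [MultilinearMap.domCoprod, mul_left_comm])

@[simp] theorem mul_apply (ξ : KDual g S) (η : KDual g T) (u : S ⊕ T → H g) :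
    mul ξ η u = ξ (fun s => u (.inl s)) * η (fun t => u (.inr t)) := by
  simp [mul, MultilinearMap.domCoprod]

/-- The contravariant effect of a bijection `S ≃ T`: precomposition with the relabelling map
`H(g)^{⊗ S} → H(g)^{⊗ T}`. -/
def relabel (e : S ≃ T) (ξ : KDual g T) : KDual g S := ξ.domDomCongr e.symm

@[simp] theorem relabel_apply (e : S ≃ T) (ξ : KDual g T) (u : S → H g) :
    relabel e ξ u = ξ (fun t => u (e.symm t)) := rfl

/-- The pairing `λ`, as an element of `K^∨` of a two-element set. -/
def pair (n g : ℕ) : KDual g (Fin 2) where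
  toFun u := pairing n g (u 0) (u 1)
  map_update_add' u i x y := by
    fin_cases i <;> simp [Function.update]
  map_update_smul' u i c x := by
    fin_cases i <;> simp [Function.update]

/-- The contravariant effect of the contraction `S → T` which matches the ordered pair
`(e (inl 0), e (inl 1))` of elements of `S`, where `e : Fin 2 ⊔ T ≃ S`: precomposition with
`λ_{x,y} : H(g)^{⊗ S} → H(g)^{⊗ T}`. -/
def contract (n : ℕ) (e : Fin 2 ⊕ T ≃ S) (ξ : KDual g T) : KDual g S :=
  (mul (pair n g) ξ).domDomCongr e

@[simp] theorem contract_apply (n : ℕ) (e : Fin 2 ⊕ T ≃ S) (ξ : KDual g T) (u : S → H g) :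
    contract n e ξ u =
      pairing n g (u (e (.inl 0))) (u (e (.inl 1))) * ξ (fun t => u (e (.inr t))) := by
  simp [contract, pair]

end KDual

/-! ### The functor `det^{⊗ n}` -/

/-- Total orderings of `S`, as lists in which every element of `S` occurs exactly once. -/
@[ext] structure Ordering (S : Type) : Type where
  list : List S
  nodup : list.Nodup
  mem : ∀ s, s ∈ list

namespace Ordering

variable {S T U : Type}

/-- Relabelling along a bijection. -/
@[simps list] def relabel (e : S ≃ T) (o : Ordering S) : Ordering T where
  list := o.list.map e
  nodup := o.nodup.map e.injective
  mem t := List.mem_map.2 ⟨e.symm t, o.mem _, by simp⟩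

/-- Concatenation. -/
@[simps list] def append (o : Ordering S) (o' : Ordering T) : Ordering (S ⊕ T) where
  list := o.list.map Sum.inl ++ o'.list.map Sum.inr
  nodup := by
    refine List.Nodup.append (o.nodup.map Sum.inl_injective) (o'.nodup.map Sum.inr_injective) ?_
    intro x hx hy
    obtain ⟨a, -, rfl⟩ := List.mem_map.1 hx
    obtain ⟨b, -, hb⟩ := List.mem_map.1 hy
    cases hb
  mem := by
    rintro (s | t)
    · exact List.mem_append_left _ (List.mem_map.2 ⟨s, o.mem s, rfl⟩)
    · exact List.mem_append_right _ (List.mem_map.2 ⟨t, o'.mem t, rfl⟩)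

/-- The standard ordering of `Fin k`. -/
@[simps list] def fin (k : ℕ) : Ordering (Fin k) :=
  ⟨List.finRange k, List.nodup_finRange k, List.mem_finRange⟩

/-- The empty ordering. -/
@[simps list] def nil : Ordering Empty := ⟨[], List.nodup_nil, fun s => s.elim⟩

end Ordering

/-- The relations `s₁ ∧ ⋯ ∧ b ∧ a ∧ ⋯ ∧ s_k = - s₁ ∧ ⋯ ∧ a ∧ b ∧ ⋯ ∧ s_k`, after passing to
`n`-th tensor powers. -/
def detRel (n : ℕ) (S : Type) : Set (Ordering S →₀ ℚ) :=
  {r | ∃ (l₁ l₂ : List S) (a b : S) (o o' : Ordering S),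
      o.list = l₁ ++ b :: a :: l₂ ∧ o'.list = l₁ ++ a :: b :: l₂ ∧
      r = Finsupp.single o 1 - (-1 : ℚ) ^ n • Finsupp.single o' 1}

/-- `(det ℚ^S)^{⊗ n}`: it is spanned by the elements `(s₁ ∧ ⋯ ∧ s_k)^{⊗ n}` for the total orderings
`s₁, …, s_k` of `S`. -/
abbrev DetPow (n : ℕ) (S : Type) : Type := PresMod (detRel n S)

namespace DetPow

variable {n : ℕ} {S T U : Type}

/-- The element `(s₁ ∧ ⋯ ∧ s_k)^{⊗ n}`. -/
abbrev mk (n : ℕ) {S : Type} (o : Ordering S) : DetPow n S := PresMod.mk (detRel n S) o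

theorem mk_swap (l₁ l₂ : List S) (a b : S) {o o' : Ordering S}
    (h : o.list = l₁ ++ b :: a :: l₂) (h' : o'.list = l₁ ++ a :: b :: l₂) :
    mk n o = (-1 : ℚ) ^ n • mk n o' := by
  have := PresMod.proj_rel (relX := detRel n S) ⟨l₁, l₂, a, b, o, o', h, h', rfl⟩
  rw [map_sub, map_smul, sub_eq_zero] at this
  exact this

/-- The effect of a bijection. -/
def relabel (n : ℕ) (e : S ≃ T) : DetPow n S →ₗ[ℚ] DetPow n T :=
  PresMod.lift (fun o => mk n (o.relabel e)) (by
    rintro _ ⟨l₁, l₂, a, b, o, o', h, h', rfl⟩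
    simp only [map_sub, map_smul, Finsupp.linearCombination_single, one_smul, sub_eq_zero]
    exact mk_swap (l₁.map e) (l₂.map e) (e a) (e b) (by simp [h]) (by simp [h']))

/-- The exterior product `det ℚ^S ⊗ det ℚ^T → det ℚ^{S ⊔ T}`, after passing to `n`-th tensor
powers. -/
def mul (n : ℕ) : DetPow n S →ₗ[ℚ] DetPow n T →ₗ[ℚ] DetPow n (S ⊕ T) :=
  PresMod.lift₂ (fun o o' => mk n (o.append o'))
    (by
      rintro _ ⟨l₁, l₂, a, b, o, o', h, h', rfl⟩ p
      simp only [map_sub, map_smul, Finsupp.linearCombination_single, one_smul, sub_eq_zero]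
      exact mk_swap (l₁.map Sum.inl) (l₂.map Sum.inl ++ p.list.map Sum.inr) (.inl a) (.inl b)
        (by simp [h]) (by simp [h']))
    (by
      rintro p _ ⟨l₁, l₂, a, b, o, o', h, h', rfl⟩
      simp only [map_sub, map_smul, Finsupp.linearCombination_single, one_smul, sub_eq_zero]
      exact mk_swap (p.list.map Sum.inl ++ l₁.map Sum.inr) (l₂.map Sum.inr) (.inr a) (.inr b)
        (by simp [h]) (by simp [h']))

/-- For `e : Fin 2 ⊔ T ≃ S` and `x = e (inl 0)`, `y = e (inl 1)`, this is the isomorphism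
`(x ∧ y ∧ -)^{⊗ n}` from `(det ℚ^T)^{⊗ n}` to `(det ℚ^S)^{⊗ n}`. The effect of the contraction
`S → T` matching `(x, y)` is its inverse. -/
def wedge (n : ℕ) (e : Fin 2 ⊕ T ≃ S) : DetPow n T →ₗ[ℚ] DetPow n S :=
  relabel n e ∘ₗ mul n (mk n (Ordering.fin 2))

@[simp] theorem relabel_mk (e : S ≃ T) (o : Ordering S) :
    relabel n e (mk n o) = mk n (o.relabel e) := by simp [relabel]

@[simp] theorem mul_mk (o : Ordering S) (o' : Ordering T) :
    mul n (mk n o) (mk n o') = mk n (o.append o') := by simp [mul]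

@[simp] theorem wedge_mk (e : Fin 2 ⊕ T ≃ S) (o : Ordering T) :
    wedge n e (mk n o) = mk n (((Ordering.fin 2).append o).relabel e) := by simp [wedge]

end DetPow


/-! ### The functor `P(-, V)'_{≥ 0}` of labelled partitions -/

section Partitions

variable {V : Type*} [CommRing V] [Algebra ℚ V]

/-- A partition of `S`, given as the family of fibres (possibly empty) of a map `part : S → I` to a
finite set, with each part `i` labelled by a homogeneous element `lab i` of `V` of degree `deg i`,
such that each part has strictly positive degree `deg i + n (|part i| - 2)`. So parts of size `0`,
`1`, `2` have labels of degree `> 2n`, `> n`, `> 0` respectively. -/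
structure LPart (𝒱 : ℕ → Submodule ℚ V) (n : ℕ) (S : Type) where
  I : Type
  fin : Finite I
  part : S → I
  deg : I → ℕ
  lab : I → V
  lab_mem : ∀ i, lab i ∈ 𝒱 (deg i)
  pos : ∀ i, 2 * n < deg i + n * Nat.card {s // part s = i}

namespace LPart

variable {𝒱 : ℕ → Submodule ℚ V} {n : ℕ} {S T U : Type}

/-- The number of elements of the part `i`. -/
def size (A : LPart 𝒱 n S) (i : A.I) : ℕ := Nat.card {s // A.part s = i}

/-- The degree of a labelled partition is the sum of the degrees `|c_i| + n (|P_i| - 2)` of its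
parts (the subtraction does not truncate, as these are positive). -/
def degree (A : LPart 𝒱 n S) : ℕ := ∑ᶠ i, (A.deg i + n * A.size i - 2 * n)

/-- Two labelled partitions are the same if they differ by a bijection of the indexing sets. -/
def Iso (A B : LPart 𝒱 n S) : Prop :=
  ∃ φ : A.I ≃ B.I, (∀ s, B.part s = φ (A.part s)) ∧
    ∀ i, B.deg (φ i) = A.deg i ∧ B.lab (φ i) = A.lab i

open Classical in
/-- Replace the label of the part `i` by another one of the same degree. -/
def upd (A : LPart 𝒱 n S) (i : A.I) (x : V) (hx : x ∈ 𝒱 (A.deg i)) : LPart 𝒱 n S where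
  I := A.I
  fin := A.fin
  part := A.part
  deg := A.deg
  lab j := if j = i then x else A.lab j
  lab_mem j := by
    split_ifs with h
    · exact h ▸ hx
    · exact A.lab_mem j
  pos := A.pos

/-- The effect of a bijection. -/
def relabel (σ : S ≃ T) (A : LPart 𝒱 n S) : LPart 𝒱 n T where
  I := A.I
  fin := A.fin
  part t := A.part (σ.symm t)
  deg := A.deg
  lab := A.lab
  lab_mem := A.lab_mem
  pos i := by
    rw [Nat.card_congr (σ.symm.subtypeEquiv (q := fun s => A.part s = i) fun _ => Iff.rfl)]
    exact A.pos i

theorem card_sum_subtype [Finite S] [Finite T] (p : S ⊕ T → Prop) :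
    Nat.card {s // p s} = Nat.card {s // p (.inl s)} + Nat.card {t // p (.inr t)} := by
  rw [← Nat.card_sum]
  exact Nat.card_congr Equiv.subtypeSum

open Classical in
theorem card_contract [Finite T] (σ : Fin 2 ⊕ T ≃ S) {I : Type*} (part : S → I) (i : I) :
    Nat.card {s // part s = i} =
      ((if part (σ (.inl 0)) = i then 1 else 0) + (if part (σ (.inl 1)) = i then 1 else 0)) +
        Nat.card {t // part (σ (.inr t)) = i} := by
  rw [← Nat.card_congr (σ.subtypeEquiv (p := fun z => part (σ z) = i) fun _ => Iff.rfl),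
    card_sum_subtype, Nat.card_eq_fintype_card, Fintype.card_subtype, Finset.card_filter,
    Fin.sum_univ_two]

/-- Disjoint union of labelled partitions. -/
def sum [Finite S] [Finite T] (A : LPart 𝒱 n S) (B : LPart 𝒱 n T) : LPart 𝒱 n (S ⊕ T) where
  I := A.I ⊕ B.I
  fin := by have := A.fin; have := B.fin; infer_instance
  part := Sum.map A.part B.part
  deg := Sum.elim A.deg B.deg
  lab := Sum.elim A.lab B.lab
  lab_mem := by rintro (i | i); exacts [A.lab_mem i, B.lab_mem i]
  pos := by
    rintro (i | i)
    · rw [card_sum_subtype]; simpa using A.pos i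
    · rw [card_sum_subtype]; simpa using B.pos i

/-- The partition of the empty set with no parts. -/
def empty (𝒱 : ℕ → Submodule ℚ V) (n : ℕ) : LPart 𝒱 n Empty where
  I := Empty
  fin := inferInstance
  part := id
  deg := Empty.elim
  lab := Empty.elim
  lab_mem i := i.elim
  pos i := i.elim

/-- The partition of `S` with a single part, labelled by `c`. -/
def single (n : ℕ) (S : Type) (d : ℕ) (c : V) (hc : c ∈ 𝒱 d) (hpos : 2 * n < d + n * Nat.card S) :
    LPart 𝒱 n S where
  I := Unit
  fin := inferInstance
  part _ := ()
  deg _ := d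
  lab _ := c
  lab_mem _ := hc
  pos i := by
    have h : Nat.card {s : S // () = i} = Nat.card S :=
      Nat.card_congr (Equiv.subtypeUnivEquiv fun _ => rfl)
    rw [h]; exact hpos

variable [GradedAlgebra 𝒱]

open Classical in
/-- Contraction of a pair `x, y` of elements in the same part: they are removed from this part, and
its label is multiplied by `e`. -/
def loop [Finite T] (e : 𝒱 (2 * n)) (σ : Fin 2 ⊕ T ≃ S) (A : LPart 𝒱 n S)
    (h : A.part (σ (.inl 0)) = A.part (σ (.inl 1))) : LPart 𝒱 n T where
  I := A.I
  fin := A.fin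
  part t := A.part (σ (.inr t))
  deg i := if i = A.part (σ (.inl 0)) then 2 * n + A.deg i else A.deg i
  lab i := if i = A.part (σ (.inl 0)) then e * A.lab i else A.lab i
  lab_mem i := by
    split_ifs
    · exact SetLike.mul_mem_graded e.2 (A.lab_mem i)
    · exact A.lab_mem i
  pos i := by
    have h₁ := A.pos i
    rw [card_contract σ, ← h] at h₁
    by_cases hi : A.part (σ (.inl 0)) = i
    · simp only [if_pos hi, if_pos hi.symm] at h₁ ⊢
      rw [mul_add] at h₁
      omega
    · simp only [if_neg hi, if_neg (Ne.symm hi)] at h₁ ⊢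
      simpa using h₁

open Classical in
/-- Contraction of a pair `x, y` of elements in different parts: these parts are merged (and the
merged part is indexed by the index of the part of `x`), `x` and `y` are removed, and the labels are
multiplied. -/
def merge [Finite T] (σ : Fin 2 ⊕ T ≃ S) (A : LPart 𝒱 n S)
    (h : A.part (σ (.inl 0)) ≠ A.part (σ (.inl 1))) : LPart 𝒱 n T where
  I := {i : A.I // i ≠ A.part (σ (.inl 1))}
  fin := by have := A.fin; infer_instance
  part t := if ht : A.part (σ (.inr t)) = A.part (σ (.inl 1)) then ⟨A.part (σ (.inl 0)), h⟩
    else ⟨A.part (σ (.inr t)), ht⟩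
  deg i := if i.1 = A.part (σ (.inl 0)) then A.deg i + A.deg (A.part (σ (.inl 1))) else A.deg i
  lab i := if i.1 = A.part (σ (.inl 0)) then A.lab i * A.lab (A.part (σ (.inl 1))) else A.lab i
  lab_mem i := by
    split_ifs
    · exact SetLike.mul_mem_graded (A.lab_mem _) (A.lab_mem _)
    · exact A.lab_mem i
  pos i := by
    obtain ⟨i, hi⟩ := i
    have h₁ := A.pos i
    have h₂ := A.pos (A.part (σ (.inl 1)))
    rw [card_contract σ] at h₁ h₂
    simp only [if_neg hi.symm, if_neg h, if_true] at h₁ h₂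
    by_cases hx : i = A.part (σ (.inl 0))
    · subst hx
      have hc : Nat.card {t // (if ht : A.part (σ (.inr t)) = A.part (σ (.inl 1)) then
          (⟨A.part (σ (.inl 0)), h⟩ : {i : A.I // i ≠ A.part (σ (.inl 1))})
          else ⟨A.part (σ (.inr t)), ht⟩) = ⟨A.part (σ (.inl 0)), hi⟩} =
          Nat.card {t // A.part (σ (.inr t)) = A.part (σ (.inl 0))} +
          Nat.card {t // A.part (σ (.inr t)) = A.part (σ (.inl 1))} := by
        rw [← Nat.card_sum]
        refine Nat.card_congr (Equiv.trans (Equiv.subtypeEquivRight fun t => ?_)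
          (subtypeOrEquiv _ _ ?_))
        · by_cases ht : A.part (σ (.inr t)) = A.part (σ (.inl 1)) <;> simp [ht]
        · rw [Pi.disjoint_iff]
          intro t
          rw [Prop.disjoint_iff]
          rintro ⟨h₁, h₂⟩
          exact h (h₁.symm.trans h₂)
      rw [hc]
      simp only [if_true, mul_add] at h₁ h₂ ⊢
      omega
    · have hc : Nat.card {t // (if ht : A.part (σ (.inr t)) = A.part (σ (.inl 1)) then
          (⟨A.part (σ (.inl 0)), h⟩ : {i : A.I // i ≠ A.part (σ (.inl 1))})
          else ⟨A.part (σ (.inr t)), ht⟩) = ⟨i, hi⟩} =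
          Nat.card {t // A.part (σ (.inr t)) = i} := by
        refine Nat.card_congr (Equiv.subtypeEquivRight fun t => ?_)
        by_cases ht : A.part (σ (.inr t)) = A.part (σ (.inl 1))
        · simp [ht, Ne.symm hx, Ne.symm hi]
        · simp [ht]
      rw [hc]
      simp only [if_neg hx, if_neg (Ne.symm hx)] at h₁ ⊢
      simpa using h₁

theorem merge_part_pos [Finite T] (σ : Fin 2 ⊕ T ≃ S) (A : LPart 𝒱 n S)
    (h : A.part (σ (.inl 0)) ≠ A.part (σ (.inl 1))) {t : T}
    (ht : A.part (σ (.inr t)) = A.part (σ (.inl 1))) :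
    (A.merge σ h).part t = ⟨A.part (σ (.inl 0)), h⟩ := dif_pos ht

theorem merge_part_neg [Finite T] (σ : Fin 2 ⊕ T ≃ S) (A : LPart 𝒱 n S)
    (h : A.part (σ (.inl 0)) ≠ A.part (σ (.inl 1))) {t : T}
    (ht : A.part (σ (.inr t)) ≠ A.part (σ (.inl 1))) :
    (A.merge σ h).part t = ⟨A.part (σ (.inr t)), ht⟩ := dif_neg ht

open Classical in
/-- The effect of the contraction `S → T` matching the pair `x = σ (inl 0)`, `y = σ (inl 1)`, where
`σ : Fin 2 ⊔ T ≃ S`. -/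
def contract [Finite T] (e : 𝒱 (2 * n)) (σ : Fin 2 ⊕ T ≃ S) (A : LPart 𝒱 n S) : LPart 𝒱 n T :=
  if h : A.part (σ (.inl 0)) = A.part (σ (.inl 1)) then A.loop e σ h else A.merge σ h

end LPart

/-- The relations between labelled partitions: they only matter up to a bijection of the indexing
sets, and are linear in each label. -/
def partRel (𝒱 : ℕ → Submodule ℚ V) (n : ℕ) (S : Type) : Set (LPart 𝒱 n S →₀ ℚ) :=
  {r | ∃ A B : LPart 𝒱 n S, A.Iso B ∧ r = Finsupp.single A 1 - Finsupp.single B 1} ∪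
  {r | ∃ (A : LPart 𝒱 n S) (i : A.I) (s t : ℚ) (x y : V) (hx : x ∈ 𝒱 (A.deg i))
      (hy : y ∈ 𝒱 (A.deg i)),
      r = Finsupp.single
          (A.upd i (s • x + t • y) (add_mem (Submodule.smul_mem _ s hx) (Submodule.smul_mem _ t hy))) 1
        - (s • Finsupp.single (A.upd i x hx) 1 + t • Finsupp.single (A.upd i y hy) 1)}

/-- `P(S, V)'_{≥ 0}`. -/
abbrev PP (𝒱 : ℕ → Submodule ℚ V) (n : ℕ) (S : Type) := PresMod (partRel 𝒱 n S)

namespace PP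

variable {𝒱 : ℕ → Submodule ℚ V} {n : ℕ} {S T U : Type}

/-- The class of a labelled partition. -/
abbrev mk (A : LPart 𝒱 n S) : PP 𝒱 n S := PresMod.mk (partRel 𝒱 n S) A

theorem mk_iso {A B : LPart 𝒱 n S} (h : A.Iso B) : mk A = mk B := by
  have := PresMod.proj_rel (relX := partRel 𝒱 n S) (Or.inl ⟨A, B, h, rfl⟩)
  rwa [map_sub, sub_eq_zero] at this

theorem mk_upd (A : LPart 𝒱 n S) (i : A.I) (s t : ℚ) (x y : V) (hx : x ∈ 𝒱 (A.deg i))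
    (hy : y ∈ 𝒱 (A.deg i)) (h) :
    mk (A.upd i (s • x + t • y) h) = s • mk (A.upd i x hx) + t • mk (A.upd i y hy) := by
  have := PresMod.proj_rel (relX := partRel 𝒱 n S) (Or.inr ⟨A, i, s, t, x, y, hx, hy, rfl⟩)
  rwa [map_sub, map_add, map_smul, map_smul, sub_eq_zero] at this

theorem mk_lab {I : Type} {fin : Finite I} {part : S → I} {deg : I → ℕ} {lab lab' : I → V}
    {h₁ : ∀ i, lab i ∈ 𝒱 (deg i)} {h₁' : ∀ i, lab' i ∈ 𝒱 (deg i)} {h₂} (h : lab = lab') :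
    mk (⟨I, fin, part, deg, lab, h₁, h₂⟩ : LPart 𝒱 n S) =
      mk ⟨I, fin, part, deg, lab', h₁', h₂⟩ := by
  subst h; rfl

/-- A criterion for an operation on labelled partitions to be compatible with the relations. -/
theorem rel_of {f : LPart 𝒱 n S → PP 𝒱 n T} (h₁ : ∀ A B, A.Iso B → f A = f B)
    (h₂ : ∀ (A : LPart 𝒱 n S) (i : A.I), ∃ (B : LPart 𝒱 n T) (j : B.I) (L : V →ₗ[ℚ] V),
      ∀ x hx, ∃ hx', f (A.upd i x hx) = mk (B.upd j (L x) hx')) :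
    ∀ r ∈ partRel 𝒱 n S, Finsupp.linearCombination ℚ f r = 0 := by
  rintro _ (⟨A, B, h, rfl⟩ | ⟨A, i, s, t, x, y, hx, hy, rfl⟩)
  · simp [h₁ A B h]
  · obtain ⟨B, j, L, hL⟩ := h₂ A i
    obtain ⟨hx', ex⟩ := hL x hx
    obtain ⟨hy', ey⟩ := hL y hy
    obtain ⟨hz', ez⟩ := hL (s • x + t • y)
      (add_mem (Submodule.smul_mem _ s hx) (Submodule.smul_mem _ t hy))
    simp only [map_sub, map_add, map_smul, Finsupp.linearCombination_single, one_smul,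
      sub_eq_zero, ex, ey, ez]
    rw [← mk_upd]

/-- The effect of a bijection. -/
def relabel (σ : S ≃ T) : PP 𝒱 n S →ₗ[ℚ] PP 𝒱 n T :=
  PresMod.lift (fun A => mk (A.relabel σ)) <| rel_of
    (by rintro A B ⟨φ, h₁, h₂⟩; exact mk_iso ⟨φ, fun t => h₁ _, h₂⟩)
    (fun A i => ⟨A.relabel σ, i, LinearMap.id, fun x hx => ⟨hx, rfl⟩⟩)

@[simp] theorem relabel_mk (σ : S ≃ T) (A : LPart 𝒱 n S) :
    relabel σ (mk A) = mk (A.relabel σ) := by simp [relabel]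

/-- Disjoint union of labelled partitions, as a lax monoidality
`P(S, V)'_{≥ 0} ⊗ P(T, V)'_{≥ 0} → P(S ⊔ T, V)'_{≥ 0}`. -/
def mul [Finite S] [Finite T] : PP 𝒱 n S →ₗ[ℚ] PP 𝒱 n T →ₗ[ℚ] PP 𝒱 n (S ⊕ T) :=
  PresMod.lift₂ (fun A B => mk (A.sum B))
    (fun r hr B => rel_of (f := fun A => mk (A.sum B))
      (by
        rintro A A' ⟨φ, h₁, h₂⟩
        refine mk_iso ⟨φ.sumCongr (Equiv.refl _), ?_, ?_⟩
        · rintro (s | s)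
          exacts [congrArg Sum.inl (h₁ s), rfl]
        · rintro (i | i)
          exacts [h₂ i, ⟨rfl, rfl⟩])
      (fun A i => ⟨A.sum B, .inl i, LinearMap.id, fun x hx => ⟨hx, mk_lab (by
        funext (j : A.I ⊕ B.I)
        rcases j with j | j
        · by_cases h : j = i
          · exact (if_pos h).trans (if_pos (congrArg Sum.inl h)).symm
          · exact (if_neg h).trans (if_neg (fun hh => h (Sum.inl_injective hh))).symm
        · exact (if_neg (by simp)).symm)⟩⟩) r hr)
    (fun A => rel_of
      (by
        rintro B B' ⟨φ, h₁, h₂⟩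
        refine mk_iso ⟨(Equiv.refl _).sumCongr φ, ?_, ?_⟩
        · rintro (s | s)
          exacts [rfl, congrArg Sum.inr (h₁ s)]
        · rintro (i | i)
          exacts [⟨rfl, rfl⟩, h₂ i])
      (fun B i => ⟨A.sum B, .inr i, LinearMap.id, fun x hx => ⟨hx, mk_lab (by
        funext (j : A.I ⊕ B.I)
        rcases j with j | j
        · exact (if_neg (by simp)).symm
        · by_cases h : j = i
          · exact (if_pos h).trans (if_pos (congrArg Sum.inr h)).symm
          · exact (if_neg h).trans (if_neg (fun hh => h (Sum.inr_injective hh))).symm)⟩⟩))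

@[simp] theorem mul_mk [Finite S] [Finite T] (A : LPart 𝒱 n S) (B : LPart 𝒱 n T) :
    mul (mk A) (mk B) = mk (A.sum B) := by simp [mul]

variable [GradedAlgebra 𝒱]

theorem contract_iso [Finite T] (e : 𝒱 (2 * n)) (σ : Fin 2 ⊕ T ≃ S) (A B : LPart 𝒱 n S)
    (hAB : A.Iso B) : mk (A.contract e σ) = mk (B.contract e σ) := by
  classical
  obtain ⟨φ, h₁, h₂⟩ := hAB
  by_cases h : A.part (σ (.inl 0)) = A.part (σ (.inl 1))
  · have h' : B.part (σ (.inl 0)) = B.part (σ (.inl 1)) := by rw [h₁, h₁, h]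
    simp only [LPart.contract, dif_pos h, dif_pos h']
    refine mk_iso ⟨φ, fun _ => h₁ _, fun (i : A.I) => ?_⟩
    change (if φ i = B.part (σ (.inl 0)) then 2 * n + B.deg (φ i) else B.deg (φ i)) =
        (if i = A.part (σ (.inl 0)) then 2 * n + A.deg i else A.deg i) ∧
      (if φ i = B.part (σ (.inl 0)) then (e : V) * B.lab (φ i) else B.lab (φ i)) =
        (if i = A.part (σ (.inl 0)) then (e : V) * A.lab i else A.lab i)
    simp only [h₁, (h₂ _).1, (h₂ _).2, EmbeddingLike.apply_eq_iff_eq, and_self]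
  · have h' : B.part (σ (.inl 0)) ≠ B.part (σ (.inl 1)) := by
      rw [h₁, h₁]; exact fun hh => h (φ.injective hh)
    simp only [LPart.contract, dif_neg h, dif_neg h']
    let ψ : {i : A.I // i ≠ A.part (σ (.inl 1))} ≃ {i : B.I // i ≠ B.part (σ (.inl 1))} :=
      φ.subtypeEquiv fun i => by rw [h₁]; simp
    refine mk_iso ⟨ψ, fun t => ?_, ?_⟩
    · by_cases ht : A.part (σ (.inr t)) = A.part (σ (.inl 1))
      · have ht' : B.part (σ (.inr t)) = B.part (σ (.inl 1)) := by rw [h₁, h₁, ht]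
        simp only [LPart.merge, dif_pos ht, dif_pos ht']
        exact Subtype.ext (h₁ _)
      · have ht' : B.part (σ (.inr t)) ≠ B.part (σ (.inl 1)) := by
          rw [h₁, h₁]; exact fun hh => ht (φ.injective hh)
        simp only [LPart.merge, dif_neg ht, dif_neg ht']
        exact Subtype.ext (h₁ _)
    · rintro ⟨i, hi⟩
      change (if φ i = B.part (σ (.inl 0)) then B.deg (φ i) + B.deg (B.part (σ (.inl 1)))
            else B.deg (φ i)) =
          (if i = A.part (σ (.inl 0)) then A.deg i + A.deg (A.part (σ (.inl 1))) else A.deg i) ∧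
        (if φ i = B.part (σ (.inl 0)) then B.lab (φ i) * B.lab (B.part (σ (.inl 1)))
            else B.lab (φ i)) =
          (if i = A.part (σ (.inl 0)) then A.lab i * A.lab (A.part (σ (.inl 1))) else A.lab i)
      simp only [h₁, (h₂ _).1, (h₂ _).2, EmbeddingLike.apply_eq_iff_eq, and_self]

theorem contract_upd [Finite T] (e : 𝒱 (2 * n)) (σ : Fin 2 ⊕ T ≃ S) (A : LPart 𝒱 n S) (i : A.I) :
    ∃ (B : LPart 𝒱 n T) (j : B.I) (L : V →ₗ[ℚ] V),
      ∀ x hx, ∃ hx', mk ((A.upd i x hx).contract e σ) = mk (B.upd j (L x) hx') := by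
  classical
  by_cases h : A.part (σ (.inl 0)) = A.part (σ (.inl 1))
  · by_cases hi : i = A.part (σ (.inl 0))
    · refine ⟨A.loop e σ h, i, LinearMap.mulLeft ℚ (e : V), fun x hx => ⟨?_, ?_⟩⟩
      · simp only [LPart.loop, if_pos hi]
        exact SetLike.mul_mem_graded e.2 hx
      · refine (congrArg mk (dif_pos h)).trans (mk_lab ?_)
        funext (j : A.I)
        simp only [LPart.loop, LPart.upd]
        by_cases hj : j = i
        · subst hj; simp [hi]
        · simp [hj]
    · refine ⟨A.loop e σ h, i, LinearMap.id, fun x hx => ⟨?_, ?_⟩⟩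
      · simp only [LPart.loop, if_neg hi]
        exact hx
      · refine (congrArg mk (dif_pos h)).trans (mk_lab ?_)
        funext (j : A.I)
        simp only [LPart.loop, LPart.upd]
        by_cases hj : j = i
        · subst hj; simp [hi]
        · simp [hj]
  · by_cases hi : i = A.part (σ (.inl 1))
    · subst hi
      refine ⟨A.merge σ h, ⟨A.part (σ (.inl 0)), h⟩,
        LinearMap.mulLeft ℚ (A.lab (A.part (σ (.inl 0)))), fun x hx => ⟨?_, ?_⟩⟩
      · simp only [LPart.merge, if_true]
        exact SetLike.mul_mem_graded (A.lab_mem _) hx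
      · refine (congrArg mk (dif_neg h)).trans (mk_lab ?_)
        funext (j : {j : A.I // j ≠ A.part (σ (.inl 1))})
        obtain ⟨j, hj'⟩ := j
        simp only [LPart.merge, LPart.upd]
        by_cases hj : j = A.part (σ (.inl 0))
        · subst hj; simp [h]
        · simp [hj, hj']
    · by_cases hi' : i = A.part (σ (.inl 0))
      · subst hi'
        refine ⟨A.merge σ h, ⟨A.part (σ (.inl 0)), hi⟩,
          LinearMap.mulRight ℚ (A.lab (A.part (σ (.inl 1)))), fun x hx => ⟨?_, ?_⟩⟩
        · simp only [LPart.merge, if_true]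
          exact SetLike.mul_mem_graded hx (A.lab_mem _)
        · refine (congrArg mk (dif_neg h)).trans (mk_lab ?_)
          funext (j : {j : A.I // j ≠ A.part (σ (.inl 1))})
          obtain ⟨j, hj'⟩ := j
          simp only [LPart.merge, LPart.upd]
          by_cases hj : j = A.part (σ (.inl 0))
          · subst hj; simp [Ne.symm h]
          · simp [hj]
      · refine ⟨A.merge σ h, ⟨i, hi⟩, LinearMap.id, fun x hx => ⟨?_, ?_⟩⟩
        · simp only [LPart.merge, if_neg hi']
          exact hx
        · refine (congrArg mk (dif_neg h)).trans (mk_lab ?_)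
          funext (j : {j : A.I // j ≠ A.part (σ (.inl 1))})
          obtain ⟨j, hj'⟩ := j
          simp only [LPart.merge, LPart.upd]
          by_cases hj : j = i
          · subst hj; simp [hi']
          · simp [hj, Ne.symm hi]

/-- The effect of the contraction `S → T` matching the pair `σ (inl 0)`, `σ (inl 1)`. -/
def contract [Finite T] (e : 𝒱 (2 * n)) (σ : Fin 2 ⊕ T ≃ S) : PP 𝒱 n S →ₗ[ℚ] PP 𝒱 n T :=
  PresMod.lift (fun A => mk (A.contract e σ)) (rel_of (contract_iso e σ) (contract_upd e σ))

@[simp] theorem contract_mk [Finite T] (e : 𝒱 (2 * n)) (σ : Fin 2 ⊕ T ≃ S) (A : LPart 𝒱 n S) :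
    contract e σ (mk A) = mk (A.contract e σ) := by simp [contract]

end PP

end Partitions


/-! ### Compatibility of the structure maps with products -/

/-- The contraction of a pair in `S`, extended by the identity of `U`, from `S ⊔ U` to `T ⊔ U`. -/
def contrL {S T : Type} (U : Type) (σ : Fin 2 ⊕ T ≃ S) : Fin 2 ⊕ (T ⊕ U) ≃ S ⊕ U :=
  (Equiv.sumAssoc _ _ _).symm.trans (σ.sumCongr (Equiv.refl U))

/-- The contraction of a pair in `S`, extended by the identity of `U`, from `U ⊔ S` to `U ⊔ T`. -/
def contrR {S T : Type} (U : Type) (σ : Fin 2 ⊕ T ≃ S) : Fin 2 ⊕ (U ⊕ T) ≃ U ⊕ S where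
  toFun := Sum.elim (fun i => .inr (σ (.inl i))) (Sum.map id fun t => σ (.inr t))
  invFun := Sum.elim (fun u => .inr (.inl u)) fun s => Sum.map id Sum.inr (σ.symm s)
  left_inv := by rintro (i | u | t) <;> simp
  right_inv := by
    rintro (u | s)
    · rfl
    · obtain ⟨i | t, rfl⟩ := σ.surjective s <;> simp

namespace KDual

variable {g : ℕ} {S T U : Type}

/-- The unit of the monoidality. -/
def one (g : ℕ) : KDual g Empty := MultilinearMap.constOfIsEmpty ℚ _ 1

theorem relabel_mul (σ : S ≃ T) (ξ : KDual g T) (η : KDual g U) :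
    mul (relabel σ ξ) η = relabel (σ.sumCongr (Equiv.refl U)) (mul ξ η) := by
  ext u
  rw [mul_apply, relabel_apply, relabel_apply, mul_apply]
  rfl

theorem mul_relabel (σ : S ≃ T) (ξ : KDual g T) (η : KDual g U) :
    mul η (relabel σ ξ) = relabel ((Equiv.refl U).sumCongr σ) (mul η ξ) := by
  ext u
  rw [mul_apply, relabel_apply, relabel_apply, mul_apply]
  rfl

theorem contract_mul (n : ℕ) (σ : Fin 2 ⊕ T ≃ S) (ξ : KDual g T) (η : KDual g U) :
    mul (contract n σ ξ) η = contract n (contrL U σ) (mul ξ η) := by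
  ext u
  rw [mul_apply, contract_apply, contract_apply, mul_apply, mul_assoc]
  rfl

theorem mul_contract (n : ℕ) (σ : Fin 2 ⊕ T ≃ S) (ξ : KDual g T) (η : KDual g U) :
    mul η (contract n σ ξ) = contract n (contrR U σ) (mul η ξ) := by
  ext; simp [contrR, mul_left_comm]

theorem mul_assoc' (ξ : KDual g S) (η : KDual g T) (ζ : KDual g U) :
    mul (mul ξ η) ζ = relabel (Equiv.sumAssoc S T U) (mul ξ (mul η ζ)) := by
  ext u
  simp only [mul_apply, relabel_apply, mul_assoc]
  rfl

theorem one_mul' (ξ : KDual g S) : mul (one g) ξ = relabel (Equiv.emptySum Empty S) ξ := by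
  ext u
  rw [mul_apply, relabel_apply]
  exact one_mul _

theorem mul_one' (ξ : KDual g S) : mul ξ (one g) = relabel (Equiv.sumEmpty S Empty) ξ := by
  ext u
  rw [mul_apply, relabel_apply]
  exact mul_one _

end KDual

namespace DetPow

variable {n : ℕ} {S T U : Type}

theorem relabel_mul (σ : S ≃ T) (w : DetPow n S) (v : DetPow n U) :
    relabel n (σ.sumCongr (Equiv.refl U)) (mul n w v) = mul n (relabel n σ w) v := by
  have : (mul n).compr₂ (relabel n (σ.sumCongr (Equiv.refl U))) =
      (mul n (T := U)).comp (relabel n σ) := by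
    refine PresMod.ext fun o => PresMod.ext fun o' => ?_
    simp only [LinearMap.compr₂_apply, LinearMap.comp_apply, mul_mk, relabel_mk]
    exact congrArg (mk n) (Ordering.ext (by simp [Function.comp_def]))
  exact LinearMap.congr_fun₂ this w v

theorem mul_relabel (σ : S ≃ T) (w : DetPow n S) (v : DetPow n U) :
    relabel n ((Equiv.refl U).sumCongr σ) (mul n v w) = mul n v (relabel n σ w) := by
  have : (mul n).compr₂ (relabel n ((Equiv.refl U).sumCongr σ)) =
      (mul n).compl₂ (relabel n σ) := by
    refine PresMod.ext fun o => PresMod.ext fun o' => ?_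
    simp only [LinearMap.compr₂_apply, LinearMap.compl₂_apply, mul_mk, relabel_mk]
    exact congrArg (mk n) (Ordering.ext (by simp [Function.comp_def]))
  exact LinearMap.congr_fun₂ this v w

theorem wedge_mul (σ : Fin 2 ⊕ T ≃ S) (w : DetPow n T) (v : DetPow n U) :
    wedge n (contrL U σ) (mul n w v) = mul n (wedge n σ w) v := by
  have : (mul n).compr₂ (wedge n (contrL U σ)) = (mul n).comp (wedge n σ) := by
    refine PresMod.ext fun o => PresMod.ext fun o' => ?_
    simp only [LinearMap.compr₂_apply, LinearMap.comp_apply, mul_mk, wedge_mk]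
    exact congrArg (mk n) (Ordering.ext (by simp [Function.comp_def, contrL]))
  exact LinearMap.congr_fun₂ this w v

/-- Moving a pair of adjacent elements to the front does not change the sign. -/
theorem mk_move (l l' m : List S) (a b : S) (o o' : Ordering S)
    (h : o.list = m ++ a :: b :: (l ++ l')) (h' : o'.list = m ++ l ++ a :: b :: l') :
    mk n o = mk n o' := by
  induction l generalizing m o with
  | nil => congr 1; ext1; simp [h, h']
  | cons c l ih =>
    have key : ∀ (l₁ l₂ : List S) (x y : S) (p : Ordering S), p.list = l₁ ++ x :: y :: l₂ →
        ∃ p' : Ordering S, p'.list = l₁ ++ y :: x :: l₂ ∧ mk n p = (-1 : ℚ) ^ n • mk n p' := by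
      intro l₁ l₂ x y p hp
      have hperm : (l₁ ++ y :: x :: l₂).Perm p.list := by
        rw [hp]; exact (List.Perm.swap x y l₂).append_left l₁
      refine ⟨⟨_, hperm.nodup_iff.2 p.nodup, fun s => hperm.mem_iff.2 (p.mem s)⟩, rfl, ?_⟩
      exact mk_swap _ _ _ _ hp rfl
    obtain ⟨p, hp, e₁⟩ := key (m ++ [a]) (l ++ l') b c o (by simp [h])
    obtain ⟨q, hq, e₂⟩ := key m (b :: (l ++ l')) a c p (by simp [hp])
    rw [e₁, e₂, smul_smul, ← mul_pow, ih (m ++ [c]) q (by simp [hq]) (by simp [h'])]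
    simp

theorem mul_wedge (σ : Fin 2 ⊕ T ≃ S) (w : DetPow n T) (v : DetPow n U) :
    wedge n (contrR U σ) (mul n v w) = mul n v (wedge n σ w) := by
  have : (mul n).compr₂ (wedge n (contrR U σ)) = (mul n).compl₂ (wedge n σ) := by
    refine PresMod.ext fun o => PresMod.ext fun o' => ?_
    simp only [LinearMap.compr₂_apply, LinearMap.compl₂_apply, mul_mk, wedge_mk]
    refine mk_move (o.list.map Sum.inl) (o'.list.map fun t => .inr (σ (.inr t))) []
      (.inr (σ (.inl 0))) (.inr (σ (.inl 1))) _ _ ?_ ?_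
    · simp [contrR, List.finRange_succ, Function.comp_def]
    · simp [List.finRange_succ, Function.comp_def]
  exact LinearMap.congr_fun₂ this v w

theorem mul_assoc' (w : DetPow n S) (v : DetPow n T) (u : DetPow n U) :
    relabel n (Equiv.sumAssoc S T U) (mul n (mul n w v) u) = mul n w (mul n v u) := by
  have : ((mul n).compr₂ ((mul n (T := U)).compr₂ (relabel n (Equiv.sumAssoc S T U)))) =
      (LinearMap.lcomp ℚ _ (mul n (S := T) (T := U))).comp
        ((LinearMap.llcomp ℚ _ _ _).comp (mul n)) := by
    refine PresMod.ext fun o => PresMod.ext fun o' => PresMod.ext fun o'' => ?_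
    simp only [LinearMap.compr₂_apply, LinearMap.comp_apply, LinearMap.lcomp_apply,
      LinearMap.llcomp_apply, mul_mk, relabel_mk]
    exact congrArg (mk n) (Ordering.ext (by simp [Function.comp_def]))
  exact LinearMap.congr_fun (LinearMap.congr_fun₂ this w v) u

theorem one_mul' (w : DetPow n S) :
    relabel n (Equiv.emptySum Empty S) (mul n (mk n Ordering.nil) w) = w := by
  have : (relabel n (Equiv.emptySum Empty S)).comp (mul n (mk n Ordering.nil)) =
      LinearMap.id := by
    refine PresMod.ext fun o => ?_
    simp only [LinearMap.comp_apply, mul_mk, relabel_mk]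
    exact congrArg (mk n) (Ordering.ext (by simp [Function.comp_def]))
  exact LinearMap.congr_fun this w

theorem mul_one' (w : DetPow n S) :
    relabel n (Equiv.sumEmpty S Empty) (mul n w (mk n Ordering.nil)) = w := by
  have : (relabel n (Equiv.sumEmpty S Empty)).comp ((mul n).flip (mk n Ordering.nil)) =
      LinearMap.id := by
    refine PresMod.ext fun o => ?_
    simp only [LinearMap.comp_apply, LinearMap.flip_apply, mul_mk, relabel_mk]
    exact congrArg (mk n) (Ordering.ext (by simp [Function.comp_def]))
  exact LinearMap.congr_fun this w

end DetPow

namespace PP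

variable {V : Type*} [CommRing V] [Algebra ℚ V]
variable {𝒱 : ℕ → Submodule ℚ V} {n : ℕ} {S T U : Type}

theorem relabel_mul [Finite S] [Finite T] [Finite U] (σ : S ≃ T) (p : PP 𝒱 n S) (q : PP 𝒱 n U) :
    relabel (σ.sumCongr (Equiv.refl U)) (mul p q) = mul (relabel σ p) q := by
  have : mul.compr₂ (relabel (σ.sumCongr (Equiv.refl U))) =
      (mul (𝒱 := 𝒱) (n := n) (T := U)).comp (relabel σ) := by
    refine PresMod.ext fun A => PresMod.ext fun B => ?_
    simp only [LinearMap.compr₂_apply, LinearMap.comp_apply, mul_mk, relabel_mk]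
    refine mk_iso ⟨Equiv.refl _, ?_, fun _ => ⟨rfl, rfl⟩⟩
    rintro (t | u) <;> rfl
  exact LinearMap.congr_fun₂ this p q

theorem mul_relabel [Finite S] [Finite T] [Finite U] (σ : S ≃ T) (p : PP 𝒱 n S) (q : PP 𝒱 n U) :
    relabel ((Equiv.refl U).sumCongr σ) (mul q p) = mul q (relabel σ p) := by
  have : mul.compr₂ (relabel ((Equiv.refl U).sumCongr σ)) =
      (mul (𝒱 := 𝒱) (n := n) (S := U)).compl₂ (relabel σ) := by
    refine PresMod.ext fun A => PresMod.ext fun B => ?_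
    simp only [LinearMap.compr₂_apply, LinearMap.compl₂_apply, mul_mk, relabel_mk]
    refine mk_iso ⟨Equiv.refl _, ?_, fun _ => ⟨rfl, rfl⟩⟩
    rintro (t | u) <;> rfl
  exact LinearMap.congr_fun₂ this q p

theorem mul_assoc' [Finite S] [Finite T] [Finite U] (p : PP 𝒱 n S) (q : PP 𝒱 n T)
    (r : PP 𝒱 n U) :
    relabel (Equiv.sumAssoc S T U) (mul (mul p q) r) = mul p (mul q r) := by
  have : (mul.compr₂ ((mul (T := U)).compr₂ (relabel (Equiv.sumAssoc S T U)))) =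
      (LinearMap.lcomp ℚ _ (mul (𝒱 := 𝒱) (n := n) (S := T) (T := U))).comp
        ((LinearMap.llcomp ℚ _ _ _).comp mul) := by
    refine PresMod.ext fun A => PresMod.ext fun B => PresMod.ext fun C => ?_
    simp only [LinearMap.compr₂_apply, LinearMap.comp_apply, LinearMap.lcomp_apply,
      LinearMap.llcomp_apply, mul_mk, relabel_mk]
    refine mk_iso ⟨Equiv.sumAssoc _ _ _, ?_, ?_⟩
    · rintro (s | t | u) <;> rfl
    · rintro ((s | t) | u) <;> exact ⟨rfl, rfl⟩
  exact LinearMap.congr_fun (LinearMap.congr_fun₂ this p q) r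

theorem one_mul' [Finite S] (p : PP 𝒱 n S) :
    relabel (Equiv.emptySum Empty S) (mul (mk (LPart.empty 𝒱 n)) p) = p := by
  have : (relabel (Equiv.emptySum Empty S)).comp (mul (mk (LPart.empty 𝒱 n))) =
      LinearMap.id := by
    refine PresMod.ext fun A => ?_
    simp only [LinearMap.comp_apply, mul_mk, relabel_mk]
    refine mk_iso ⟨Equiv.emptySum Empty A.I, fun s => rfl, ?_⟩
    rintro (i | i)
    exacts [i.elim, ⟨rfl, rfl⟩]
  exact LinearMap.congr_fun this p

theorem mul_one' [Finite S] (p : PP 𝒱 n S) :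
    relabel (Equiv.sumEmpty S Empty) (mul p (mk (LPart.empty 𝒱 n))) = p := by
  have : (relabel (Equiv.sumEmpty S Empty)).comp (mul.flip (mk (LPart.empty 𝒱 n))) =
      LinearMap.id := by
    refine PresMod.ext fun A => ?_
    simp only [LinearMap.comp_apply, LinearMap.flip_apply, mul_mk, relabel_mk]
    refine mk_iso ⟨Equiv.sumEmpty A.I Empty, fun s => rfl, ?_⟩
    rintro (i | i)
    exacts [⟨rfl, rfl⟩, i.elim]
  exact LinearMap.congr_fun this p

variable [GradedAlgebra 𝒱]

theorem contract_sum_left [Finite S] [Finite T] [Finite U] (e : 𝒱 (2 * n)) (σ : Fin 2 ⊕ T ≃ S)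
    (A : LPart 𝒱 n S) (B : LPart 𝒱 n U) :
    mk ((A.sum B).contract e (contrL U σ)) = mk ((A.contract e σ).sum B) := by
  classical
  by_cases h : A.part (σ (.inl 0)) = A.part (σ (.inl 1))
  · have h' : (A.sum B).part (contrL U σ (.inl 0)) = (A.sum B).part (contrL U σ (.inl 1)) :=
      congrArg Sum.inl h
    simp only [LPart.contract, dif_pos h, dif_pos h']
    refine mk_iso ⟨Equiv.refl (A.I ⊕ B.I), ?_, ?_⟩
    · rintro (t | u) <;> rfl
    · rintro (i | i)
      · by_cases hi : i = A.part (σ (.inl 0))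
        · exact ⟨(if_pos hi).trans (if_pos (congrArg Sum.inl hi)).symm,
            (if_pos hi).trans (if_pos (congrArg Sum.inl hi)).symm⟩
        · have hi' : (Sum.inl i : A.I ⊕ B.I) ≠ Sum.inl (A.part (σ (.inl 0))) :=
            fun hh => hi (Sum.inl_injective hh)
          exact ⟨(if_neg hi).trans (if_neg hi').symm, (if_neg hi).trans (if_neg hi').symm⟩
      · have hi' : (Sum.inr i : A.I ⊕ B.I) ≠ Sum.inl (A.part (σ (.inl 0))) := by simp
        exact ⟨(if_neg hi').symm, (if_neg hi').symm⟩
  · have h' : (A.sum B).part (contrL U σ (.inl 0)) ≠ (A.sum B).part (contrL U σ (.inl 1)) :=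
      fun hh => h (Sum.inl_injective hh)
    simp only [LPart.contract, dif_neg h, dif_neg h']
    let ψ : {i : A.I ⊕ B.I // i ≠ Sum.inl (A.part (σ (.inl 1)))} ≃
        {i : A.I // i ≠ A.part (σ (.inl 1))} ⊕ B.I :=
      { toFun := fun i => match i with
          | ⟨.inl i, hi⟩ => .inl ⟨i, fun hh => hi (congrArg Sum.inl hh)⟩
          | ⟨.inr i, _⟩ => .inr i
        invFun := fun i => match i with
          | .inl i => ⟨.inl i.1, fun hh => i.2 (Sum.inl_injective hh)⟩
          | .inr i => ⟨.inr i, by simp⟩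
        left_inv := by rintro ⟨i | i, hi⟩ <;> rfl
        right_inv := by rintro (i | i) <;> rfl }
    refine mk_iso ⟨ψ, ?_, ?_⟩
    · rintro (t | u)
      · by_cases ht : A.part (σ (.inr t)) = A.part (σ (.inl 1))
        · have ht' : (A.sum B).part (contrL U σ (.inr (.inl t))) =
            (A.sum B).part (contrL U σ (.inl 1)) := congrArg Sum.inl ht
          exact (congrArg Sum.inl (A.merge_part_pos σ h ht)).trans
            (congrArg ψ (LPart.merge_part_pos _ _ h' ht')).symm
        · have ht' : (A.sum B).part (contrL U σ (.inr (.inl t))) ≠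
            (A.sum B).part (contrL U σ (.inl 1)) := fun hh => ht (Sum.inl_injective hh)
          exact (congrArg Sum.inl (A.merge_part_neg σ h ht)).trans
            (congrArg ψ (LPart.merge_part_neg _ _ h' ht')).symm
      · have ht' : (A.sum B).part (contrL U σ (.inr (.inr u))) ≠
            (A.sum B).part (contrL U σ (.inl 1)) := Sum.inr_ne_inl
        exact (congrArg ψ (LPart.merge_part_neg _ _ h' ht')).symm
    · rintro ⟨i | i, hi⟩
      · by_cases hx : i = A.part (σ (.inl 0))
        · have hx' : (Sum.inl i : A.I ⊕ B.I) = Sum.inl (A.part (σ (.inl 0))) :=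
            congrArg Sum.inl hx
          exact ⟨(if_pos hx).trans (if_pos hx').symm, (if_pos hx).trans (if_pos hx').symm⟩
        · have hx' : (Sum.inl i : A.I ⊕ B.I) ≠ Sum.inl (A.part (σ (.inl 0))) :=
            fun hh => hx (Sum.inl_injective hh)
          exact ⟨(if_neg hx).trans (if_neg hx').symm, (if_neg hx).trans (if_neg hx').symm⟩
      · have hx' : (Sum.inr i : A.I ⊕ B.I) ≠ Sum.inl (A.part (σ (.inl 0))) := Sum.inr_ne_inl
        exact ⟨(if_neg hx').symm, (if_neg hx').symm⟩

theorem contract_sum_right [Finite S] [Finite T] [Finite U] (e : 𝒱 (2 * n)) (σ : Fin 2 ⊕ T ≃ S)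
    (B : LPart 𝒱 n U) (A : LPart 𝒱 n S) :
    mk ((B.sum A).contract e (contrR U σ)) = mk (B.sum (A.contract e σ)) := by
  classical
  by_cases h : A.part (σ (.inl 0)) = A.part (σ (.inl 1))
  · have h' : (B.sum A).part (contrR U σ (.inl 0)) = (B.sum A).part (contrR U σ (.inl 1)) :=
      congrArg Sum.inr h
    simp only [LPart.contract, dif_pos h, dif_pos h']
    refine mk_iso ⟨Equiv.refl (B.I ⊕ A.I), ?_, ?_⟩
    · rintro (u | t) <;> rfl
    · rintro (i | i)
      rotate_left
      · by_cases hi : i = A.part (σ (.inl 0))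
        · exact ⟨(if_pos hi).trans (if_pos (congrArg Sum.inr hi)).symm,
            (if_pos hi).trans (if_pos (congrArg Sum.inr hi)).symm⟩
        · have hi' : (Sum.inr i : B.I ⊕ A.I) ≠ Sum.inr (A.part (σ (.inl 0))) :=
            fun hh => hi (Sum.inr_injective hh)
          exact ⟨(if_neg hi).trans (if_neg hi').symm, (if_neg hi).trans (if_neg hi').symm⟩
      · have hi' : (Sum.inl i : B.I ⊕ A.I) ≠ Sum.inr (A.part (σ (.inl 0))) := by simp
        exact ⟨(if_neg hi').symm, (if_neg hi').symm⟩
  · have h' : (B.sum A).part (contrR U σ (.inl 0)) ≠ (B.sum A).part (contrR U σ (.inl 1)) :=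
      fun hh => h (Sum.inr_injective hh)
    simp only [LPart.contract, dif_neg h, dif_neg h']
    let ψ : {i : B.I ⊕ A.I // i ≠ Sum.inr (A.part (σ (.inl 1)))} ≃
        B.I ⊕ {i : A.I // i ≠ A.part (σ (.inl 1))} :=
      { toFun := fun i => match i with
          | ⟨.inr i, hi⟩ => .inr ⟨i, fun hh => hi (congrArg Sum.inr hh)⟩
          | ⟨.inl i, _⟩ => .inl i
        invFun := fun i => match i with
          | .inr i => ⟨.inr i.1, fun hh => i.2 (Sum.inr_injective hh)⟩
          | .inl i => ⟨.inl i, by simp⟩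
        left_inv := by rintro ⟨i | i, hi⟩ <;> rfl
        right_inv := by rintro (i | i) <;> rfl }
    refine mk_iso ⟨ψ, ?_, ?_⟩
    · rintro (u | t)
      rotate_left
      · by_cases ht : A.part (σ (.inr t)) = A.part (σ (.inl 1))
        · have ht' : (B.sum A).part (contrR U σ (.inr (.inr t))) =
            (B.sum A).part (contrR U σ (.inl 1)) := congrArg Sum.inr ht
          exact (congrArg Sum.inr (A.merge_part_pos σ h ht)).trans
            (congrArg ψ (LPart.merge_part_pos _ _ h' ht')).symm
        · have ht' : (B.sum A).part (contrR U σ (.inr (.inr t))) ≠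
            (B.sum A).part (contrR U σ (.inl 1)) := fun hh => ht (Sum.inr_injective hh)
          exact (congrArg Sum.inr (A.merge_part_neg σ h ht)).trans
            (congrArg ψ (LPart.merge_part_neg _ _ h' ht')).symm
      · have ht' : (B.sum A).part (contrR U σ (.inr (.inl u))) ≠
            (B.sum A).part (contrR U σ (.inl 1)) := Sum.inl_ne_inr
        exact (congrArg ψ (LPart.merge_part_neg _ _ h' ht')).symm
    · rintro ⟨i | i, hi⟩
      rotate_left
      · by_cases hx : i = A.part (σ (.inl 0))
        · have hx' : (Sum.inr i : B.I ⊕ A.I) = Sum.inr (A.part (σ (.inl 0))) :=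
            congrArg Sum.inr hx
          exact ⟨(if_pos hx).trans (if_pos hx').symm, (if_pos hx).trans (if_pos hx').symm⟩
        · have hx' : (Sum.inr i : B.I ⊕ A.I) ≠ Sum.inr (A.part (σ (.inl 0))) :=
            fun hh => hx (Sum.inr_injective hh)
          exact ⟨(if_neg hx).trans (if_neg hx').symm, (if_neg hx).trans (if_neg hx').symm⟩
      · have hx' : (Sum.inl i : B.I ⊕ A.I) ≠ Sum.inr (A.part (σ (.inl 0))) := Sum.inl_ne_inr
        exact ⟨(if_neg hx').symm, (if_neg hx').symm⟩

theorem contract_mul [Finite S] [Finite T] [Finite U] (e : 𝒱 (2 * n)) (σ : Fin 2 ⊕ T ≃ S)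
    (p : PP 𝒱 n S) (q : PP 𝒱 n U) :
    contract e (contrL U σ) (mul p q) = mul (contract e σ p) q := by
  have : mul.compr₂ (contract e (contrL U σ)) =
      (mul (𝒱 := 𝒱) (n := n) (T := U)).comp (contract e σ) := by
    refine PresMod.ext fun A => PresMod.ext fun B => ?_
    simp only [LinearMap.compr₂_apply, LinearMap.comp_apply, mul_mk, contract_mk]
    exact contract_sum_left e σ A B
  exact LinearMap.congr_fun₂ this p q

theorem mul_contract [Finite S] [Finite T] [Finite U] (e : 𝒱 (2 * n)) (σ : Fin 2 ⊕ T ≃ S)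
    (p : PP 𝒱 n S) (q : PP 𝒱 n U) :
    contract e (contrR U σ) (mul q p) = mul q (contract e σ p) := by
  have : mul.compr₂ (contract e (contrR U σ)) =
      (mul (𝒱 := 𝒱) (n := n) (S := U)).compl₂ (contract e σ) := by
    refine PresMod.ext fun B => PresMod.ext fun A => ?_
    simp only [LinearMap.compr₂_apply, LinearMap.compl₂_apply, mul_mk, contract_mk]
    exact contract_sum_right e σ B A
  exact LinearMap.congr_fun₂ this q p

end PP

/-! ### The coend `R^V` -/

/-- A finite set. -/
structure FinSet : Type 1 where
  carrier : Type
  fin : Finite carrier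

section Coend

instance : DecidableEq FinSet := Classical.decEq _

variable {V : Type*} [CommRing V] [Algebra ℚ V]
variable (𝒱 : ℕ → Submodule ℚ V) (n g : ℕ)

/-- `K^∨(S) ⊗ (P(S, V)'_{≥ 0} ⊗ (det ℚ^S)^{⊗ n})`. -/
abbrev Summand (S : FinSet) : Type _ :=
  KDual g S.carrier ⊗[ℚ] (PP 𝒱 n S.carrier ⊗[ℚ] DetPow n S.carrier)

/-- The direct sum over all finite sets `S` of
`K^∨(S) ⊗ (P(S, V)'_{≥ 0} ⊗ (det ℚ^S)^{⊗ n})`. -/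
def Total : Type _ := ⨁ S : FinSet, Summand 𝒱 n g S

instance : AddCommGroup (Total 𝒱 n g) :=
  inferInstanceAs (AddCommGroup (⨁ S : FinSet, Summand 𝒱 n g S))

instance : Module ℚ (Total 𝒱 n g) :=
  inferInstanceAs (Module ℚ (⨁ S : FinSet, Summand 𝒱 n g S))

variable {𝒱 n g}

/-- The inclusion of a summand. -/
def ofSummand (S : FinSet) : Summand 𝒱 n g S →ₗ[ℚ] Total 𝒱 n g :=
  DirectSum.lof ℚ FinSet (Summand 𝒱 n g) S

/-- A linear map out of the direct sum. -/
def Total.lift {M : Type*} [AddCommGroup M] [Module ℚ M]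
    (f : ∀ S : FinSet, Summand 𝒱 n g S →ₗ[ℚ] M) : Total 𝒱 n g →ₗ[ℚ] M :=
  DirectSum.toModule ℚ FinSet M f

theorem Total.lift_of {M : Type*} [AddCommGroup M] [Module ℚ M]
    (f : ∀ S : FinSet, Summand 𝒱 n g S →ₗ[ℚ] M) (S : FinSet) (x : Summand 𝒱 n g S) :
    Total.lift f (ofSummand S x) = f S x :=
  DirectSum.toModule_lof ℚ S x

/-- The element `ξ ⊗ p ⊗ w` of the summand indexed by `S`. -/
def gen {S : Type} [hS : Finite S] (ξ : KDual g S) (p : PP 𝒱 n S) (w : DetPow n S) :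
    Total 𝒱 n g :=
  ofSummand ⟨S, hS⟩ (ξ ⊗ₜ (p ⊗ₜ w))

theorem total_ext {M : Type*} [AddCommGroup M] [Module ℚ M] {f f' : Total 𝒱 n g →ₗ[ℚ] M}
    (h : ∀ (S : Type) [Finite S] (ξ : KDual g S) (p : PP 𝒱 n S) (w : DetPow n S),
      f (gen ξ p w) = f' (gen ξ p w)) : f = f' := by
  refine DirectSum.linearMap_ext ℚ fun S => ?_
  change f.comp (ofSummand S) = f'.comp (ofSummand S)
  refine TensorProduct.ext' fun ξ y => ?_
  refine LinearMap.congr_fun (f := (f.comp (ofSummand S)).comp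
    (TensorProduct.mk ℚ _ _ ξ)) (g := (f'.comp (ofSummand S)).comp
    (TensorProduct.mk ℚ _ _ ξ)) ?_ y
  refine TensorProduct.ext' fun p w => ?_
  have := S.fin
  exact h S.carrier ξ p w

/-- The product of `K^∨ ⊗ P(-, V)'_{≥ 0} ⊗ det^{⊗ n}` induced by disjoint union. -/
def mulTotal : Total 𝒱 n g →ₗ[ℚ] Total 𝒱 n g →ₗ[ℚ] Total 𝒱 n g :=
  Total.lift fun S => LinearMap.flip (Total.lift fun T => LinearMap.flip (
    have := S.fin
    have := T.fin
    (TensorProduct.map₂ KDual.mul (TensorProduct.map₂ PP.mul (DetPow.mul n))).compr₂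
      (ofSummand ⟨S.carrier ⊕ T.carrier, inferInstance⟩)))

theorem mulTotal_gen {S T : Type} [hS : Finite S] [hT : Finite T] (ξ : KDual g S)
    (p : PP 𝒱 n S) (w : DetPow n S) (η : KDual g T) (q : PP 𝒱 n T) (v : DetPow n T) :
    mulTotal (gen ξ p w) (gen η q v) = gen (KDual.mul ξ η) (PP.mul p q) (DetPow.mul n w v) := by
  unfold mulTotal gen
  rw [Total.lift_of, LinearMap.flip_apply, Total.lift_of, LinearMap.flip_apply]
  rfl

variable [GradedAlgebra 𝒱]

/-- The relations of the coend: an element of `K^∨(T)` can be pulled back along a bijection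
`S → T`, or the contraction `S → T` of an ordered pair, or instead the element of
`P(S, V)'_{≥ 0} ⊗ (det ℚ^S)^{⊗ n}` can be pushed forward along it. For a contraction, the
isomorphism on `det^{⊗ n}` is written in the opposite direction. -/
inductive CoendRel (g : ℕ) (e : 𝒱 (2 * n)) : Total 𝒱 n g → Prop
  | bij {S T : Type} [Finite S] [Finite T] (σ : S ≃ T) (ξ : KDual g T) (p : PP 𝒱 n S)
      (w : DetPow n S) :
      CoendRel g e
        (gen (KDual.relabel σ ξ) p w - gen ξ (PP.relabel σ p) (DetPow.relabel n σ w))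
  | contr {S T : Type} [Finite S] [Finite T] (σ : Fin 2 ⊕ T ≃ S) (ξ : KDual g T) (p : PP 𝒱 n S)
      (w : DetPow n T) :
      CoendRel g e
        (gen (KDual.contract n σ ξ) p (DetPow.wedge n σ w) - gen ξ (PP.contract e σ p) w)

/-- `R^V = K^∨ ⊗^{d(s)Br} (P(-, V)'_{≥ 0} ⊗ det^{⊗ n})`. -/
def RV (g : ℕ) (e : 𝒱 (2 * n)) : Type _ :=
  Total 𝒱 n g ⧸ Submodule.span ℚ {x | CoendRel g e x}

namespace RV

variable {e : 𝒱 (2 * n)}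

instance : AddCommGroup (RV g e) :=
  inferInstanceAs (AddCommGroup (Total 𝒱 n g ⧸ Submodule.span ℚ {x | CoendRel g e x}))

instance : Module ℚ (RV g e) :=
  inferInstanceAs (Module ℚ (Total 𝒱 n g ⧸ Submodule.span ℚ {x | CoendRel g e x}))

/-- The quotient map. -/
def proj (g : ℕ) (e : 𝒱 (2 * n)) : Total 𝒱 n g →ₗ[ℚ] RV g e := Submodule.mkQ _

/-- The class of `ξ ⊗ p ⊗ w` in the coend. -/
def cls (e : 𝒱 (2 * n)) {S : Type} [Finite S] (ξ : KDual g S) (p : PP 𝒱 n S)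
    (w : DetPow n S) : RV g e := proj g e (gen ξ p w)

theorem cls_relabel {S T : Type} [Finite S] [Finite T] (σ : S ≃ T) (ξ : KDual g T) (p : PP 𝒱 n S)
    (w : DetPow n S) :
    cls e (KDual.relabel σ ξ) p w = cls e ξ (PP.relabel σ p) (DetPow.relabel n σ w) :=
  (Submodule.Quotient.eq _).2 (Submodule.subset_span (.bij σ ξ p w))

theorem cls_contract {S T : Type} [Finite S] [Finite T] (σ : Fin 2 ⊕ T ≃ S) (ξ : KDual g T)
    (p : PP 𝒱 n S) (w : DetPow n T) :
    cls e (KDual.contract n σ ξ) p (DetPow.wedge n σ w) = cls e ξ (PP.contract e σ p) w :=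
  (Submodule.Quotient.eq _).2 (Submodule.subset_span (.contr σ ξ p w))

theorem ext {M : Type*} [AddCommGroup M] [Module ℚ M] {f f' : RV g e →ₗ[ℚ] M}
    (h : ∀ (S : Type) [Finite S] (ξ : KDual g S) (p : PP 𝒱 n S) (w : DetPow n S),
      f (cls e ξ p w) = f' (cls e ξ p w)) : f = f' :=
  Submodule.linearMap_qext _ (total_ext fun S _ ξ p w => h S ξ p w)

/-- A linear map out of the coend. -/
def lift {M : Type*} [AddCommGroup M] [Module ℚ M] (f : Total 𝒱 n g →ₗ[ℚ] M)
    (h : ∀ r, CoendRel g e r → f r = 0) : RV g e →ₗ[ℚ] M :=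
  Submodule.liftQ _ f (Submodule.span_le.2 h)

/-- The product of `R^V`, as a bilinear map. -/
def mulMap (g : ℕ) (e : 𝒱 (2 * n)) : RV g e →ₗ[ℚ] RV g e →ₗ[ℚ] RV g e :=
  lift (LinearMap.flip (lift (LinearMap.flip ((mulTotal (𝒱 := 𝒱)).compr₂ (proj g e))) (by
    intro r hr
    refine total_ext fun U _ η q v => ?_
    rw [LinearMap.flip_apply, LinearMap.compr₂_apply, LinearMap.zero_apply]
    rcases hr with ⟨σ, ξ, p, w⟩ | ⟨σ, ξ, p, w⟩
    · rw [map_sub, map_sub, sub_eq_zero, mulTotal_gen, mulTotal_gen, KDual.mul_relabel,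
        ← PP.mul_relabel, ← DetPow.mul_relabel]
      exact cls_relabel _ _ _ _
    · rw [map_sub, map_sub, sub_eq_zero, mulTotal_gen, mulTotal_gen, KDual.mul_contract,
        ← PP.mul_contract, ← DetPow.mul_wedge]
      exact cls_contract _ _ _ _))) (by
    intro r hr
    refine ext fun U _ η q v => ?_
    change proj g e (mulTotal r (gen η q v)) = 0
    rcases hr with ⟨σ, ξ, p, w⟩ | ⟨σ, ξ, p, w⟩
    · rw [map_sub, LinearMap.sub_apply, map_sub, sub_eq_zero, mulTotal_gen, mulTotal_gen,
        KDual.relabel_mul, ← PP.relabel_mul, ← DetPow.relabel_mul]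
      exact cls_relabel _ _ _ _
    · rw [map_sub, LinearMap.sub_apply, map_sub, sub_eq_zero, mulTotal_gen, mulTotal_gen,
        KDual.contract_mul, ← PP.contract_mul, ← DetPow.wedge_mul]
      exact cls_contract _ _ _ _)

theorem mulMap_cls {S T : Type} [Finite S] [Finite T] (ξ : KDual g S)
    (p : PP 𝒱 n S) (w : DetPow n S) (η : KDual g T) (q : PP 𝒱 n T) (v : DetPow n T) :
    mulMap g e (cls e ξ p w) (cls e η q v) =
      cls e (KDual.mul ξ η) (PP.mul p q) (DetPow.mul n w v) :=
  congrArg (proj g e) (mulTotal_gen ξ p w η q v)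

/-- The unit of `R^V`. -/
def one (g : ℕ) (e : 𝒱 (2 * n)) : RV g e :=
  cls e (KDual.one g) (PP.mk (LPart.empty 𝒱 n)) (DetPow.mk n Ordering.nil)

theorem one_mulMap (x : RV g e) : mulMap g e (one g e) x = x := by
  have : mulMap g e (one g e) = LinearMap.id := ext fun S _ ξ p w => by
    rw [one, mulMap_cls, KDual.one_mul', cls_relabel, PP.one_mul', DetPow.one_mul']
    rfl
  exact LinearMap.congr_fun this x

theorem mulMap_one (x : RV g e) : mulMap g e x (one g e) = x := by
  have : (mulMap g e).flip (one g e) = LinearMap.id := ext fun S _ ξ p w => by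
    rw [LinearMap.flip_apply, one, mulMap_cls, KDual.mul_one', cls_relabel, PP.mul_one',
      DetPow.mul_one']
    rfl
  exact LinearMap.congr_fun this x

theorem mulMap_assoc (x y z : RV g e) :
    mulMap g e (mulMap g e x y) z = mulMap g e x (mulMap g e y z) := by
  have : (mulMap g e).compr₂ (mulMap g e) =
      (LinearMap.lcomp ℚ _ (mulMap g e)).comp ((LinearMap.llcomp ℚ _ _ _).comp (mulMap g e)) := by
    refine ext fun S _ ξ p w => ext fun T _ η q v => ext fun U _ ζ r u => ?_
    simp only [LinearMap.compr₂_apply, LinearMap.comp_apply, LinearMap.lcomp_apply,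
      LinearMap.llcomp_apply, mulMap_cls]
    rw [KDual.mul_assoc', cls_relabel, PP.mul_assoc', DetPow.mul_assoc']
  exact LinearMap.congr_fun (LinearMap.congr_fun₂ this x y) z

instance : Ring (RV g e) :=
  { (inferInstance : AddCommGroup (RV g e)) with
    mul := fun x y => mulMap g e x y
    one := one g e
    mul_assoc := mulMap_assoc
    one_mul := one_mulMap
    mul_one := mulMap_one
    left_distrib := fun x y z => map_add (mulMap g e x) y z
    right_distrib := fun x y z => LinearMap.map_add₂ (mulMap g e) x y z
    zero_mul := fun x => LinearMap.map_zero₂ (mulMap g e) x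
    mul_zero := fun x => map_zero (mulMap g e x) }

instance : Algebra ℚ (RV g e) :=
  Algebra.ofModule (fun c x y => LinearMap.map_smul₂ (mulMap g e) c x y)
    (fun c x y => map_smul (mulMap g e x) c y)

/-- The homogeneous part of degree `k` of `R^V`. -/
def degree (g : ℕ) (e : 𝒱 (2 * n)) (k : ℕ) : Submodule ℚ (RV g e) :=
  Submodule.span ℚ {x | ∃ (S : Type) (_ : Finite S) (ξ : KDual g S) (A : LPart 𝒱 n S)
    (o : Ordering S), A.degree = k ∧ x = cls e ξ (PP.mk A) (DetPow.mk n o)}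

end RV

end Coend

/-! ### The classes `κ_c(v₁ ⊗ ⋯ ⊗ v_r)` and the ring presented by them -/

section Presentation

variable {V : Type*} [CommRing V] [Algebra ℚ V]

/-- The symbols `κ_c(v₁ ⊗ ⋯ ⊗ v_r)`, for `c` homogeneous of degree `d` with
`d + n (r - 2) > 0`. -/
structure KGen (𝒱 : ℕ → Submodule ℚ V) (n g : ℕ) where
  r : ℕ
  d : ℕ
  c : V
  mem : c ∈ 𝒱 d
  v : Fin r → H g
  pos : 2 * n < d + n * r

/-- The degree `d + n (r - 2)` of `κ_c(v₁ ⊗ ⋯ ⊗ v_r)` (the subtraction does not truncate). -/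
def KGen.degree {𝒱 : ℕ → Submodule ℚ V} {n g : ℕ} (x : KGen 𝒱 n g) : ℕ := x.d + n * x.r - 2 * n

variable {𝒱 : ℕ → Submodule ℚ V} {n g : ℕ}

/-- The linear form `λ(v₁, -) ⊗ ⋯ ⊗ λ(v_r, -)` on `H(g)^{⊗ r}`. -/
def dualTensor (n : ℕ) {r : ℕ} (v : Fin r → H g) : KDual g (Fin r) :=
  (MultilinearMap.mkPiAlgebra ℚ (Fin r) ℚ).compLinearMap fun i => pairing n g (v i)

variable [GradedAlgebra 𝒱]

/-- The class `κ_c(v₁ ⊗ ⋯ ⊗ v_r)` in `R^V`: it is represented by the partition of `{1, …, r}` with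
one part, labelled by `c`. -/
def kappa (e : 𝒱 (2 * n)) (x : KGen 𝒱 n g) : RV g e :=
  RV.cls e (dualTensor n x.v)
    (PP.mk (LPart.single n (Fin x.r) x.d x.c x.mem (by simpa using x.pos)))
    (DetPow.mk n (Ordering.fin x.r))

/-- `a` and `a'` are dual bases of `H(g)`, with `λ(a_i, a'_j) = δ_{ij}`. -/
def IsDualBases (n : ℕ) (a a' : Fin (2 * g) → H g) : Prop :=
  ∀ i j, pairing n g (a i) (a' j) = if i = j then 1 else 0

open FreeAlgebra in
/-- The defining relations between the `κ_c(v₁ ⊗ ⋯ ⊗ v_r)`. -/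
inductive KRel (g : ℕ) (e : 𝒱 (2 * n)) :
    FreeAlgebra ℚ (KGen 𝒱 n g) → FreeAlgebra ℚ (KGen 𝒱 n g) → Prop
  /-- Graded commutativity. -/
  | comm (x y : KGen 𝒱 n g) :
      KRel g e (ι ℚ x * ι ℚ y) ((-1 : ℚ) ^ (x.degree * y.degree) • (ι ℚ y * ι ℚ x))
  /-- Linearity in `c`. -/
  | linear_label (r d : ℕ) (v : Fin r → H g) (s t : ℚ) (c c' : V) (hc : c ∈ 𝒱 d) (hc' : c' ∈ 𝒱 d)
      (pos : 2 * n < d + n * r) :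
      KRel g e
        (ι ℚ ⟨r, d, s • c + t • c',
          add_mem (Submodule.smul_mem _ s hc) (Submodule.smul_mem _ t hc'), v, pos⟩)
        (s • ι ℚ ⟨r, d, c, hc, v, pos⟩ + t • ι ℚ ⟨r, d, c', hc', v, pos⟩)
  /-- Linearity in each `v_i`. -/
  | linear_vector (r d : ℕ) (v : Fin r → H g) (i : Fin r) (s t : ℚ) (x y : H g) (c : V)
      (hc : c ∈ 𝒱 d) (pos : 2 * n < d + n * r) :
      KRel g e
        (ι ℚ ⟨r, d, c, hc, Function.update v i (s • x + t • y), pos⟩)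
        (s • ι ℚ ⟨r, d, c, hc, Function.update v i x, pos⟩ +
          t • ι ℚ ⟨r, d, c, hc, Function.update v i y, pos⟩)
  /-- `κ_c(v_{σ(1)} ⊗ ⋯ ⊗ v_{σ(r)}) = sign(σ)^n κ_c(v₁ ⊗ ⋯ ⊗ v_r)`. -/
  | symmetry (r d : ℕ) (v : Fin r → H g) (σ : Equiv.Perm (Fin r)) (c : V) (hc : c ∈ 𝒱 d)
      (pos : 2 * n < d + n * r) :
      KRel g e
        (ι ℚ ⟨r, d, c, hc, fun i => v (σ i), pos⟩)
        (((Equiv.Perm.sign σ : ℤ) : ℚ) ^ n • ι ℚ ⟨r, d, c, hc, v, pos⟩)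
  /-- `∑ i, κ_x(v ⊗ a_i) κ_y(a'_i ⊗ w) = κ_{xy}(v ⊗ w)`. -/
  | edge (a a' : Fin (2 * g) → H g) (ha : IsDualBases n a a') (r r' d d' : ℕ) (v : Fin r → H g)
      (w : Fin r' → H g) (x y : V) (hx : x ∈ 𝒱 d) (hy : y ∈ 𝒱 d') (pos : 2 * n < d + n * (r + 1))
      (pos' : 2 * n < d' + n * (r' + 1)) :
      KRel g e
        (∑ i, ι ℚ ⟨r + 1, d, x, hx, Fin.snoc v (a i), pos⟩ *
          ι ℚ ⟨r' + 1, d', y, hy, Fin.cons (a' i) w, pos'⟩)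
        (ι ℚ ⟨r + r', d + d', x * y, SetLike.mul_mem_graded hx hy, Fin.append v w,
          by simp only [mul_add] at *; omega⟩)
  /-- `∑ i, κ_x(v ⊗ a_i ⊗ a'_i) = κ_{ex}(v)`. -/
  | loop (a a' : Fin (2 * g) → H g) (ha : IsDualBases n a a') (r d : ℕ) (v : Fin r → H g) (x : V)
      (hx : x ∈ 𝒱 d) (pos : 2 * n < d + n * (r + 1 + 1)) :
      KRel g e
        (∑ i, ι ℚ ⟨r + 1 + 1, d, x, hx, Fin.snoc (Fin.snoc v (a i) : Fin (r + 1) → H g) (a' i), pos⟩)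
        (ι ℚ ⟨r, 2 * n + d, e * x, SetLike.mul_mem_graded e.2 hx, v,
          by simp only [mul_add] at *; omega⟩)

/-- The graded-commutative ring generated by the symbols `κ_c(v₁ ⊗ ⋯ ⊗ v_r)` subject to the
relations of `KRel`. -/
abbrev KRing (g : ℕ) (e : 𝒱 (2 * n)) := RingQuot (KRel g e)

/-- The generator `κ_c(v₁ ⊗ ⋯ ⊗ v_r)`. -/
def KRing.gen (e : 𝒱 (2 * n)) (x : KGen 𝒱 n g) : KRing g e :=
  RingQuot.mkAlgHom ℚ (KRel g e) (FreeAlgebra.ι ℚ x)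

/-- The homogeneous part of degree `k`, spanned by the products of generators of total degree
`k`. -/
def KRing.degree (g : ℕ) (e : 𝒱 (2 * n)) (k : ℕ) : Submodule ℚ (KRing g e) :=
  Submodule.span ℚ {x | ∃ l : List (KGen 𝒱 n g), (l.map KGen.degree).sum = k ∧
    x = (l.map (KRing.gen e)).prod}

end Presentation

end TorelliRing

end

/-! The comparison map is an isomorphism for every g and in every degree, so no stability argument
is needed: both rings are presentations of the same object, and an inverse can be written down.

A form on H(g)^{⊗ S} is a combination of forms ⊗_s λ(v_s, -). Together with a labelled partition and
an ordering of S that runs through the parts one after the other, such a form represents a product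
of classes κ, one for each part. In the coend, the bijections account for graded commutativity and
the symmetry of κ, and the contractions for relation (3): pulling a form back along a contraction
multiplies it by λ, and λ = ∑ λ(a_i, -) ⊗ λ(a_i^#, -) by `sum_pairing_mul_pairing`. This yields the
ring map `phi` (`kappa_comm`, `kappa_symmetry`, `kappa_edge`, `kappa_loop`). Cutting S along its
parts shows that `phi` is onto in each degree (`cls_tensorForm_mem`, `degree_le_map_phi`).

For injectivity, a linear map `psi` goes back: expand the form in the standard basis, and replace
each basis form by the monomial in the κ's read off from the partition. Two things must be checked.

Signs: the monomial depends on an enumeration of the parts and of their elements, and so does the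
induced ordering of S. Since labels have even degree, a class with r vectors has degree congruent to
nr mod 2, so exchanging classes with r and r' vectors costs (-1)^{nrr'}. This is the n-th power of
the sign of exchanging two blocks of these sizes, so the dependence cancels against `DetPow`
(`LPart.exists_signedPerm`, `LPart.eval_order`).

Contractions: an enumeration can be chosen in which the contracted pair is adjacent. Moving an
adjacent pair to the front is free of sign (`DetPow.mk_move`), and what remains is relation (3) for
the standard dual bases (`LPart.eval_loop`, `LPart.eval_merge`).

Finally `psi` is multiplicative and sends each class `kappa e x` to the generator x, so `psi` after
`phi` is a ring endomorphism fixing the generators, that is, the identity (`psi_phi`). -/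

noncomputable section

namespace TorelliRing

open scoped DirectSum TensorProduct

/-! ### Signed permutations of lists -/

/-- `SignedPerm n l l' c` says that `l'` is obtained from `l` by transpositions of adjacent entries,
and that `c` is the `n`-th power of the sign of this sequence of transpositions. -/
inductive SignedPerm (n : ℕ) {α : Type*} : List α → List α → ℚ → Prop
  | refl (l : List α) : SignedPerm n l l 1
  | swap (l₁ l₂ : List α) (a b : α) :
      SignedPerm n (l₁ ++ a :: b :: l₂) (l₁ ++ b :: a :: l₂) ((-1) ^ n)
  | trans {l l' l'' : List α} {c c' : ℚ} :
      SignedPerm n l l' c → SignedPerm n l' l'' c' → SignedPerm n l l'' (c * c')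

namespace SignedPerm

variable {n : ℕ} {α : Type*} {l l' m m' : List α} {c c' : ℚ}

theorem of_eq (h : SignedPerm n l l' c) (hc : c = c') : SignedPerm n l l' c' := hc ▸ h

theorem perm (h : SignedPerm n l l' c) : l.Perm l' := by
  induction h with
  | refl l => exact .refl _
  | swap l₁ l₂ a b => exact (List.Perm.swap b a l₂).append_left l₁
  | trans _ _ ih ih' => exact ih.trans ih'

theorem append_left (m : List α) (h : SignedPerm n l l' c) : SignedPerm n (m ++ l) (m ++ l') c := by
  induction h with
  | refl l => exact .refl _
  | swap l₁ l₂ a b => simpa using SignedPerm.swap (n := n) (m ++ l₁) l₂ a b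
  | trans _ _ ih ih' => exact ih.trans ih'

theorem append_right (m : List α) (h : SignedPerm n l l' c) :
    SignedPerm n (l ++ m) (l' ++ m) c := by
  induction h with
  | refl l => exact .refl _
  | swap l₁ l₂ a b => simpa using SignedPerm.swap (n := n) l₁ (l₂ ++ m) a b
  | trans _ _ ih ih' => exact ih.trans ih'

theorem append (h : SignedPerm n l l' c) (h' : SignedPerm n m m' c') :
    SignedPerm n (l ++ m) (l' ++ m') (c * c') :=
  (h.append_right m).trans (h'.append_left l')

theorem cons_append (a : α) (q : List α) :
    SignedPerm n (a :: q) (q ++ [a]) ((-1) ^ (n * q.length)) := by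
  induction q with
  | nil => simpa using SignedPerm.refl (n := n) [a]
  | cons b q ih =>
    refine ((SignedPerm.swap [] q a b).trans (ih.append_left [b])).of_eq ?_
    rw [← pow_add, List.length_cons]
    ring_nf

/-- The sign of exchanging two blocks. It equals the Koszul sign for exchanging two classes κ with
`p.length` and `q.length` vectors, which is why it is recorded in this form. -/
theorem append_comm (p q : List α) :
    SignedPerm n (p ++ q) (q ++ p) ((-1) ^ (n * (p.length * q.length))) := by
  induction p with
  | nil => simpa using SignedPerm.refl (n := n) q
  | cons a p ih =>
    have h₁ := ih.append_left [a]
    have h₂ := (cons_append (n := n) a q).append_right p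
    simp only [List.append_assoc, List.cons_append, List.nil_append] at h₁ h₂
    refine (h₁.trans h₂).of_eq ?_
    rw [← pow_add, List.length_cons]
    ring_nf

/-- Uniqueness of c is neither claimed nor needed (it can fail for lists with repetitions): one and
the same chain of transpositions will be applied to orderings and to monomials. -/
theorem exists_of_perm (h : l.Perm l') : ∃ c, SignedPerm n l l' c := by
  induction h with
  | nil => exact ⟨_, .refl _⟩
  | cons a _ ih => obtain ⟨c, hc⟩ := ih; exact ⟨c, hc.append_left [a]⟩
  | swap a b l => exact ⟨_, .swap [] l b a⟩
  | trans _ _ ih ih' =>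
    obtain ⟨c, hc⟩ := ih
    obtain ⟨c', hc'⟩ := ih'
    exact ⟨_, hc.trans hc'⟩

end SignedPerm

/-! ### The line `(det ℚ^S)^{⊗ n}` -/

namespace DetPow

variable {n : ℕ} {S T : Type}

theorem mk_signedPerm {l l' : List S} {c : ℚ} (h : SignedPerm n l l' c) :
    ∀ {o o' : Ordering S}, o.list = l → o'.list = l' → mk n o = c • mk n o' := by
  induction h with
  | refl l =>
    intro o o' h h'
    rw [Ordering.ext (h.trans h'.symm), one_smul]
  | swap l₁ l₂ a b =>
    intro o o' h h'
    exact mk_swap l₁ l₂ b a h h'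
  | @trans l l' l'' c c' h₁ h₂ ih ih' =>
    intro o o'' h h''
    -- The intermediate list is a permutation of an ordering, hence itself an ordering, to which
    -- both induction hypotheses apply.
    have hp : l'.Perm o.list := h ▸ h₁.perm.symm
    let o' : Ordering S := ⟨l', hp.nodup_iff.2 o.nodup, fun s => hp.mem_iff.2 (o.mem s)⟩
    rw [ih h (rfl : o'.list = l'), ih' rfl h'', smul_smul]

theorem mk_eq_smul (o o' : Ordering S) : ∃ c : ℚ, mk n o = c • mk n o' := by
  have hp : o.list.Perm o'.list :=
    (List.perm_ext_iff_of_nodup o.nodup o'.nodup).2 fun s => iff_of_true (o.mem s) (o'.mem s)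
  obtain ⟨c, hc⟩ := SignedPerm.exists_of_perm (n := n) hp
  exact ⟨c, mk_signedPerm hc rfl rfl⟩

/-- Any two orderings differ by transpositions, so a single one spans; together with `exists_coord`
this makes the space a line for finite S. -/
theorem eq_smul (o : Ordering S) (w : DetPow n S) : ∃ c : ℚ, w = c • mk n o := by
  obtain ⟨x, rfl⟩ := Submodule.mkQ_surjective _ w
  change ∃ c : ℚ, PresMod.proj (detRel n S) x = c • mk n o
  induction x using Finsupp.induction_linear with
  | zero => exact ⟨0, by rw [map_zero, zero_smul]⟩
  | add x y hx hy =>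
    obtain ⟨c, hc⟩ := hx
    obtain ⟨c', hc'⟩ := hy
    exact ⟨c + c', by rw [map_add, hc, hc', add_smul]⟩
  | single o' a =>
    obtain ⟨c, hc⟩ := mk_eq_smul (n := n) o' o
    refine ⟨a * c, ?_⟩
    rw [mul_smul, ← hc, ← Finsupp.smul_single_one, map_smul]
    rfl

/-- The number of inversions of a list, with respect to a ranking of its entries. -/
def inversions (r : S → ℕ) : List S → ℕ
  | [] => 0
  | a :: l => l.countP (fun b => r b < r a) + inversions r l

/-- Entries of `l₁` see the same multiset behind them, and a and b compare with `l₂` as before. Only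
the pair a, b itself changes its contribution, by one. -/
theorem inversions_swap {r : S → ℕ} (l₁ l₂ : List S) {a b : S} (hab : r a ≠ r b) :
    (-1 : ℚ) ^ inversions r (l₁ ++ b :: a :: l₂) = -(-1) ^ inversions r (l₁ ++ a :: b :: l₂) := by
  induction l₁ with
  | nil =>
    simp only [List.nil_append, inversions, List.countP_cons, decide_eq_true_eq]
    rcases hab.lt_or_gt with h | h <;> simp only [h, h.not_gt, if_true, if_false] <;> ring
  | cons d l₁ ih =>
    have hp : (l₁ ++ b :: a :: l₂).Perm (l₁ ++ a :: b :: l₂) :=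
      (List.Perm.swap a b l₂).append_left l₁
    simp only [List.cons_append, inversions, pow_add, ih, hp.countP_eq]
    ring

/-- The sign relations do not kill the line: the n-th power of the inversion sign respects them and
takes the values ±1 on orderings. Multiplying the functional by its own value at `o` normalises it.
-/
theorem exists_coord [Finite S] (o : Ordering S) :
    ∃ f : DetPow n S →ₗ[ℚ] ℚ, f (mk n o) = 1 := by
  obtain ⟨r, hr⟩ := exists_injective_nat S
  let f : DetPow n S →ₗ[ℚ] ℚ := PresMod.lift (fun p => ((-1) ^ inversions r p.list) ^ n) (by
    rintro _ ⟨l₁, l₂, a, b, o, o', h, h', rfl⟩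
    have hab : a ≠ b := by
      have := o.nodup
      rw [h, List.nodup_append] at this
      have := this.2.1
      simp only [List.nodup_cons, List.mem_cons, not_or] at this
      exact fun hh => this.1.1 hh.symm
    simp only [map_sub, map_smul, Finsupp.linearCombination_single, h, h',
      inversions_swap l₁ l₂ (fun hh => hab (hr hh)), smul_eq_mul]
    rw [neg_pow]
    ring)
  have h : f (mk n o) * f (mk n o) = 1 := by
    simp only [f, PresMod.lift_mk, ← mul_pow]
    norm_num
  exact ⟨f (mk n o) • f, h⟩

/-- The coordinate with respect to the generator given by an ordering. -/
def coord (n : ℕ) [Finite S] (o : Ordering S) : DetPow n S →ₗ[ℚ] ℚ := (exists_coord o).choose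

@[simp] theorem coord_mk [Finite S] (o : Ordering S) : coord n o (mk n o) = 1 :=
  (exists_coord o).choose_spec

/-- Linear maps out of `(det ℚ^S)^{⊗ n}` are determined by their value on one ordering. -/
theorem ext_ordering {M : Type*} [AddCommGroup M] [Module ℚ M] (o : Ordering S)
    {f f' : DetPow n S →ₗ[ℚ] M} (h : f (mk n o) = f' (mk n o)) : f = f' := by
  ext w
  obtain ⟨c, rfl⟩ := eq_smul o w
  rw [map_smul, map_smul, h]

end DetPow

/-! ### The generators of the presented ring, indexed by lists of vectors -/

section Kap

variable {V : Type*} [CommRing V] [Algebra ℚ V] {𝒱 : ℕ → Submodule ℚ V} {n g : ℕ}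
variable [GradedAlgebra 𝒱] {e : 𝒱 (2 * n)}

theorem KRing.rel {x y : FreeAlgebra ℚ (KGen 𝒱 n g)} (h : KRel g e x y) :
    RingQuot.mkAlgHom ℚ (KRel g e) x = RingQuot.mkAlgHom ℚ (KRel g e) y :=
  RingQuot.mkAlgHom_rel ℚ h

open Classical in
/-- The class `κ_c(v₁ ⊗ ⋯ ⊗ v_r)` in the presented ring, for a list of vectors; it is zero when the
conditions on `c` are not satisfied. -/
def kap (e : 𝒱 (2 * n)) (d : ℕ) (c : V) (l : List (H g)) : KRing g e :=
  if h : c ∈ 𝒱 d ∧ 2 * n < d + n * l.length then KRing.gen e ⟨l.length, d, c, h.1, l.get, h.2⟩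
  else 0

theorem kap_of {d : ℕ} {c : V} {l : List (H g)} (hc : c ∈ 𝒱 d) (pos : 2 * n < d + n * l.length) :
    kap e d c l = KRing.gen e ⟨l.length, d, c, hc, l.get, pos⟩ :=
  dif_pos ⟨hc, pos⟩

theorem kap_ofFn {r d : ℕ} {c : V} (hc : c ∈ 𝒱 d) (v : Fin r → H g) (pos : 2 * n < d + n * r) :
    kap e d c (List.ofFn v) = KRing.gen e ⟨r, d, c, hc, v, pos⟩ := by
  -- The length of `List.ofFn v` is r only propositionally, so length and family are transported
  -- together as a dependent pair.
  have gen_congr : ∀ {p q : Σ r, Fin r → H g}, p = q →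
      ∀ (hp : 2 * n < d + n * p.1) (hq : 2 * n < d + n * q.1),
        KRing.gen e ⟨p.1, d, c, hc, p.2, hp⟩ = KRing.gen e ⟨q.1, d, c, hc, q.2, hq⟩ := by
    rintro p _ rfl _ _
    rfl
  rw [kap_of hc (by simpa using pos)]
  exact gen_congr (p := ⟨_, (List.ofFn v).get⟩) (q := ⟨r, v⟩)
    (List.ofFn_inj'.1 (List.ofFn_get _)) _ _

theorem ofFn_snoc {α : Type*} {r : ℕ} (v : Fin r → α) (x : α) :
    List.ofFn (Fin.snoc v x : Fin (r + 1) → α) = List.ofFn v ++ [x] := by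
  rw [List.ofFn_succ']
  simp only [Fin.snoc_castSucc, Fin.snoc_last, List.concat_eq_append]

theorem kap_smul_add {d : ℕ} {l : List (H g)} (s t : ℚ) {c c' : V} (hc : c ∈ 𝒱 d)
    (hc' : c' ∈ 𝒱 d) : kap e d (s • c + t • c') l = s • kap e d c l + t • kap e d c' l := by
  by_cases pos : 2 * n < d + n * l.length
  · rw [kap_of hc pos, kap_of hc' pos,
      kap_of (add_mem (Submodule.smul_mem _ s hc) (Submodule.smul_mem _ t hc')) pos]
    have := KRing.rel (KRel.linear_label (e := e) l.length d l.get s t c c' hc hc' pos)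
    rwa [map_add, map_smul, map_smul] at this
  · simp [kap, pos]

theorem kap_zero (d : ℕ) (l : List (H g)) : kap e d 0 l = 0 := by
  have := kap_smul_add (e := e) (l := l) 0 0 (zero_mem (𝒱 d)) (zero_mem (𝒱 d))
  simpa using this

-- With even labels the degree of a generator is congruent to nr mod 2, and n² ≡ n, so the Koszul
-- sign becomes the n-th power of the sign of exchanging blocks of sizes r and r'.
omit [GradedAlgebra 𝒱] in
theorem KGen.neg_one_pow_degree_mul (x y : KGen 𝒱 n g) (hx : Even x.d) (hy : Even y.d) :
    (-1 : ℚ) ^ (x.degree * y.degree) = (-1) ^ (n * (x.r * y.r)) := by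
  have parity : ∀ x : KGen 𝒱 n g, Even x.d → x.degree % 2 = n * x.r % 2 := by
    rintro x ⟨k, hk⟩
    -- Positivity guarantees that the subtraction in the degree does not truncate.
    have := x.pos
    rw [KGen.degree]
    omega
  rw [neg_one_pow_eq_pow_mod_two, neg_one_pow_eq_pow_mod_two (n := n * (x.r * y.r))]
  congr 1
  rw [Nat.mul_mod, parity x hx, parity y hy, ← Nat.mul_mod,
    show n * x.r * (n * y.r) = (n * n) * (x.r * y.r) by ring, Nat.mul_mod,
    Nat.mul_mod n (x.r * y.r)]
  congr 2
  rcases Nat.mod_two_eq_zero_or_one n with hn | hn <;> simp [Nat.mul_mod, hn]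

/-- In odd degree the label is 0 or the default value applies, so the class vanishes and the sign is
irrelevant; in even degrees the sign is `KGen.neg_one_pow_degree_mul`. The default value 0 makes the
identity hold without side conditions. -/
theorem kap_comm (even : ∀ d, Odd d → 𝒱 d = ⊥) (d d' : ℕ) (c c' : V) (l l' : List (H g)) :
    kap e d c l * kap e d' c' l' =
      ((-1 : ℚ) ^ (n * (l.length * l'.length))) • (kap e d' c' l' * kap e d c l) := by
  have odd_zero : ∀ (d : ℕ) (c : V) (l : List (H g)), Odd d → kap e d c l = 0 := by
    intro d c l hd
    by_cases hc : c ∈ 𝒱 d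
    · rw [even d hd, Submodule.mem_bot] at hc
      rw [hc, kap_zero]
    · simp [kap, hc]
  rcases d.even_or_odd with hd | hd
  swap
  · simp [odd_zero d c l hd]
  rcases d'.even_or_odd with hd' | hd'
  swap
  · simp [odd_zero d' c' l' hd']
  by_cases h : c ∈ 𝒱 d ∧ 2 * n < d + n * l.length
  swap
  · simp [kap, h]
  by_cases h' : c' ∈ 𝒱 d' ∧ 2 * n < d' + n * l'.length
  swap
  · simp [kap, h']
  rw [kap_of h.1 h.2, kap_of h'.1 h'.2]
  have := KRing.rel (KRel.comm (e := e) ⟨l.length, d, c, h.1, l.get, h.2⟩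
    ⟨l'.length, d', c', h'.1, l'.get, h'.2⟩)
  rw [map_mul, map_smul, map_mul] at this
  exact this.trans (congrArg (· • _) (KGen.neg_one_pow_degree_mul _ _ hd hd'))

/-- The class `κ_c(v₁ ⊗ ⋯ ⊗ v_r)` as a multilinear map. -/
def kapMulti (e : 𝒱 (2 * n)) {r d : ℕ} {c : V} (hc : c ∈ 𝒱 d) (pos : 2 * n < d + n * r) :
    MultilinearMap ℚ (fun _ : Fin r => H g) (KRing g e) where
  toFun v := KRing.gen e ⟨r, d, c, hc, v, pos⟩
  map_update_add' {inst} v i x y := by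
    obtain rfl : inst = instDecidableEqFin r := Subsingleton.elim _ _
    have := KRing.rel (KRel.linear_vector (e := e) r d v i 1 1 x y c hc pos)
    simp only [one_smul, map_add] at this
    exact this
  map_update_smul' {inst} v i s x := by
    obtain rfl : inst = instDecidableEqFin r := Subsingleton.elim _ _
    have := KRing.rel (KRel.linear_vector (e := e) r d v i s 0 x 0 c hc pos)
    simp only [zero_smul, add_zero, map_smul] at this
    exact this

theorem kapMulti_apply {r d : ℕ} {c : V} (hc : c ∈ 𝒱 d) (pos : 2 * n < d + n * r)
    (v : Fin r → H g) : kapMulti e hc pos v = kap e d c (List.ofFn v) :=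
  (kap_ofFn hc v pos).symm

/-- Linearity in one slot of a list, used to move a basis expansion of the vector there through the
class. If the conditions on c fail, every value is the default 0 and the zero map serves. -/
theorem exists_kap_linear (e : 𝒱 (2 * n)) (d : ℕ) (c : V) (l₁ l₂ : List (H g)) :
    ∃ f : H g →ₗ[ℚ] KRing g e, ∀ x, f x = kap e d c (l₁ ++ x :: l₂) := by
  by_cases h : c ∈ 𝒱 d ∧ 2 * n < d + n * (l₁ ++ 0 :: l₂).length
  · refine ⟨(kapMulti e h.1 h.2).toLinearMap (l₁ ++ 0 :: l₂).get ⟨l₁.length, by simp⟩, fun x => ?_⟩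
    rw [MultilinearMap.toLinearMap_apply, kapMulti_apply]
    congr 1
    refine List.ext_getElem (by simp [add_assoc]) fun i h₁ h₂ => ?_
    rw [List.getElem_ofFn, Function.update_apply]
    simp only [Fin.mk.injEq, List.get_eq_getElem]
    rcases lt_trichotomy i l₁.length with hi | rfl | hi
    · simp [hi, hi.ne]
    · simp
    · obtain ⟨k, rfl⟩ := Nat.exists_eq_add_of_lt hi
      simp [add_assoc, List.getElem_append_right]
  · refine ⟨0, fun x => ?_⟩
    rw [kap, dif_neg (by simpa using h)]
    rfl

/-- The symmetry relation for the transposition of positions `l₁.length` and `l₁.length + 1`. -/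
theorem kap_swap (d : ℕ) (c : V) (l₁ l₂ : List (H g)) (x y : H g) :
    kap e d c (l₁ ++ x :: y :: l₂) = ((-1 : ℚ) ^ n) • kap e d c (l₁ ++ y :: x :: l₂) := by
  by_cases h : c ∈ 𝒱 d ∧ 2 * n < d + n * (l₁ ++ y :: x :: l₂).length
  · rw [kap_of h.1 h.2]
    let i : Fin (l₁ ++ y :: x :: l₂).length := ⟨l₁.length, by simp⟩
    let j : Fin (l₁ ++ y :: x :: l₂).length := ⟨l₁.length + 1, by simp⟩
    have hij : i ≠ j := by simp [i, j]
    have := KRing.rel (KRel.symmetry (e := e) _ d (l₁ ++ y :: x :: l₂).get (Equiv.swap i j) c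
      h.1 h.2)
    rw [map_smul, Equiv.Perm.sign_swap hij] at this
    simp only [Units.val_neg, Units.val_one, Int.cast_neg, Int.cast_one] at this
    refine Eq.trans ?_ this
    refine Eq.trans (congrArg _ ?_) (kap_ofFn h.1 _ h.2)
    refine List.ext_getElem (by simp [add_assoc]) fun k h₁ h₂ => ?_
    rw [List.getElem_ofFn, Equiv.swap_apply_def]
    simp only [i, j, Fin.mk.injEq, List.get_eq_getElem]
    rcases lt_or_ge k l₁.length with hk | hk
    · simp [hk, hk.ne, (Nat.lt_succ_of_lt hk).ne]
    · obtain ⟨k, rfl⟩ := Nat.exists_eq_add_of_le hk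
      rcases k with _ | _ | k <;> simp [List.getElem_append_right]
  · have h' : ¬ (c ∈ 𝒱 d ∧ 2 * n < d + n * (l₁ ++ x :: y :: l₂).length) := by simpa using h
    rw [kap, kap, dif_neg h, dif_neg h', smul_zero]

theorem kap_signedPerm {S : Type*} (v : S → H g) (d : ℕ) (c : V) {l l' : List S} {s : ℚ}
    (h : SignedPerm n l l' s) : kap e d c (l.map v) = s • kap e d c (l'.map v) := by
  induction h with
  | refl l => rw [one_smul]
  | swap l₁ l₂ a b =>
    simp only [List.map_append, List.map_cons]
    exact kap_swap d c _ _ _ _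
  | trans _ _ ih ih' => rw [ih, ih', smul_smul]

theorem kap_edge {a a' : Fin (2 * g) → H g} (ha : IsDualBases n a a') {d d' : ℕ} {x y : V}
    (hx : x ∈ 𝒱 d) (hy : y ∈ 𝒱 d') (l l' : List (H g)) (pos : 2 * n < d + n * (l.length + 1))
    (pos' : 2 * n < d' + n * (l'.length + 1)) :
    ∑ i, kap e d x (l ++ [a i]) * kap e d' y (a' i :: l') = kap e (d + d') (x * y) (l ++ l') := by
  have := KRing.rel (KRel.edge (e := e) a a' ha l.length l'.length d d' l.get l'.get x y hx hy
    pos pos')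
  simp only [map_sum, map_mul] at this
  have h := fun (r d : ℕ) (c : V) (hc : c ∈ 𝒱 d) (v : Fin r → H g) (pos) =>
    (kap_ofFn (e := e) hc v pos).symm
  simp only [KRing.gen] at h
  simp only [h] at this
  refine Eq.trans (Finset.sum_congr rfl fun i _ => ?_) (this.trans ?_)
  · rw [ofFn_snoc, List.ofFn_cons, List.ofFn_get, List.ofFn_get]
  · rw [List.ofFn_fin_append, List.ofFn_get, List.ofFn_get]

theorem kap_loop {a a' : Fin (2 * g) → H g} (ha : IsDualBases n a a') {d : ℕ} {x : V}
    (hx : x ∈ 𝒱 d) (l : List (H g)) (pos : 2 * n < d + n * (l.length + 1 + 1)) :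
    ∑ i, kap e d x (l ++ [a i, a' i]) = kap e (2 * n + d) (e * x) l := by
  have := KRing.rel (KRel.loop (e := e) a a' ha l.length d l.get x hx pos)
  simp only [map_sum] at this
  have h := fun (r d : ℕ) (c : V) (hc : c ∈ 𝒱 d) (v : Fin r → H g) (pos) =>
    (kap_ofFn (e := e) hc v pos).symm
  simp only [KRing.gen] at h
  simp only [h] at this
  refine Eq.trans (Finset.sum_congr rfl fun i _ => ?_) (this.trans ?_)
  · rw [ofFn_snoc, ofFn_snoc, List.ofFn_get, List.append_assoc]
    rfl
  · rw [List.ofFn_get]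

end Kap

/-! ### Enumerations of the parts of a partition -/

/-- An enumeration of the parts of a partition, and of the elements of each part. -/
structure PartEnum {S I : Type} (part : S → I) where
  parts : List I
  elems : I → List S
  nodup_parts : parts.Nodup
  mem_parts : ∀ i, i ∈ parts
  nodup_elems : ∀ i, (elems i).Nodup
  mem_elems : ∀ i s, s ∈ elems i ↔ part s = i

namespace PartEnum

variable {S T I J : Type} {part : S → I} {part' : T → J}

/-- The induced ordering of the underlying set, which lists the parts one after the other. -/
@[simps list] def order (E : PartEnum part) : Ordering S where
  list := E.parts.flatMap E.elems
  nodup := by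
    refine List.nodup_flatMap.2 ⟨fun i _ => E.nodup_elems i, ?_⟩
    refine E.nodup_parts.imp fun {i j} hij => ?_
    intro s hs hs'
    exact hij (((E.mem_elems i s).1 hs).symm.trans ((E.mem_elems j s).1 hs'))
  mem s := List.mem_flatMap.2 ⟨part s, E.mem_parts _, (E.mem_elems _ _).2 rfl⟩

theorem exists_list (X : Type) [Finite X] (p : X → Prop) :
    ∃ l : List X, l.Nodup ∧ ∀ x, x ∈ l ↔ p x := by
  classical
  have := Fintype.ofFinite X
  exact ⟨(Finset.univ.filter p).toList, Finset.nodup_toList _, fun x => by simp⟩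

instance [Finite S] [Finite I] : Nonempty (PartEnum part) := by
  obtain ⟨L, hL, hL'⟩ := exists_list I fun _ => True
  choose P hP hP' using fun i => exists_list S fun s => part s = i
  exact ⟨⟨L, P, hL, fun i => (hL' i).2 trivial, hP, hP'⟩⟩

theorem length_elems (E : PartEnum part) (i : I) :
    (E.elems i).length = Nat.card {s // part s = i} := by
  classical
  exact (Nat.card_eq_of_equiv_fin (((E.nodup_elems i).getEquiv _).trans
    (Equiv.subtypeEquivRight (E.mem_elems i))).symm).symm

/-- Transport along bijections. -/
@[simps parts elems] def transport (E : PartEnum part) (σ : S ≃ T) (φ : I ≃ J)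
    (h : ∀ s, part' (σ s) = φ (part s)) : PartEnum part' where
  parts := E.parts.map φ
  elems j := (E.elems (φ.symm j)).map σ
  nodup_parts := E.nodup_parts.map φ.injective
  mem_parts j := List.mem_map.2 ⟨φ.symm j, E.mem_parts _, by simp⟩
  nodup_elems j := (E.nodup_elems _).map σ.injective
  mem_elems j t := by
    obtain ⟨s, rfl⟩ := σ.surjective t
    rw [List.mem_map_of_injective σ.injective, E.mem_elems, h, Equiv.eq_symm_apply]

theorem transport_order (E : PartEnum part) (σ : S ≃ T) (φ : I ≃ J)
    (h : ∀ s, part' (σ s) = φ (part s)) : (E.transport σ φ h).order = E.order.relabel σ :=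
  Ordering.ext (by simp [List.flatMap_map, List.map_flatMap])

/-- Disjoint union of enumerations. -/
@[simps parts elems] def sum (E : PartEnum part) (E' : PartEnum part') :
    PartEnum (Sum.map part part') where
  parts := E.parts.map Sum.inl ++ E'.parts.map Sum.inr
  elems := Sum.elim (fun i => (E.elems i).map Sum.inl) fun j => (E'.elems j).map Sum.inr
  nodup_parts := (Ordering.append ⟨_, E.nodup_parts, E.mem_parts⟩
    ⟨_, E'.nodup_parts, E'.mem_parts⟩).nodup
  mem_parts := (Ordering.append ⟨_, E.nodup_parts, E.mem_parts⟩
    ⟨_, E'.nodup_parts, E'.mem_parts⟩).mem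
  nodup_elems := by
    rintro (i | j)
    exacts [(E.nodup_elems i).map Sum.inl_injective, (E'.nodup_elems j).map Sum.inr_injective]
  mem_elems := by
    rintro (i | j) (s | t) <;> simp [E.mem_elems, E'.mem_elems]

theorem sum_order (E : PartEnum part) (E' : PartEnum part') :
    (E.sum E').order = E.order.append E'.order :=
  Ordering.ext (by simp [List.flatMap_map, List.map_flatMap])

/-- The enumeration of a partition with one part given by an ordering. -/
@[simps parts elems] def ofOrdering (o : Ordering S) : PartEnum (fun _ : S => ()) where
  parts := [()]
  elems _ := o.list
  nodup_parts := List.nodup_singleton _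
  mem_parts := by simp
  nodup_elems _ := o.nodup
  mem_elems i s := iff_of_true (o.mem s) rfl

theorem ofOrdering_order (o : Ordering S) : (ofOrdering o).order = o :=
  Ordering.ext (by simp)

end PartEnum

/-! ### Monomials associated with labelled partitions -/

namespace LPart

variable {V : Type*} [CommRing V] [Algebra ℚ V] {𝒱 : ℕ → Submodule ℚ V} {n g : ℕ}
variable [GradedAlgebra 𝒱] {S T : Type}

/-- The product over the parts `s₁, …, s_r` of the classes `κ_c(v_{s₁} ⊗ ⋯ ⊗ v_{s_r})`, taken in the
order of an enumeration. -/
def mono (e : 𝒱 (2 * n)) (A : LPart 𝒱 n S) (E : PartEnum A.part) (v : S → H g) : KRing g e :=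
  (E.parts.map fun i => kap e (A.deg i) (A.lab i) ((E.elems i).map v)).prod

variable {e : 𝒱 (2 * n)}

/-- Reordering inside the parts. The point is that one scalar governs both the concatenated list and
the monomial, factor by factor through `kap_signedPerm`. -/
theorem exists_signedPerm_of_elems {I : Type} (d : I → ℕ) (c : I → V) {P P' : I → List S}
    (h : ∀ i, (P i).Perm (P' i)) (L : List I) :
    ∃ s : ℚ, SignedPerm n (L.flatMap P) (L.flatMap P') s ∧ ∀ v : S → H g,
      (L.map fun i => kap e (d i) (c i) ((P i).map v)).prod =
        s • (L.map fun i => kap e (d i) (c i) ((P' i).map v)).prod := by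
  induction L with
  | nil => exact ⟨1, .refl _, fun v => (one_smul _ _).symm⟩
  | cons i L ih =>
    obtain ⟨s, hs, hv⟩ := ih
    obtain ⟨t, ht⟩ := SignedPerm.exists_of_perm (n := n) (h i)
    refine ⟨t * s, ht.append hs, fun v => ?_⟩
    rw [List.map_cons, List.map_cons, List.prod_cons, List.prod_cons, hv, kap_signedPerm v _ _ ht,
      smul_mul_smul_comm]

/-- Reordering the parts themselves. Exchanging neighbouring parts exchanges two blocks of the list
and commutes two factors of the monomial, and the two signs agree by `SignedPerm.append_comm` and
`kap_comm`. -/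
theorem exists_signedPerm_of_parts (even : ∀ d, Odd d → 𝒱 d = ⊥) {I : Type} (d : I → ℕ)
    (c : I → V) (P : I → List S) {L L' : List I} (h : L.Perm L') :
    ∃ s : ℚ, SignedPerm n (L.flatMap P) (L'.flatMap P) s ∧ ∀ v : S → H g,
      (L.map fun i => kap e (d i) (c i) ((P i).map v)).prod =
        s • (L'.map fun i => kap e (d i) (c i) ((P i).map v)).prod := by
  induction h with
  | nil => exact ⟨1, .refl _, fun v => (one_smul _ _).symm⟩
  | cons i _ ih =>
    obtain ⟨s, hs, hv⟩ := ih
    refine ⟨s, hs.append_left _, fun v => ?_⟩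
    rw [List.map_cons, List.map_cons, List.prod_cons, List.prod_cons, hv, mul_smul_comm]
  | swap i j L =>
    refine ⟨(-1) ^ (n * ((P j).length * (P i).length)), ?_, fun v => ?_⟩
    · simpa using (SignedPerm.append_comm (P j) (P i)).append_right (L.flatMap P)
    · simp only [List.map_cons, List.prod_cons, ← mul_assoc]
      rw [kap_comm even, List.length_map, List.length_map, smul_mul_assoc]
      simp only [mul_assoc]
  | trans _ _ ih ih' =>
    obtain ⟨s, hs, hv⟩ := ih
    obtain ⟨s', hs', hv'⟩ := ih'
    exact ⟨_, hs.trans hs', fun v => by rw [hv, hv', smul_smul]⟩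

theorem exists_signedPerm (even : ∀ d, Odd d → 𝒱 d = ⊥) (A : LPart 𝒱 n S)
    (E E' : PartEnum A.part) :
    ∃ s : ℚ, SignedPerm n E.order.list E'.order.list s ∧ ∀ v : S → H g,
      A.mono e E v = s • A.mono e E' v := by
  obtain ⟨s, hs, hv⟩ := exists_signedPerm_of_elems (n := n) (g := g) (e := e) A.deg A.lab
    (fun i => (List.perm_ext_iff_of_nodup (E.nodup_elems i) (E'.nodup_elems i)).2 fun s => by
      rw [E.mem_elems, E'.mem_elems]) E.parts
  obtain ⟨t, ht, hv'⟩ := exists_signedPerm_of_parts (n := n) (g := g) (e := e) even A.deg A.lab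
    E'.elems ((List.perm_ext_iff_of_nodup E.nodup_parts E'.nodup_parts).2 fun i =>
      iff_of_true (E.mem_parts i) (E'.mem_parts i))
  exact ⟨s * t, hs.trans ht, fun v => by rw [mono, hv, hv', smul_smul]; rfl⟩

/-- The linear map from `(det ℚ^S)^{⊗ n}` to the presented ring which sends the ordering induced by
an enumeration of a labelled partition to the corresponding monomial. -/
def eval (e : 𝒱 (2 * n)) [Finite S] (A : LPart 𝒱 n S) (v : S → H g) :
    DetPow n S →ₗ[ℚ] KRing g e :=
  have := A.fin
  -- The choice of enumeration is immaterial, by `eval_order`.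
  let E : PartEnum A.part := Classical.arbitrary _
  (DetPow.coord n E.order).smulRight (A.mono e E v)

/-- Passing to another enumeration multiplies the ordering and the monomial by the same scalar, so
every enumeration computes `eval`. From here on each identity may be checked on an enumeration
adapted to it. -/
theorem eval_order (even : ∀ d, Odd d → 𝒱 d = ⊥) [Finite S] (A : LPart 𝒱 n S) (v : S → H g)
    (E : PartEnum A.part) : A.eval e v (DetPow.mk n E.order) = A.mono e E v := by
  have := A.fin
  let E' : PartEnum A.part := Classical.arbitrary _
  obtain ⟨s, hs, hv⟩ := exists_signedPerm (g := g) (e := e) even A E E'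
  change DetPow.coord n E'.order _ • A.mono e E' v = _
  rw [hv, DetPow.mk_signedPerm hs rfl rfl, map_smul, DetPow.coord_mk, smul_eq_mul, mul_one]

omit [GradedAlgebra 𝒱] in
theorem eval_ext {M : Type*} [AddCommGroup M] [Module ℚ M] [Finite S] (A : LPart 𝒱 n S)
    {f f' : DetPow n S →ₗ[ℚ] M}
    (h : ∀ E : PartEnum A.part, f (DetPow.mk n E.order) = f' (DetPow.mk n E.order)) : f = f' := by
  have := A.fin
  let E : PartEnum A.part := Classical.arbitrary _
  exact DetPow.ext_ordering E.order (h E)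

theorem eval_relabel (even : ∀ d, Odd d → 𝒱 d = ⊥) [Finite S] [Finite T] (A : LPart 𝒱 n S)
    (B : LPart 𝒱 n T) (σ : S ≃ T) (φ : A.I ≃ B.I) (h : ∀ s, B.part (σ s) = φ (A.part s))
    (h' : ∀ i, B.deg (φ i) = A.deg i ∧ B.lab (φ i) = A.lab i) (v : T → H g) (w : DetPow n S) :
    B.eval e v (DetPow.relabel n σ w) = A.eval e (fun s => v (σ s)) w := by
  refine LinearMap.congr_fun (f := B.eval e v ∘ₗ DetPow.relabel n σ)
    (g := A.eval e fun s => v (σ s)) (A.eval_ext fun E => ?_) w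
  rw [LinearMap.comp_apply, DetPow.relabel_mk, ← E.transport_order σ φ h, eval_order even,
    eval_order even, mono, mono]
  simp [Function.comp_def, h']

theorem eval_iso (even : ∀ d, Odd d → 𝒱 d = ⊥) [Finite S] {A B : LPart 𝒱 n S} (h : A.Iso B)
    (v : S → H g) : A.eval e v = B.eval e v := by
  obtain ⟨φ, h₁, h₂⟩ := h
  ext w
  have : DetPow.relabel n (Equiv.refl S) = LinearMap.id :=
    PresMod.ext fun o => by simp [Ordering.relabel]
  have h := eval_relabel (e := e) even A B (.refl S) φ h₁ h₂ v w
  rw [this] at h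
  exact h.symm

/-- The part i occurs exactly once in an enumeration, so the monomial has a single factor involving
the changed label and is linear in it. -/
theorem eval_upd (even : ∀ d, Odd d → 𝒱 d = ⊥) [Finite S] (A : LPart 𝒱 n S) (i : A.I) (s t : ℚ)
    (x y : V) (hx : x ∈ 𝒱 (A.deg i)) (hy : y ∈ 𝒱 (A.deg i)) (h) (v : S → H g) :
    (A.upd i (s • x + t • y) h).eval e v =
      s • (A.upd i x hx).eval e v + t • (A.upd i y hy).eval e v := by
  classical
  refine A.eval_ext fun E => ?_
  rw [LinearMap.add_apply, LinearMap.smul_apply, LinearMap.smul_apply]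
  -- Changing a label leaves the underlying partition alone, so the same `E` enumerates all three
  -- updates.
  have key := fun z hz => eval_order (e := e) even (A.upd i z hz) v E
  refine (key _ _).trans (Eq.trans ?_
    (congrArg₂ (s • · + t • ·) (key x hx) (key y hy)).symm)
  obtain ⟨L₁, L₂, hL⟩ := List.append_of_mem (E.mem_parts i)
  have hnd := E.nodup_parts
  rw [hL, List.nodup_middle, List.nodup_cons, List.mem_append, not_or] at hnd
  have aux : ∀ (z : V) (L : List A.I), i ∉ L → (L.map fun j =>
      kap e (A.deg j) (if j = i then z else A.lab j) ((E.elems j).map v)) =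
      L.map fun j => kap e (A.deg j) (A.lab j) ((E.elems j).map v) := by
    intro z L hi
    refine List.map_congr_left fun j hj => ?_
    rw [if_neg]
    rintro rfl
    exact hi hj
  have main : ∀ (z) (hz : z ∈ 𝒱 (A.deg i)), (A.upd i z hz).mono e E v =
      (L₁.map fun j => kap e (A.deg j) (A.lab j) ((E.elems j).map v)).prod *
      (kap e (A.deg i) z ((E.elems i).map v) *
      (L₂.map fun j => kap e (A.deg j) (A.lab j) ((E.elems j).map v)).prod) := by
    intro z hz
    change (E.parts.map fun j => kap e (A.deg j) (if j = i then z else A.lab j)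
      ((E.elems j).map v)).prod = _
    rw [hL, List.map_append, List.prod_append, List.map_cons, List.prod_cons, aux z L₁ hnd.1.1,
      aux z L₂ hnd.1.2, if_pos rfl]
  rw [main, main, main, kap_smul_add s t hx hy, add_mul, mul_add, smul_mul_assoc, smul_mul_assoc,
    mul_smul_comm, mul_smul_comm]

theorem eval_sum (even : ∀ d, Odd d → 𝒱 d = ⊥) [Finite S] [Finite T] (A : LPart 𝒱 n S)
    (B : LPart 𝒱 n T) (v : S ⊕ T → H g) (w : DetPow n S) (w' : DetPow n T) :
    (A.sum B).eval e v (DetPow.mul n w w') =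
      A.eval e (fun s => v (.inl s)) w * B.eval e (fun t => v (.inr t)) w' := by
  refine LinearMap.congr_fun₂ (f := (DetPow.mul n).compr₂ ((A.sum B).eval e v))
    (g := (LinearMap.mul ℚ (KRing g e)).compl₁₂ (A.eval e fun s => v (.inl s))
      (B.eval e fun t => v (.inr t))) (A.eval_ext fun E => B.eval_ext fun E' => ?_) w w'
  rw [LinearMap.compr₂_apply, LinearMap.compl₁₂_apply, LinearMap.mul_apply', DetPow.mul_mk,
    ← PartEnum.sum_order, eval_order even, eval_order even]
  refine (eval_order even (A.sum B) v (E.sum E')).trans ?_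
  change ((E.parts.map Sum.inl ++ E'.parts.map Sum.inr).map fun i : A.I ⊕ B.I =>
    kap e (Sum.elim A.deg B.deg i) (Sum.elim A.lab B.lab i) (((E.sum E').elems i).map v)).prod = _
  rw [List.map_append, List.prod_append, List.map_map, List.map_map]
  simp [Function.comp_def, mono]

end LPart

/-! ### The standard dual bases -/

section StandardBasis

variable (n g : ℕ)

/-- The hyperbolic basis of `H(g)`. -/
def stdBasis (k : Fin g ⊕ Fin g) : H g := Pi.single k 1

/-- The basis of `H(g)` dual to the hyperbolic basis. -/
def stdDual : Fin g ⊕ Fin g → H g :=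
  Sum.elim (fun i => stdBasis g (.inr i)) fun i => (-1 : ℚ) ^ n • stdBasis g (.inl i)

variable {n g}

theorem pairing_apply (u w : H g) : pairing n g u w =
    ∑ i : Fin g, (u (.inl i) * w (.inr i) + (-1) ^ n * (u (.inr i) * w (.inl i))) := rfl

/-- Pairing with the dual basis reads off coordinates: on the second half the sign (-1)^n in
`stdDual` cancels the one in the pairing. -/
theorem pairing_stdDual (x : H g) (k : Fin g ⊕ Fin g) : pairing n g x (stdDual n g k) = x k := by
  rcases k with i | i
  · simp [pairing_apply, stdDual, stdBasis, Pi.single_apply]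
  · simp only [pairing_apply, stdDual, stdBasis, Sum.elim_inr, Pi.smul_apply, smul_eq_mul]
    simp only [Pi.single_apply, reduceCtorEq, if_false, Sum.inl.injEq, mul_zero, zero_add, mul_ite,
      mul_one, Finset.sum_ite_eq', Finset.mem_univ, if_true]
    rw [mul_left_comm, ← mul_pow]
    simp

theorem sum_pairing_stdDual (x : H g) :
    ∑ k, pairing n g x (stdDual n g k) • stdBasis g k = x := by
  simp only [pairing_stdDual]
  ext l
  simp [stdBasis, Pi.single_apply, Finset.sum_apply]

theorem exists_isDualBases_std (n g : ℕ) : ∃ ε : Fin (2 * g) ≃ Fin g ⊕ Fin g,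
    IsDualBases n (stdBasis g ∘ ε) (stdDual n g ∘ ε) := by
  refine ⟨Fintype.equivOfCardEq (by simp [two_mul]), fun i j => ?_⟩
  simp only [Function.comp_apply]
  rw [pairing_stdDual, stdBasis, Pi.single_apply]
  simp [eq_comm]

end StandardBasis

/-! ### Relation (3) in the standard dual bases -/

section KapStd

variable {V : Type*} [CommRing V] [Algebra ℚ V] {𝒱 : ℕ → Submodule ℚ V} {n g : ℕ}
variable [GradedAlgebra 𝒱] {e : 𝒱 (2 * n)}

/-- The double sum is what expanding a contracted form produces, with a basis vector in each of the
two contracted slots. Since ∑_{k'} λ(a_k^#, a_{k'}^#) a_{k'} = a_k^#, the inner sum collapses to the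
defining relation. The same happens in `kap_loop_std`. -/
theorem kap_edge_std {d d' : ℕ} {x y : V} (hx : x ∈ 𝒱 d) (hy : y ∈ 𝒱 d') (l l' : List (H g))
    (pos : 2 * n < d + n * (l.length + 1)) (pos' : 2 * n < d' + n * (l'.length + 1)) :
    ∑ k, ∑ k', pairing n g (stdDual n g k) (stdDual n g k') •
      (kap e d x (l ++ [stdBasis g k]) * kap e d' y (stdBasis g k' :: l')) =
      kap e (d + d') (x * y) (l ++ l') := by
  obtain ⟨ε, hε⟩ := exists_isDualBases_std n g
  rw [← kap_edge hε hx hy l l' pos pos', ← ε.sum_comp]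
  refine Finset.sum_congr rfl fun i _ => ?_
  obtain ⟨f, hf⟩ := exists_kap_linear e d' y [] l'
  simp only [List.nil_append] at hf
  simp only [← hf, ← mul_smul_comm, ← Finset.mul_sum, ← map_smul, ← map_sum, sum_pairing_stdDual]
  rfl

theorem kap_loop_std {d : ℕ} {x : V} (hx : x ∈ 𝒱 d) (l : List (H g))
    (pos : 2 * n < d + n * (l.length + 1 + 1)) :
    ∑ k, ∑ k', pairing n g (stdDual n g k) (stdDual n g k') •
      kap e d x (l ++ [stdBasis g k, stdBasis g k']) = kap e (2 * n + d) (e * x) l := by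
  obtain ⟨ε, hε⟩ := exists_isDualBases_std n g
  rw [← kap_loop hε hx l pos, ← ε.sum_comp]
  refine Finset.sum_congr rfl fun i _ => ?_
  obtain ⟨f, hf⟩ := exists_kap_linear e d x (l ++ [stdBasis g (ε i)]) []
  simp only [List.append_assoc, List.singleton_append] at hf
  simp only [← hf, ← map_smul, ← map_sum, sum_pairing_stdDual]
  exact hf _

end KapStd

/-! ### Expansion of forms in the standard basis -/

namespace KDual

variable {g : ℕ} {S T : Type} {M : Type*} [AddCommGroup M] [Module ℚ M]

/-- The pairing of a form `ξ` on `H(g)^{⊗ S}` with a function of `S`-indexed families of vectors,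
obtained by expanding `ξ` in the standard basis. -/
def expand (n : ℕ) [Finite S] (ξ : KDual g S) (F : (S → H g) → M) : M :=
  ∑ᶠ f : S → Fin g ⊕ Fin g, ξ (fun s => stdDual n g (f s)) • F fun s => stdBasis g (f s)

/-- The bilinear map underlying `expand`. -/
def expandMap (n : ℕ) [Finite S] : KDual g S →ₗ[ℚ] ((S → H g) → M) →ₗ[ℚ] M :=
  LinearMap.mk₂ ℚ (expand n)
    (fun ξ η F => by
      simp only [expand, _root_.add_apply, add_smul]
      exact finsum_add_distrib (Set.toFinite _) (Set.toFinite _))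
    (fun c ξ F => by
      simp only [expand, _root_.smul_apply, smul_assoc]
      exact (smul_finsum' c (Set.toFinite _)).symm)
    (fun ξ F G => by
      simp only [expand, Pi.add_apply, smul_add]
      exact finsum_add_distrib (Set.toFinite _) (Set.toFinite _))
    (fun c ξ F => by
      simp only [expand, Pi.smul_apply, smul_comm _ c]
      exact (smul_finsum' c (Set.toFinite _)).symm)

theorem expand_relabel (n : ℕ) [Finite S] [Finite T] (σ : S ≃ T) (ξ : KDual g T)
    (F : (S → H g) → M) :
    expand n (relabel σ ξ) F = expand n ξ fun v => F fun s => v (σ s) := by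
  refine finsum_eq_of_bijective (σ.arrowCongr (Equiv.refl _)) (Equiv.bijective _) fun f => ?_
  simp [Equiv.arrowCongr]

theorem expand_mul {R : Type*} [Ring R] [Algebra ℚ R] (n : ℕ) [Finite S] [Finite T]
    (ξ : KDual g S) (η : KDual g T) (F : (S → H g) → R) (G : (T → H g) → R) :
    expand n (mul ξ η) (fun v => F (fun s => v (.inl s)) * G fun t => v (.inr t)) =
      expand n ξ F * expand n η G := by
  have := Fintype.ofFinite (S → Fin g ⊕ Fin g)
  have := Fintype.ofFinite (T → Fin g ⊕ Fin g)
  have := Fintype.ofFinite (S ⊕ T → Fin g ⊕ Fin g)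
  simp only [expand, finsum_eq_sum_of_fintype]
  rw [Finset.sum_mul_sum, ← Fintype.sum_prod_type',
    ← (Equiv.sumArrowEquivProdArrow S T (Fin g ⊕ Fin g)).sum_comp]
  refine Finset.sum_congr rfl fun f _ => ?_
  rw [mul_apply, smul_mul_smul_comm]
  rfl

/-- The family of vectors indexed by `S` which is `x`, `y` on the contracted pair, and `v` on the
remaining elements. -/
def glue (σ : Fin 2 ⊕ T ≃ S) (x y : H g) (v : T → H g) (s : S) : H g :=
  Sum.elim ![x, y] v (σ.symm s)

theorem expand_contract (n : ℕ) [Finite S] [Finite T] (σ : Fin 2 ⊕ T ≃ S) (ξ : KDual g T)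
    (F : (S → H g) → M) :
    expand n (contract n σ ξ) F = expand n ξ fun v =>
      ∑ k, ∑ k', pairing n g (stdDual n g k) (stdDual n g k') •
        F (glue σ (stdBasis g k) (stdBasis g k') v) := by
  have := Fintype.ofFinite (S → Fin g ⊕ Fin g)
  have := Fintype.ofFinite (T → Fin g ⊕ Fin g)
  -- A multi-index on S is a multi-index on T together with two indices k, k' for the contracted
  -- pair; the factor λ of the contracted form sees only the latter.
  let Φ : (T → Fin g ⊕ Fin g) × (Fin g ⊕ Fin g) × (Fin g ⊕ Fin g) ≃ (S → Fin g ⊕ Fin g) :=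
    (((Equiv.refl _).prodCongr (finTwoArrowEquiv _).symm).trans (Equiv.prodComm _ _)).trans
      ((Equiv.sumArrowEquivProdArrow _ _ _).symm.trans (σ.arrowCongr (Equiv.refl _)))
  have hΦ : ∀ f k k' s, Φ (f, k, k') s = Sum.elim ![k, k'] f (σ.symm s) := fun f k k' s => rfl
  simp only [expand, finsum_eq_sum_of_fintype]
  rw [← Φ.sum_comp, Fintype.sum_prod_type]
  refine Finset.sum_congr rfl fun f _ => ?_
  rw [Fintype.sum_prod_type, Finset.smul_sum]
  refine Finset.sum_congr rfl fun k _ => ?_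
  rw [Finset.smul_sum]
  refine Finset.sum_congr rfl fun k' _ => ?_
  rw [contract_apply, smul_smul, mul_comm]
  simp only [hΦ, Equiv.symm_apply_apply, Sum.elim_inl, Sum.elim_inr]
  refine congrArg₂ _ rfl (congrArg F (funext fun s => ?_))
  rw [glue]
  rcases σ.symm s with i | t
  · fin_cases i <;> rfl
  · rfl

/-- The coefficients ∏ λ(v_i, a_{f i}^#) are products of coordinates of the v_i in the standard
basis, so the expansion reassembles F(v) by multilinearity. -/
theorem expand_dualTensor (n : ℕ) {r : ℕ} (v : Fin r → H g)
    (F : MultilinearMap ℚ (fun _ : Fin r => H g) M) : expand n (dualTensor n v) F = F v := by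
  rw [expand, finsum_eq_sum_of_fintype]
  conv_rhs => rw [← funext fun i => sum_pairing_stdDual (n := n) (v i)]
  rw [MultilinearMap.map_sum]
  refine Finset.sum_congr rfl fun f _ => ?_
  rw [MultilinearMap.map_smul_univ]
  simp [dualTensor]

end KDual

/-! ### Monomials and contractions -/

namespace LPart

variable {V : Type*} [CommRing V] [Algebra ℚ V] {𝒱 : ℕ → Submodule ℚ V} {n g : ℕ}
variable [GradedAlgebra 𝒱] {e : 𝒱 (2 * n)} {S T : Type}

theorem map_glue (σ : Fin 2 ⊕ T ≃ S) (x y : H g) (v : T → H g) (l : List T) :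
    (l.map fun t => σ (.inr t)).map (KDual.glue σ x y v) = l.map v := by
  simp [KDual.glue, Function.comp_def]

theorem forall_of_equiv (σ : Fin 2 ⊕ T ≃ S) {p : S → Prop} (h₀ : p (σ (.inl 0)))
    (h₁ : p (σ (.inl 1))) (h : ∀ t, p (σ (.inr t))) (s : S) : p s := by
  obtain ⟨i | t, rfl⟩ := σ.surjective s
  · fin_cases i
    exacts [h₀, h₁]
  · exact h t

-- The affected part p is enumerated first, with the contracted pair at its end. Up to moving this
-- adjacent pair, which is free of sign, only the first factor of the monomial is concerned, and
-- there the claim is `kap_loop_std`.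
open Classical in
theorem eval_loop (even : ∀ d, Odd d → 𝒱 d = ⊥) [Finite S] [Finite T] (σ : Fin 2 ⊕ T ≃ S)
    (A : LPart 𝒱 n S) (h : A.part (σ (.inl 0)) = A.part (σ (.inl 1))) (v : T → H g)
    (w : DetPow n T) :
    ∑ k, ∑ k', pairing n g (stdDual n g k) (stdDual n g k') •
        A.eval e (KDual.glue σ (stdBasis g k) (stdBasis g k') v) (DetPow.wedge n σ w) =
      (A.loop e σ h).eval e v w := by
  have := A.fin
  set p := A.part (σ (.inl 0)) with hp
  obtain ⟨L, hL, hL'⟩ := PartEnum.exists_list A.I fun i => i ≠ p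
  choose P hP hP' using fun i => PartEnum.exists_list T fun t => A.part (σ (.inr t)) = i
  have hpL : p ∉ L := fun hh => (hL' p).1 hh rfl
  -- `E'` enumerates the partition after contraction; `E` below enumerates the one before, with the
  -- pair inserted at the end of p.
  let E' : PartEnum fun t => A.part (σ (.inr t)) :=
    { parts := p :: L
      elems := P
      nodup_parts := List.nodup_cons.2 ⟨hpL, hL⟩
      mem_parts := fun i => by
        by_cases hi : i = p <;> simp [hi, hL']
      nodup_elems := hP
      mem_elems := hP' }
  let j : T → S := fun t => σ (.inr t)
  have hj : Function.Injective j := fun a b hab => Sum.inr_injective (σ.injective hab)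
  let E : PartEnum A.part :=
    { parts := p :: L
      elems := fun i => if i = p then (P p).map j ++ [σ (.inl 0), σ (.inl 1)] else (P i).map j
      nodup_parts := List.nodup_cons.2 ⟨hpL, hL⟩
      mem_parts := E'.mem_parts
      nodup_elems := fun i => by
        split_ifs with hi
        · refine List.Nodup.append ((hP p).map hj) (by simp) ?_
          intro s hs hs'
          obtain ⟨t, -, rfl⟩ := List.mem_map.1 hs
          simp [j] at hs'
        · exact (hP i).map hj
      mem_elems := fun i => by
        split_ifs with hi
        · subst hi
          refine forall_of_equiv σ ?_ ?_ fun t => ?_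
          · simp [hp]
          · simp [← h]
          · simp [j, hP']
        · refine forall_of_equiv σ ?_ ?_ fun t => ?_
          · simp [j, ← hp, Ne.symm hi]
          · simp [j, ← h, Ne.symm hi]
          · simp [j, hP'] }
  have hE : ∀ i ∈ L, E.elems i = (P i).map j := fun i hi => if_neg ((hL' i).1 hi)
  have hEp : E.elems p = (P p).map j ++ [σ (.inl 0), σ (.inl 1)] := if_pos rfl
  -- `wedge` puts the pair in front, whereas `E` lists it after the other elements of p.
  have horder : DetPow.wedge n σ (DetPow.mk n E'.order) = DetPow.mk n E.order := by
    rw [DetPow.wedge_mk]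
    refine DetPow.mk_move ((P p).map j) (L.flatMap fun i => (P i).map j) [] (σ (.inl 0))
      (σ (.inl 1)) _ _ ?_ ?_
    · simp [E', List.finRange_succ, List.map_flatMap, j, Function.comp_def]
    · simp only [PartEnum.order_list]
      change E.elems p ++ L.flatMap E.elems = _
      rw [List.flatMap_congr hE, hEp]
      simp
  have main : ∀ k k', A.eval e (KDual.glue σ (stdBasis g k) (stdBasis g k') v)
      (DetPow.mk n E.order) =
      kap e (A.deg p) (A.lab p) ((P p).map v ++ [stdBasis g k, stdBasis g k']) *
        (L.map fun i => kap e (A.deg i) (A.lab i) ((P i).map v)).prod := by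
    intro k k'
    rw [eval_order even, mono]
    change ((p :: L).map _).prod = _
    rw [List.map_cons, List.prod_cons, hEp, List.map_append, map_glue]
    refine congrArg₂ _ ?_ (congrArg List.prod (List.map_congr_left fun i hi => ?_))
    · simp [KDual.glue]
    · rw [hE i hi, map_glue]
  have main' : (A.loop e σ h).eval e v (DetPow.mk n E'.order) =
      kap e (2 * n + A.deg p) (e * A.lab p) ((P p).map v) *
        (L.map fun i => kap e (A.deg i) (A.lab i) ((P i).map v)).prod := by
    refine (eval_order even (A.loop e σ h) v E').trans ?_
    change ((p :: L).map fun i => kap e (if i = p then 2 * n + A.deg i else A.deg i)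
      (if i = p then e * A.lab i else A.lab i) ((P i).map v)).prod = _
    rw [List.map_cons, List.prod_cons, if_pos rfl, if_pos rfl]
    refine congrArg _ (congrArg List.prod (List.map_congr_left fun i hi => ?_))
    rw [if_neg ((hL' i).1 hi), if_neg ((hL' i).1 hi)]
  have pos : 2 * n < A.deg p + n * (((P p).map v).length + 1 + 1) := by
    have := A.pos p
    rw [← E.length_elems, hEp] at this
    simpa using this
  obtain ⟨c, rfl⟩ := DetPow.eq_smul E'.order w
  simp only [map_smul, horder, main, main', smul_comm _ c, ← Finset.smul_sum]
  rw [← kap_loop_std (A.lab_mem p) _ pos]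
  simp only [Finset.sum_mul, smul_mul_assoc]

-- The parts p and q to be merged come first, with the contracted element last in p and first in q
-- respectively. So the pair is adjacent in the ordering, and the first two factors of the monomial
-- have the shape of `kap_edge_std`.
open Classical in
theorem eval_merge (even : ∀ d, Odd d → 𝒱 d = ⊥) [Finite S] [Finite T] (σ : Fin 2 ⊕ T ≃ S)
    (A : LPart 𝒱 n S) (h : A.part (σ (.inl 0)) ≠ A.part (σ (.inl 1))) (v : T → H g)
    (w : DetPow n T) :
    ∑ k, ∑ k', pairing n g (stdDual n g k) (stdDual n g k') •
        A.eval e (KDual.glue σ (stdBasis g k) (stdBasis g k') v) (DetPow.wedge n σ w) =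
      (A.merge σ h).eval e v w := by
  have := A.fin
  let p := A.part (σ (.inl 0))
  let q := A.part (σ (.inl 1))
  have hpq : p ≠ q := h
  obtain ⟨L, hL, hL'⟩ := PartEnum.exists_list {i : A.I // i ≠ q} fun i => i.1 ≠ p
  choose P hP hP' using fun i => PartEnum.exists_list T fun t => A.part (σ (.inr t)) = i
  have hpL : ⟨p, hpq⟩ ∉ L := fun hh => (hL' _).1 hh rfl
  -- The merged part keeps the index p and lists the remaining elements of p before those of q, as v
  -- ⊗ w in the edge relation.
  let P' : {i : A.I // i ≠ q} → List T := fun i => if i.1 = p then P p ++ P q else P i.1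
  let E' : PartEnum (A.merge σ h).part :=
    { parts := (⟨p, hpq⟩ :: L : List {i : A.I // i ≠ q})
      elems := P'
      nodup_parts := List.nodup_cons.2 ⟨hpL, hL⟩
      mem_parts := by
        rintro ⟨i, hi⟩
        by_cases hip : i = p
        · subst hip
          exact List.mem_cons_self
        · exact List.mem_cons_of_mem _ ((hL' _).2 hip)
      nodup_elems := by
        rintro ⟨i, hi⟩
        change (if i = p then P p ++ P q else P i).Nodup
        split_ifs with hip
        · refine List.Nodup.append (hP p) (hP q) fun t ht ht' => ?_
          exact hpq (((hP' p t).1 ht).symm.trans ((hP' q t).1 ht'))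
        · exact hP i
      mem_elems := by
        rintro ⟨i, hi⟩ t
        change t ∈ (if i = p then P p ++ P q else P i) ↔ (if ht : A.part (σ (.inr t)) = q then
          (⟨p, hpq⟩ : {i : A.I // i ≠ q}) else ⟨A.part (σ (.inr t)), ht⟩) = ⟨i, hi⟩
        by_cases hip : i = p
        · subst hip
          by_cases ht : A.part (σ (.inr t)) = q <;> simp [ht, hP']
        · by_cases ht : A.part (σ (.inr t)) = q
          · have hi' : q ≠ i := Ne.symm hi
            simp [ht, hP', hip, Ne.symm hip, hi']
          · simp [ht, hP', hip] }
  let j : T → S := fun t => σ (.inr t)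
  have hj : Function.Injective j := fun a b hab => Sum.inr_injective (σ.injective hab)
  have hqp : q ≠ p := hpq.symm
  let E : PartEnum A.part :=
    { parts := p :: q :: L.map Subtype.val
      elems := fun i => if i = p then (P p).map j ++ [σ (.inl 0)] else
        if i = q then σ (.inl 1) :: (P q).map j else (P i).map j
      nodup_parts := by
        refine List.nodup_cons.2 ⟨?_, List.nodup_cons.2 ⟨?_, hL.map Subtype.val_injective⟩⟩
        · simp [hpq, hL']
        · simp
      mem_parts := fun i => by
        by_cases hi : i = p
        · simp [hi]
        · by_cases hi' : i = q <;> simp [hi, hi', hL']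
      nodup_elems := fun i => by
        split_ifs with hi hi'
        · refine List.Nodup.append ((hP p).map hj) (by simp) ?_
          intro s hs hs'
          obtain ⟨t, -, rfl⟩ := List.mem_map.1 hs
          simp [j] at hs'
        · exact List.nodup_cons.2 ⟨by simp [j], (hP q).map hj⟩
        · exact (hP i).map hj
      mem_elems := fun i => by
        have hp : A.part (σ (.inl 0)) = p := rfl
        have hq : A.part (σ (.inl 1)) = q := rfl
        split_ifs with hi hi'
        · subst hi
          refine forall_of_equiv σ ?_ ?_ fun t => ?_
          · simp [hp]
          · simp [j, hq, hqp]
          · simp [j, hP']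
        · subst hi'
          refine forall_of_equiv σ ?_ ?_ fun t => ?_
          · simp [j, hp, hpq]
          · simp [hq]
          · simp [j, hP']
        · refine forall_of_equiv σ ?_ ?_ fun t => ?_
          · simp [j, hp, Ne.symm hi]
          · simp [j, hq, Ne.symm hi']
          · simp [j, hP'] }
  have hE : ∀ i ∈ L, E.elems i.1 = (P i.1).map j := fun i hi =>
    (if_neg ((hL' i).1 hi)).trans (if_neg i.2)
  have hEp : E.elems p = (P p).map j ++ [σ (.inl 0)] := if_pos rfl
  have hEq : E.elems q = σ (.inl 1) :: (P q).map j := (if_neg hqp).trans (if_pos rfl)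
  have hE' : ∀ i ∈ L, P' i = P i.1 := fun i hi => if_neg ((hL' i).1 hi)
  have hEp' : P' ⟨p, hpq⟩ = P p ++ P q := if_pos rfl
  -- The pair moves from the front past the remaining elements of p, to the junction of p and q,
  -- without a sign.
  have horder : DetPow.wedge n σ (DetPow.mk n E'.order) = DetPow.mk n E.order := by
    rw [DetPow.wedge_mk]
    refine DetPow.mk_move ((P p).map j) ((P q).map j ++ L.flatMap fun i => (P i.1).map j) []
      (σ (.inl 0)) (σ (.inl 1)) _ _ ?_ ?_
    · have : E'.order.list = P p ++ P q ++ L.flatMap fun i => P i.1 := by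
        change P' ⟨p, hpq⟩ ++ L.flatMap P' = _
        rw [List.flatMap_congr hE', hEp']
      rw [Ordering.relabel_list, Ordering.append_list, this]
      simp [List.finRange_succ, List.map_flatMap, j, Function.comp_def]
    · simp only [PartEnum.order_list]
      change E.elems p ++ (E.elems q ++ (L.map Subtype.val).flatMap E.elems) = _
      rw [List.flatMap_map, List.flatMap_congr hE, hEp, hEq]
      simp
  have main : ∀ k k', A.eval e (KDual.glue σ (stdBasis g k) (stdBasis g k') v)
      (DetPow.mk n E.order) =
      kap e (A.deg p) (A.lab p) ((P p).map v ++ [stdBasis g k]) *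
        kap e (A.deg q) (A.lab q) (stdBasis g k' :: (P q).map v) *
        (L.map fun i => kap e (A.deg i.1) (A.lab i.1) ((P i.1).map v)).prod := by
    intro k k'
    rw [eval_order even, mono]
    change ((p :: q :: L.map Subtype.val).map _).prod = _
    rw [List.map_cons, List.map_cons, List.prod_cons, List.prod_cons, hEp, hEq, List.map_append,
      List.map_cons (l := (P q).map j), map_glue, map_glue, List.map_map, mul_assoc]
    refine congrArg₂ _ ?_ (congrArg₂ _ ?_ (congrArg List.prod (List.map_congr_left fun i hi => ?_)))
    · simp [KDual.glue]
    · simp [KDual.glue]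
    · rw [Function.comp_apply, hE i hi, map_glue]
  have main' : (A.merge σ h).eval e v (DetPow.mk n E'.order) =
      kap e (A.deg p + A.deg q) (A.lab p * A.lab q) ((P p).map v ++ (P q).map v) *
        (L.map fun i => kap e (A.deg i.1) (A.lab i.1) ((P i.1).map v)).prod := by
    refine (eval_order even (A.merge σ h) v E').trans ?_
    change ((⟨p, hpq⟩ :: L : List {i : A.I // i ≠ q}).map fun i =>
      kap e (if i.1 = p then A.deg i.1 + A.deg q else A.deg i.1)
      (if i.1 = p then A.lab i.1 * A.lab q else A.lab i.1) ((P' i).map v)).prod = _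
    rw [List.map_cons, List.prod_cons, if_pos rfl, if_pos rfl, hEp', List.map_append]
    refine congrArg _ (congrArg List.prod (List.map_congr_left fun i hi => ?_))
    rw [if_neg ((hL' i).1 hi), if_neg ((hL' i).1 hi), hE' i hi]
  have pos : 2 * n < A.deg p + n * (((P p).map v).length + 1) := by
    have := A.pos p
    rw [← E.length_elems, hEp] at this
    simpa using this
  have pos' : 2 * n < A.deg q + n * (((P q).map v).length + 1) := by
    have := A.pos q
    rw [← E.length_elems, hEq] at this
    simpa using this
  obtain ⟨c, rfl⟩ := DetPow.eq_smul E'.order w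
  simp only [map_smul, horder, main, main', smul_comm _ c, ← Finset.smul_sum]
  rw [← kap_edge_std (A.lab_mem p) (A.lab_mem q) _ _ pos pos']
  simp only [Finset.sum_mul, smul_mul_assoc]

theorem eval_contract (even : ∀ d, Odd d → 𝒱 d = ⊥) [Finite S] [Finite T] (σ : Fin 2 ⊕ T ≃ S)
    (A : LPart 𝒱 n S) (v : T → H g) (w : DetPow n T) :
    ∑ k, ∑ k', pairing n g (stdDual n g k) (stdDual n g k') •
        A.eval e (KDual.glue σ (stdBasis g k) (stdBasis g k') v) (DetPow.wedge n σ w) =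
      (A.contract e σ).eval e v w := by
  unfold contract
  split_ifs with h
  exacts [eval_loop even σ A h v w, eval_merge even σ A h v w]

end LPart

/-! ### From the coend to the presented ring -/

section Psi

variable {V : Type*} [CommRing V] [Algebra ℚ V] {𝒱 : ℕ → Submodule ℚ V} {n g : ℕ}
variable [GradedAlgebra 𝒱] {e : 𝒱 (2 * n)} {S T : Type}

/-- The extension of `LPart.eval` to linear combinations of labelled partitions. -/
def PP.eval (g : ℕ) (e : 𝒱 (2 * n)) (even : ∀ d, Odd d → 𝒱 d = ⊥) (S : Type) [Finite S] :
    PP 𝒱 n S →ₗ[ℚ] (S → H g) → DetPow n S →ₗ[ℚ] KRing g e :=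
  PresMod.lift (fun A : LPart 𝒱 n S => A.eval e) (by
    rintro _ (⟨A, B, h, rfl⟩ | ⟨A, i, s, t, x, y, hx, hy, rfl⟩)
    · rw [map_sub, Finsupp.linearCombination_single, Finsupp.linearCombination_single, one_smul,
        one_smul]
      exact funext fun v => sub_eq_zero.2 (LPart.eval_iso even h v)
    · simp only [map_sub, map_add, map_smul, Finsupp.linearCombination_single, one_smul]
      exact funext fun v => sub_eq_zero.2 (LPart.eval_upd even A i s t x y hx hy _ v))

variable (even : ∀ d, Odd d → 𝒱 d = ⊥)

@[simp] theorem PP.eval_mk [Finite S] (A : LPart 𝒱 n S) :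
    PP.eval g e even S (PP.mk A) = A.eval e := by
  simp [PP.eval]

theorem PP.eval_relabel [Finite S] [Finite T] (σ : S ≃ T) (p : PP 𝒱 n S) (w : DetPow n S)
    (v : T → H g) : PP.eval g e even T (PP.relabel σ p) v (DetPow.relabel n σ w) =
      PP.eval g e even S p (fun s => v (σ s)) w := by
  refine LinearMap.congr_fun
    (f := LinearMap.applyₗ (DetPow.relabel n σ w) ∘ₗ LinearMap.proj v ∘ₗ
      PP.eval g e even T ∘ₗ PP.relabel σ)
    (g := LinearMap.applyₗ w ∘ₗ LinearMap.proj (fun s => v (σ s)) ∘ₗ PP.eval g e even S)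
    (PresMod.ext fun A => ?_) p
  simp only [LinearMap.comp_apply, LinearMap.proj_apply, LinearMap.applyₗ_apply_apply]
  rw [PP.relabel_mk, PP.eval_mk, PP.eval_mk]
  exact LPart.eval_relabel even A (A.relabel σ) σ (.refl _)
    (fun s => congrArg A.part (σ.symm_apply_apply s)) (fun _ => ⟨rfl, rfl⟩) v w

theorem PP.eval_mul [Finite S] [Finite T] (p : PP 𝒱 n S) (q : PP 𝒱 n T) (w : DetPow n S)
    (w' : DetPow n T) (v : S ⊕ T → H g) :
    PP.eval g e even (S ⊕ T) (PP.mul p q) v (DetPow.mul n w w') =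
      PP.eval g e even S p (fun s => v (.inl s)) w *
        PP.eval g e even T q (fun t => v (.inr t)) w' := by
  refine LinearMap.congr_fun₂
    (f := PP.mul.compr₂ (LinearMap.applyₗ (DetPow.mul n w w') ∘ₗ LinearMap.proj v ∘ₗ
      PP.eval g e even (S ⊕ T)))
    (g := (LinearMap.mul ℚ (KRing g e)).compl₁₂
      (LinearMap.applyₗ w ∘ₗ LinearMap.proj (fun s => v (.inl s)) ∘ₗ PP.eval g e even S)
      (LinearMap.applyₗ w' ∘ₗ LinearMap.proj (fun t => v (.inr t)) ∘ₗ PP.eval g e even T))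
    (PresMod.ext fun A => PresMod.ext fun B => ?_) p q
  simp only [LinearMap.compr₂_apply, LinearMap.compl₁₂_apply, LinearMap.comp_apply,
    LinearMap.proj_apply, LinearMap.applyₗ_apply_apply, LinearMap.mul_apply']
  rw [PP.mul_mk, PP.eval_mk, PP.eval_mk, PP.eval_mk]
  exact LPart.eval_sum even A B v w w'

theorem PP.eval_contract [Finite S] [Finite T] (σ : Fin 2 ⊕ T ≃ S) (p : PP 𝒱 n S)
    (w : DetPow n T) (v : T → H g) :
    ∑ k, ∑ k', pairing n g (stdDual n g k) (stdDual n g k') •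
        PP.eval g e even S p (KDual.glue σ (stdBasis g k) (stdBasis g k') v)
          (DetPow.wedge n σ w) =
      PP.eval g e even T (PP.contract e σ p) v w := by
  have := LinearMap.congr_fun
    (f := ∑ k, ∑ k', pairing n g (stdDual n g k) (stdDual n g k') •
      (LinearMap.applyₗ (DetPow.wedge n σ w) ∘ₗ
        LinearMap.proj (KDual.glue σ (stdBasis g k) (stdBasis g k') v) ∘ₗ PP.eval g e even S))
    (g := LinearMap.applyₗ w ∘ₗ LinearMap.proj v ∘ₗ PP.eval g e even T ∘ₗ PP.contract e σ)
    (PresMod.ext fun A => ?_) p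
  · simpa only [LinearMap.sum_apply, LinearMap.smul_apply, LinearMap.comp_apply,
      LinearMap.proj_apply, LinearMap.applyₗ_apply_apply] using this
  · simp only [LinearMap.sum_apply, LinearMap.smul_apply, LinearMap.comp_apply,
      LinearMap.proj_apply, LinearMap.applyₗ_apply_apply]
    rw [PP.contract_mk, PP.eval_mk, PP.eval_mk]
    exact LPart.eval_contract even σ A v w

/-- `PP.eval`, as a map on the tensor product. -/
def evalTensor (g : ℕ) (e : 𝒱 (2 * n)) (S : Type) [Finite S] :
    PP 𝒱 n S ⊗[ℚ] DetPow n S →ₗ[ℚ] (S → H g) → KRing g e :=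
  TensorProduct.lift (LinearMap.mk₂ ℚ (fun p w v => PP.eval g e even S p v w)
    (fun p q w => by ext v; simp)
    (fun c p w => by ext v; simp)
    (fun p w w' => by ext v; simp)
    (fun c p w => by ext v; simp))

/-- The map on the sum of all the `K^∨(S) ⊗ (P(S, V)'_{≥ 0} ⊗ (det ℚ^S)^{⊗ n})` which induces the
inverse of the comparison map. -/
def psiTotal (g : ℕ) (e : 𝒱 (2 * n)) : Total 𝒱 n g →ₗ[ℚ] KRing g e :=
  Total.lift fun S =>
    have := S.fin
    TensorProduct.lift ((KDual.expandMap n).compl₂ (evalTensor even g e S.carrier))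

theorem psiTotal_gen [Finite S] (ξ : KDual g S) (p : PP 𝒱 n S) (w : DetPow n S) :
    psiTotal even g e (gen ξ p w) = KDual.expand n ξ fun v => PP.eval g e even S p v w := by
  unfold psiTotal gen
  rw [Total.lift_of]
  rfl

/-- The linear map from the coend to the presented ring. -/
def psi (g : ℕ) (e : 𝒱 (2 * n)) : RV g e →ₗ[ℚ] KRing g e :=
  RV.lift (psiTotal even g e) (by
    rintro _ (⟨σ, ξ, p, w⟩ | ⟨σ, ξ, p, w⟩)
    · rw [map_sub, sub_eq_zero, psiTotal_gen, psiTotal_gen, KDual.expand_relabel]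
      simp only [PP.eval_relabel]
    -- The contraction relations of the coend hold in the presented ring because of relation (3),
    -- through `PP.eval_contract`.
    · rw [map_sub, sub_eq_zero, psiTotal_gen, psiTotal_gen, KDual.expand_contract]
      simp only [PP.eval_contract])

theorem psi_cls [Finite S] (ξ : KDual g S) (p : PP 𝒱 n S) (w : DetPow n S) :
    psi even g e (RV.cls e ξ p w) = KDual.expand n ξ fun v => PP.eval g e even S p v w :=
  psiTotal_gen even ξ p w

theorem psi_mul (x y : RV g e) : psi even g e (x * y) = psi even g e x * psi even g e y := by
  refine LinearMap.congr_fun₂ (f := (RV.mulMap g e).compr₂ (psi even g e))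
    (g := (LinearMap.mul ℚ (KRing g e)).compl₁₂ (psi even g e) (psi even g e))
    (RV.ext fun S _ ξ p w => RV.ext fun T _ η q w' => ?_) x y
  rw [LinearMap.compr₂_apply, LinearMap.compl₁₂_apply, LinearMap.mul_apply', RV.mulMap_cls,
    psi_cls, psi_cls, psi_cls, ← KDual.expand_mul]
  simp only [PP.eval_mul]

theorem psi_one : psi even g e 1 = 1 := by
  refine (psi_cls even _ _ _).trans ?_
  -- There is a single multi-index on the empty set, and the monomial of the partition without parts
  -- is the empty product.
  rw [KDual.expand, finsum_unique, PP.eval_mk]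
  let E : PartEnum (LPart.empty 𝒱 n).part :=
    ⟨[], fun i => i.elim, List.nodup_nil, fun i => i.elim, fun i => i.elim, fun i => i.elim⟩
  have : (Ordering.nil : Ordering Empty) = E.order := Ordering.ext rfl
  rw [this, LPart.eval_order even]
  simp [LPart.mono, E, KDual.one]

/-- The monomial of a one-part partition, in its standard ordering, is the generator itself,
multilinear in its vectors; `KDual.expand_dualTensor` then returns its value at the given vectors.
-/
theorem psi_kappa (x : KGen 𝒱 n g) : psi even g e (kappa e x) = KRing.gen e x := by
  rw [kappa, psi_cls, PP.eval_mk]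
  have h : (fun v : Fin x.r → H g => (LPart.single n (Fin x.r) x.d x.c x.mem
      (by simpa using x.pos)).eval e v (DetPow.mk n (Ordering.fin x.r))) =
      kapMulti e x.mem x.pos := by
    funext v
    rw [kapMulti_apply, ← PartEnum.ofOrdering_order (Ordering.fin x.r)]
    refine (LPart.eval_order even (LPart.single n (Fin x.r) x.d x.c x.mem _) v
      (PartEnum.ofOrdering (Ordering.fin x.r))).trans ?_
    change ([()].map fun _ => kap e x.d x.c ((List.finRange x.r).map v)).prod = _
    simp [List.ofFn_eq_map]
  rw [h, KDual.expand_dualTensor]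
  rfl

end Psi

/-! ### The defining relations hold in the coend -/

section DualBases

variable {n g : ℕ}

/-- `IsDualBases` only records duality. It forces the a'_i to be independent, hence a basis since
there are 2g of them, and the identity is clear on each a'_j. -/
theorem sum_pairing_smul {a a' : Fin (2 * g) → H g} (ha : IsDualBases n a a') (x : H g) :
    ∑ i, pairing n g (a i) x • a' i = x := by
  have hli : LinearIndependent ℚ a' := by
    rw [Fintype.linearIndependent_iff]
    intro c hc i
    have := congrArg (pairing n g (a i)) hc
    simpa [ha i] using this
  have hspan : Submodule.span ℚ (Set.range a') = ⊤ :=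
    hli.span_eq_top_of_card_eq_finrank' (by simp [two_mul])
  have : (∑ i, (pairing n g (a i)).smulRight (a' i)) = LinearMap.id := by
    refine LinearMap.ext_on_range hspan fun j => ?_
    simp [LinearMap.sum_apply, ha _ j]
  simpa [LinearMap.sum_apply] using LinearMap.congr_fun this x

/-- The decomposition λ = ∑ λ(a_i, -) ⊗ λ(a_i^#, -), which turns the sums in relation (3) into forms
pulled back along a contraction. -/
theorem sum_pairing_mul_pairing {a a' : Fin (2 * g) → H g} (ha : IsDualBases n a a') (x y : H g) :
    ∑ i, pairing n g (a i) x * pairing n g (a' i) y = pairing n g x y := by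
  conv_rhs => rw [← sum_pairing_smul ha x]
  simp [LinearMap.sum_apply]

end DualBases

section DualTensor

variable {n g : ℕ}

theorem dualTensor_apply {r : ℕ} (v u : Fin r → H g) :
    dualTensor n v u = ∏ i, pairing n g (v i) (u i) := by
  simp [dualTensor]

theorem dualTensor_update {r : ℕ} (v : Fin r → H g) (i : Fin r) (s t : ℚ) (x y : H g) :
    dualTensor n (Function.update v i (s • x + t • y)) =
      s • dualTensor n (Function.update v i x) + t • dualTensor n (Function.update v i y) := by
  refine MultilinearMap.ext fun u => ?_
  let f : MultilinearMap ℚ (fun _ : Fin r => H g) ℚ :=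
    (MultilinearMap.mkPiAlgebra ℚ (Fin r) ℚ).compLinearMap fun i => (pairing n g).flip (u i)
  have hf : ∀ v, dualTensor n v u = f v := fun v => by simp [dualTensor, f]
  rw [_root_.add_apply, _root_.smul_apply, _root_.smul_apply, hf, hf, hf, f.map_update_add,
    f.map_update_smul, f.map_update_smul]

end DualTensor

namespace DetPow

variable {n : ℕ} {S : Type}

theorem relabel_perm [Finite S] [Fintype S] [DecidableEq S] (σ : Equiv.Perm S) (w : DetPow n S) :
    relabel n σ w = ((Equiv.Perm.sign σ : ℤ) : ℚ) ^ n • w := by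
  induction σ using Equiv.Perm.swap_induction_on generalizing w with
  | one =>
    obtain ⟨l, hl, hl'⟩ := PartEnum.exists_list S fun _ => True
    obtain ⟨c, rfl⟩ := eq_smul ⟨l, hl, fun s => (hl' s).2 trivial⟩ w
    rw [map_smul, relabel_mk]
    simp [Ordering.relabel]
  | swap_mul τ a b hab ih =>
    obtain ⟨l, hl, hl'⟩ := PartEnum.exists_list S fun s => s ≠ a ∧ s ≠ b
    -- In an ordering that begins with a, b, the swap of a and b is an adjacent transposition.
    let o : Ordering S := ⟨a :: b :: l, by simp [hl, hl', hab], fun s => by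
      by_cases h : s = a <;> by_cases h' : s = b <;> simp [h, h', hl']⟩
    have hl'' : l.map (Equiv.swap a b) = l := by
      refine (List.map_congr_left fun s hs => ?_).trans (List.map_id l)
      exact Equiv.swap_apply_of_ne_of_ne ((hl' s).1 hs).1 ((hl' s).1 hs).2
    have hswap : ∀ w : DetPow n S, relabel n (Equiv.swap a b) w = (-1 : ℚ) ^ n • w := by
      intro w
      obtain ⟨c, rfl⟩ := eq_smul o w
      rw [map_smul, relabel_mk, smul_comm]
      congr 1
      refine mk_swap [] l a b ?_ rfl
      simp [o, hl'']
    have hcomp : relabel n (Equiv.swap a b * τ) w =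
        relabel n (Equiv.swap a b) (relabel n τ w) := by
      obtain ⟨c, rfl⟩ := eq_smul o w
      have h : o.relabel (Equiv.swap a b * τ) = (o.relabel τ).relabel (Equiv.swap a b) :=
        Ordering.ext (by simp [Function.comp_def])
      simp only [map_smul, relabel_mk, h]
    rw [hcomp, hswap, ih, smul_smul, Equiv.Perm.sign_mul, Equiv.Perm.sign_swap hab]
    simp only [Units.val_mul, Units.val_neg, Units.val_one, Int.cast_mul, Int.cast_neg,
      Int.cast_one, mul_pow]

end DetPow

/-! ### The classes κ in the coend and the comparison map -/

section Relations

variable {V : Type*} [CommRing V] [Algebra ℚ V] {𝒱 : ℕ → Submodule ℚ V} {n g : ℕ}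
variable [GradedAlgebra 𝒱] {e : 𝒱 (2 * n)}

/-- The class of `ξ ⊗ p ⊗ w` is linear in `ξ`. -/
def RV.clsMap (e : 𝒱 (2 * n)) {S : Type} [Finite S] (p : PP 𝒱 n S) (w : DetPow n S) :
    KDual g S →ₗ[ℚ] RV g e :=
  RV.proj g e ∘ₗ ofSummand ⟨S, inferInstance⟩ ∘ₗ (TensorProduct.mk ℚ _ _).flip (p ⊗ₜ w)

theorem RV.clsMap_apply {S : Type} [Finite S] (ξ : KDual g S) (p : PP 𝒱 n S) (w : DetPow n S) :
    RV.clsMap e p w ξ = RV.cls e ξ p w := rfl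

theorem RV.cls_smul_add {S : Type} [Finite S] (s t : ℚ) (ξ : KDual g S) (p q : PP 𝒱 n S)
    (w : DetPow n S) :
    RV.cls e ξ (s • p + t • q) w = s • RV.cls e ξ p w + t • RV.cls e ξ q w := by
  unfold RV.cls gen
  rw [TensorProduct.add_tmul, TensorProduct.tmul_add, map_add, map_add, ← TensorProduct.smul_tmul',
    ← TensorProduct.smul_tmul', TensorProduct.tmul_smul, TensorProduct.tmul_smul, map_smul, map_smul,
    map_smul, map_smul]

theorem RV.cls_smul_right {S : Type} [Finite S] (s : ℚ) (ξ : KDual g S) (p : PP 𝒱 n S)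
    (w : DetPow n S) : RV.cls e ξ p (s • w) = s • RV.cls e ξ p w := by
  unfold RV.cls gen
  rw [TensorProduct.tmul_smul, TensorProduct.tmul_smul, map_smul, map_smul]

theorem RV.cls_mul_cls {S T : Type} [Finite S] [Finite T] (ξ : KDual g S)
    (p : PP 𝒱 n S) (w : DetPow n S) (η : KDual g T) (q : PP 𝒱 n T) (v : DetPow n T) :
    RV.cls e ξ p w * RV.cls e η q v =
      RV.cls e (KDual.mul ξ η) (PP.mul p q) (DetPow.mul n w v) :=
  RV.mulMap_cls ξ p w η q v

theorem kappa_mk {r d : ℕ} {c : V} (hc : c ∈ 𝒱 d) (v : Fin r → H g) (pos : 2 * n < d + n * r)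
    (pos' : 2 * n < d + n * Nat.card (Fin r)) :
    kappa e ⟨r, d, c, hc, v, pos⟩ = RV.clsMap e (PP.mk (LPart.single n (Fin r) d c hc pos'))
      (DetPow.mk n (Ordering.fin r)) (dualTensor n v) := rfl

theorem kappa_mul_kappa {r r' d d' : ℕ} {c c' : V} (hc : c ∈ 𝒱 d) (hc' : c' ∈ 𝒱 d')
    (v : Fin r → H g) (v' : Fin r' → H g) (pos : 2 * n < d + n * r) (pos' : 2 * n < d' + n * r')
    (h : 2 * n < d + n * Nat.card (Fin r)) (h' : 2 * n < d' + n * Nat.card (Fin r')) :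
    kappa e ⟨r, d, c, hc, v, pos⟩ * kappa e ⟨r', d', c', hc', v', pos'⟩ =
      RV.clsMap e
        (PP.mk ((LPart.single n (Fin r) d c hc h).sum (LPart.single n (Fin r') d' c' hc' h')))
        (DetPow.mk n ((Ordering.fin r).append (Ordering.fin r')))
        (KDual.mul (dualTensor n v) (dualTensor n v')) := by
  rw [kappa_mk hc v pos h, kappa_mk hc' v' pos' h', RV.clsMap_apply, RV.clsMap_apply,
    RV.cls_mul_cls, PP.mul_mk, DetPow.mul_mk]
  rfl

theorem kappa_linear_label (r d : ℕ) (v : Fin r → H g) (s t : ℚ) (c c' : V) (hc : c ∈ 𝒱 d)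
    (hc' : c' ∈ 𝒱 d) (h) (pos : 2 * n < d + n * r) :
    kappa e ⟨r, d, s • c + t • c', h, v, pos⟩ =
      s • kappa e ⟨r, d, c, hc, v, pos⟩ + t • kappa e ⟨r, d, c', hc', v, pos⟩ := by
  have pos' : 2 * n < d + n * Nat.card (Fin r) := by simpa using pos
  -- A one-part partition with any label is an update of a fixed one, so the linearity relation
  -- between labelled partitions applies.
  have key : ∀ z hz, PP.mk (LPart.single n (Fin r) d z hz pos') =
      PP.mk ((LPart.single n (Fin r) d c hc pos').upd () z hz) := fun z hz =>
    PP.mk_lab (funext fun i => (if_pos rfl).symm)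
  have h' : PP.mk (LPart.single n (Fin r) d (s • c + t • c') h pos') =
      s • PP.mk (LPart.single n (Fin r) d c hc pos') +
        t • PP.mk (LPart.single n (Fin r) d c' hc' pos') := by
    rw [key c, key c']
    exact (key _ h).trans (PP.mk_upd (LPart.single n (Fin r) d c hc pos') () s t c c' hc hc' _)
  rw [kappa_mk h v pos pos', kappa_mk hc v pos pos', kappa_mk hc' v pos pos', h']
  simp only [RV.clsMap_apply]
  exact RV.cls_smul_add _ _ _ _ _ _

theorem kappa_eq_zero_of_odd (even : ∀ d, Odd d → 𝒱 d = ⊥) (x : KGen 𝒱 n g) (hx : Odd x.d) :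
    kappa e x = 0 := by
  obtain ⟨r, d, c, hc, v, pos⟩ := x
  obtain rfl : c = 0 := by
    have := even d hx ▸ hc
    simpa using this
  have := kappa_linear_label (e := e) r d v 0 0 0 0 (zero_mem _) (zero_mem _) (by simp) pos
  simpa using this

/-- The exchange of the two summands of `Fin r ⊕ Fin r'` is moved across the coend. It matches the
forms and the partitions without sign and acts on the determinant by (-1)^{nrr'}, which is the
Koszul sign when both labels are even; otherwise a class vanishes. -/
theorem kappa_comm (even : ∀ d, Odd d → 𝒱 d = ⊥) (x y : KGen 𝒱 n g) :
    kappa e x * kappa e y = ((-1 : ℚ) ^ (x.degree * y.degree)) • (kappa e y * kappa e x) := by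
  rcases Nat.even_or_odd x.d with hx | hx
  swap
  · simp [kappa_eq_zero_of_odd even x hx]
  rcases Nat.even_or_odd y.d with hy | hy
  swap
  · simp [kappa_eq_zero_of_odd even y hy]
  rw [KGen.neg_one_pow_degree_mul x y hx hy]
  obtain ⟨r, d, c, hc, v, pos⟩ := x
  obtain ⟨r', d', c', hc', v', pos'⟩ := y
  have h : 2 * n < d + n * Nat.card (Fin r) := by simpa using pos
  have h' : 2 * n < d' + n * Nat.card (Fin r') := by simpa using pos'
  rw [kappa_mul_kappa hc hc' v v' pos pos' h h', kappa_mul_kappa hc' hc v' v pos' pos h' h]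
  have h₁ : KDual.mul (dualTensor n v') (dualTensor n v) =
      KDual.relabel (Equiv.sumComm _ _) (KDual.mul (dualTensor n v) (dualTensor n v')) := by
    refine MultilinearMap.ext fun u => ?_
    rw [KDual.mul_apply, KDual.relabel_apply, KDual.mul_apply, mul_comm]
    rfl
  have h₂ : PP.relabel (Equiv.sumComm _ _) (PP.mk ((LPart.single n (Fin r') d' c' hc' h').sum
      (LPart.single n (Fin r) d c hc h))) =
      PP.mk ((LPart.single n (Fin r) d c hc h).sum (LPart.single n (Fin r') d' c' hc' h')) := by
    rw [PP.relabel_mk]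
    refine PP.mk_iso ⟨Equiv.sumComm _ _, ?_, ?_⟩
    · rintro (i | i) <;> rfl
    · rintro (i | i) <;> exact ⟨rfl, rfl⟩
  have h₃ : DetPow.mk n ((Ordering.fin r).append (Ordering.fin r')) =
      (-1 : ℚ) ^ (n * (r * r')) • DetPow.relabel n (Equiv.sumComm _ _)
        (DetPow.mk n ((Ordering.fin r').append (Ordering.fin r))) := by
    have := SignedPerm.append_comm (n := n)
      ((List.finRange r).map (Sum.inl : _ → Fin r ⊕ Fin r')) ((List.finRange r').map Sum.inr)
    rw [List.length_map, List.length_map, List.length_finRange, List.length_finRange] at this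
    rw [DetPow.relabel_mk]
    exact DetPow.mk_signedPerm this rfl (by simp [Function.comp_def])
  rw [h₃, RV.clsMap_apply, RV.clsMap_apply, RV.cls_smul_right, h₁, RV.cls_relabel, h₂]

theorem kappa_linear_vector (r d : ℕ) (v : Fin r → H g) (i : Fin r) (s t : ℚ) (x y : H g) (c : V)
    (hc : c ∈ 𝒱 d) (pos : 2 * n < d + n * r) :
    kappa e ⟨r, d, c, hc, Function.update v i (s • x + t • y), pos⟩ =
      s • kappa e ⟨r, d, c, hc, Function.update v i x, pos⟩ +
        t • kappa e ⟨r, d, c, hc, Function.update v i y, pos⟩ := by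
  have pos' : 2 * n < d + n * Nat.card (Fin r) := by simpa using pos
  rw [kappa_mk hc _ pos pos', kappa_mk hc _ pos pos', kappa_mk hc _ pos pos', dualTensor_update,
    map_add, map_smul, map_smul]

/-- Permuting the vectors pulls the form back along σ. Across the coend, σ fixes the one-part
partition and acts on the determinant power by sign(σ)^n. -/
theorem kappa_symmetry (r d : ℕ) (v : Fin r → H g) (σ : Equiv.Perm (Fin r)) (c : V)
    (hc : c ∈ 𝒱 d) (pos : 2 * n < d + n * r) :
    kappa e ⟨r, d, c, hc, fun i => v (σ i), pos⟩ =
      ((Equiv.Perm.sign σ : ℤ) : ℚ) ^ n • kappa e ⟨r, d, c, hc, v, pos⟩ := by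
  have pos' : 2 * n < d + n * Nat.card (Fin r) := by simpa using pos
  have h : dualTensor n (fun i => v (σ i)) = KDual.relabel σ (dualTensor n v) := by
    refine MultilinearMap.ext fun u => ?_
    rw [KDual.relabel_apply, dualTensor_apply, dualTensor_apply,
      ← Equiv.prod_comp σ fun j => pairing n g (v j) (u (σ.symm j))]
    simp
  rw [kappa_mk hc _ pos pos', kappa_mk hc _ pos pos', h, RV.clsMap_apply, RV.clsMap_apply,
    RV.cls_relabel, DetPow.relabel_perm, RV.cls_smul_right, PP.relabel_mk]
  rfl

/-- The sum over the dual bases is the form of v ⊗ w pulled back along the contraction that matches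
the last element of the first block with the first of the second. Moved across the coend, this
contraction merges the two parts. -/
theorem kappa_edge {a a' : Fin (2 * g) → H g} (ha : IsDualBases n a a') (r r' d d' : ℕ)
    (v : Fin r → H g) (w : Fin r' → H g) (x y : V) (hx : x ∈ 𝒱 d) (hy : y ∈ 𝒱 d')
    (pos : 2 * n < d + n * (r + 1)) (pos' : 2 * n < d' + n * (r' + 1)) (hxy)
    (pos'' : 2 * n < d + d' + n * (r + r')) :
    ∑ i, kappa e ⟨r + 1, d, x, hx, Fin.snoc v (a i), pos⟩ *
      kappa e ⟨r' + 1, d', y, hy, Fin.cons (a' i) w, pos'⟩ =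
    kappa e ⟨r + r', d + d', x * y, hxy, Fin.append v w, pos''⟩ := by
  let f : Fin 2 ⊕ Fin (r + r') → Fin (r + 1) ⊕ Fin (r' + 1) :=
    Sum.elim ![.inl (Fin.last r), .inr 0]
      (Fin.addCases (fun i => .inl i.castSucc) fun j => .inr j.succ)
  have hf : Function.Bijective f := by
    refine (Fintype.bijective_iff_surjective_and_card f).2 ⟨?_, by simp; ring⟩
    rintro (i | j)
    · cases i using Fin.lastCases with
      | last => exact ⟨.inl 0, rfl⟩
      | cast i => exact ⟨.inr (Fin.castAdd r' i), by simp [f]⟩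
    · cases j using Fin.cases with
      | zero => exact ⟨.inl 1, rfl⟩
      | succ j => exact ⟨.inr (Fin.natAdd r j), by simp [f]⟩
  let σ := Equiv.ofBijective f hf
  have hσ : ∀ z, σ z = f z := fun z => rfl
  have h₁ : ∑ i, KDual.mul (dualTensor n (Fin.snoc v (a i) : Fin (r + 1) → H g))
      (dualTensor n (Fin.cons (a' i) w : Fin (r' + 1) → H g)) =
      KDual.contract n σ (dualTensor n (Fin.append v w)) := by
    refine MultilinearMap.ext fun u => ?_
    rw [KDual.contract_apply, _root_.sum_apply, hσ, hσ]
    simp only [KDual.mul_apply, dualTensor_apply, Fin.prod_univ_castSucc (n := r),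
      Fin.prod_univ_succ (n := r'), Fin.snoc_castSucc, Fin.snoc_last, Fin.cons_zero, Fin.cons_succ,
      Fin.prod_univ_add, Fin.append_left, Fin.append_right, hσ]
    simp only [f, Sum.elim_inl, Sum.elim_inr, Fin.addCases_left, Fin.addCases_right,
      Matrix.cons_val_zero, Matrix.cons_val_one]
    rw [← sum_pairing_mul_pairing ha, Finset.sum_mul]
    exact Finset.sum_congr rfl fun i _ => by ring
  -- The matched elements sit at the junction of the two blocks, hence are adjacent and go to the
  -- front without a sign.
  have h₂ : DetPow.mk n ((Ordering.fin (r + 1)).append (Ordering.fin (r' + 1))) =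
      DetPow.wedge n σ (DetPow.mk n (Ordering.fin (r + r'))) := by
    rw [DetPow.wedge_mk]
    refine (DetPow.mk_move ((List.finRange r).map fun i => .inl i.castSucc)
      ((List.finRange r').map fun i => .inr i.succ) [] (.inl (Fin.last r)) (.inr 0) _ _ ?_ ?_).symm
    · simp only [Ordering.relabel_list, Ordering.append_list, Ordering.fin_list, List.map_append,
        ← List.ofFn_eq_map, List.ofFn_add, List.map_ofFn, Function.comp_def, hσ]
      simp [f, List.ofFn_succ]
      exact funext fun i => Fin.addCases_left i
    · simp [List.finRange_succ_last (n := r), List.finRange_succ (n := r'), Function.comp_def]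
  have h : 2 * n < d + n * Nat.card (Fin (r + 1)) := by simpa using pos
  have h' : 2 * n < d' + n * Nat.card (Fin (r' + 1)) := by simpa using pos'
  have h'' : 2 * n < d + d' + n * Nat.card (Fin (r + r')) := by simpa using pos''
  have h₃ : PP.mk (((LPart.single n (Fin (r + 1)) d x hx h).sum
      (LPart.single n (Fin (r' + 1)) d' y hy h')).contract e σ) =
      PP.mk (LPart.single n (Fin (r + r')) (d + d') (x * y) hxy h'') := by
    have hne : ((LPart.single n (Fin (r + 1)) d x hx h).sum
        (LPart.single n (Fin (r' + 1)) d' y hy h')).part (σ (.inl 0)) ≠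
        ((LPart.single n (Fin (r + 1)) d x hx h).sum
        (LPart.single n (Fin (r' + 1)) d' y hy h')).part (σ (.inl 1)) := Sum.inl_ne_inr
    let φ : {i : Unit ⊕ Unit // i ≠ .inr ()} ≃ Unit :=
      { toFun := fun _ => ()
        invFun := fun _ => ⟨.inl (), Sum.inl_ne_inr⟩
        left_inv := by
          rintro ⟨_ | _, hi⟩
          exacts [rfl, absurd rfl hi]
        right_inv := fun _ => rfl }
    rw [LPart.contract, dif_neg hne]
    refine PP.mk_iso ⟨φ, fun _ => rfl, ?_⟩
    rintro ⟨_ | _, hi⟩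
    exacts [⟨(if_pos rfl).symm, (if_pos rfl).symm⟩, absurd rfl hi]
  simp only [kappa_mul_kappa hx hy _ _ pos pos' h h']
  rw [← map_sum, h₁, h₂, RV.clsMap_apply, RV.cls_contract, PP.contract_mk, h₃,
    kappa_mk hxy _ pos'' h'', RV.clsMap_apply]

/-- As for `kappa_edge`, with the contraction of the last two elements of a single block; both lie
in the same part, whose label is therefore multiplied by e. -/
theorem kappa_loop {a a' : Fin (2 * g) → H g} (ha : IsDualBases n a a') (r d : ℕ)
    (v : Fin r → H g) (x : V) (hx : x ∈ 𝒱 d) (pos : 2 * n < d + n * (r + 1 + 1)) (hex)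
    (pos' : 2 * n < 2 * n + d + n * r) :
    ∑ i, kappa e ⟨r + 1 + 1, d, x, hx,
      Fin.snoc (Fin.snoc v (a i) : Fin (r + 1) → H g) (a' i), pos⟩ =
    kappa e ⟨r, 2 * n + d, e * x, hex, v, pos'⟩ := by
  let f : Fin 2 ⊕ Fin r → Fin (r + 1 + 1) :=
    Sum.elim ![(Fin.last r).castSucc, Fin.last (r + 1)] fun i => i.castSucc.castSucc
  have hf : Function.Bijective f := by
    refine (Fintype.bijective_iff_surjective_and_card f).2 ⟨?_, by simp; ring⟩
    intro i
    cases i using Fin.lastCases with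
    | last => exact ⟨.inl 1, rfl⟩
    | cast i =>
      cases i using Fin.lastCases with
      | last => exact ⟨.inl 0, rfl⟩
      | cast i => exact ⟨.inr i, rfl⟩
  let σ := Equiv.ofBijective f hf
  have hσ : ∀ z, σ z = f z := fun z => rfl
  have h₁ : ∑ i, dualTensor n
      (Fin.snoc (Fin.snoc v (a i) : Fin (r + 1) → H g) (a' i) : Fin (r + 1 + 1) → H g) =
      KDual.contract n σ (dualTensor n v) := by
    refine MultilinearMap.ext fun u => ?_
    rw [KDual.contract_apply, _root_.sum_apply, hσ, hσ]
    simp only [dualTensor_apply, Fin.prod_univ_castSucc (n := r),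
      Fin.prod_univ_castSucc (n := r + 1), Fin.snoc_castSucc, Fin.snoc_last, hσ]
    simp only [f, Sum.elim_inl, Sum.elim_inr, Matrix.cons_val_zero, Matrix.cons_val_one]
    rw [← sum_pairing_mul_pairing ha, Finset.sum_mul]
    exact Finset.sum_congr rfl fun i _ => by ring
  have h₂ : DetPow.mk n (Ordering.fin (r + 1 + 1)) =
      DetPow.wedge n σ (DetPow.mk n (Ordering.fin r)) := by
    rw [DetPow.wedge_mk]
    refine (DetPow.mk_move ((List.finRange r).map fun i => i.castSucc.castSucc)
      [] [] (Fin.last r).castSucc (Fin.last (r + 1)) _ _ ?_ ?_).symm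
    · simp [f, hσ, List.finRange_succ, Function.comp_def]
    · simp [List.finRange_succ_last, Function.comp_def]
  have h : 2 * n < d + n * Nat.card (Fin (r + 1 + 1)) := by simpa using pos
  have h' : 2 * n < 2 * n + d + n * Nat.card (Fin r) := by simpa using pos'
  have h₃ : PP.mk ((LPart.single n (Fin (r + 1 + 1)) d x hx h).contract e σ) =
      PP.mk (LPart.single n (Fin r) (2 * n + d) (e * x) hex h') := by
    have heq : (LPart.single n (Fin (r + 1 + 1)) d x hx h).part (σ (.inl 0)) =
        (LPart.single n (Fin (r + 1 + 1)) d x hx h).part (σ (.inl 1)) := rfl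
    rw [LPart.contract, dif_pos heq]
    exact PP.mk_iso ⟨.refl _, fun _ => rfl, fun _ => ⟨(if_pos rfl).symm, (if_pos rfl).symm⟩⟩
  simp only [kappa_mk hx _ pos h]
  rw [← map_sum, h₁, h₂, RV.clsMap_apply, RV.cls_contract, PP.contract_mk, h₃,
    kappa_mk hex _ pos' h', RV.clsMap_apply]

/-- The comparison map from the presented ring to the coend. -/
def phi (even : ∀ d, Odd d → 𝒱 d = ⊥) (g : ℕ) (e : 𝒱 (2 * n)) : KRing g e →ₐ[ℚ] RV g e :=
  RingQuot.liftAlgHom ℚ ⟨FreeAlgebra.lift ℚ (kappa e), by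
    rintro _ _ (⟨x, y⟩ | ⟨r, d, v, s, t, c, c', hc, hc', pos⟩ |
      ⟨r, d, v, i, s, t, x, y, c, hc, pos⟩ | ⟨r, d, v, σ, c, hc, pos⟩ |
      ⟨a, a', ha, r, r', d, d', v, w, x, y, hx, hy, pos, pos'⟩ | ⟨a, a', ha, r, d, v, x, hx, pos⟩)
    all_goals simp only [map_sum, map_mul, map_add, map_smul, FreeAlgebra.lift_ι_apply]
    · exact kappa_comm even x y
    · exact kappa_linear_label r d v s t c c' hc hc' _ pos
    · exact kappa_linear_vector r d v i s t x y c hc pos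
    · exact kappa_symmetry r d v σ c hc pos
    · exact kappa_edge ha r r' d d' v w x y hx hy pos pos' _ _
    · exact kappa_loop ha r d v x hx pos _ _⟩

theorem phi_gen (even : ∀ d, Odd d → 𝒱 d = ⊥) (x : KGen 𝒱 n g) :
    phi even g e (KRing.gen e x) = kappa e x := by
  rw [phi, KRing.gen, RingQuot.liftAlgHom_mkAlgHom_apply, FreeAlgebra.lift_ι_apply]

end Relations

/-! ### Degrees -/

section Degrees

variable {V : Type*} [CommRing V] [Algebra ℚ V] {𝒱 : ℕ → Submodule ℚ V} {n g : ℕ} {S T : Type}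

namespace LPart

theorem degree_congr {A : LPart 𝒱 n S} {B : LPart 𝒱 n T} (σ : S ≃ T) (φ : A.I ≃ B.I)
    (h : ∀ s, B.part (σ s) = φ (A.part s)) (h' : ∀ i, B.deg (φ i) = A.deg i) :
    A.degree = B.degree := by
  refine finsum_eq_of_bijective φ φ.bijective fun i => ?_
  have : A.size i = B.size (φ i) := Nat.card_congr (σ.subtypeEquiv fun s => by rw [h]; simp)
  rw [h', this]

theorem degree_sum [Finite S] [Finite T] (A : LPart 𝒱 n S) (B : LPart 𝒱 n T) :
    (A.sum B).degree = A.degree + B.degree := by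
  have := A.fin
  have := B.fin
  have := Fintype.ofFinite A.I
  have := Fintype.ofFinite B.I
  have h₁ : ∀ i, (A.sum B).size (.inl i) = A.size i := fun i => by
    refine (card_sum_subtype _).trans ?_
    simp [sum, size]
  have h₂ : ∀ i, (A.sum B).size (.inr i) = B.size i := fun i => by
    refine (card_sum_subtype _).trans ?_
    simp [sum, size]
  change (∑ᶠ i : A.I ⊕ B.I, (Sum.elim A.deg B.deg i + n * (A.sum B).size i - 2 * n)) = _
  rw [degree, degree, finsum_eq_sum_of_fintype, finsum_eq_sum_of_fintype, finsum_eq_sum_of_fintype,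
    Fintype.sum_sum_type]
  simp only [Sum.elim_inl, Sum.elim_inr, h₁, h₂]

theorem degree_single (d : ℕ) (c : V) (hc : c ∈ 𝒱 d) (h : 2 * n < d + n * Nat.card S) :
    (single n S d c hc h).degree = d + n * Nat.card S - 2 * n := by
  change (∑ᶠ i : Unit, (d + n * Nat.card {s : S // () = i} - 2 * n)) = _
  rw [finsum_unique]
  simp

theorem degree_empty : (empty 𝒱 n).degree = 0 := by
  change (∑ᶠ i : Empty, _) = 0
  exact finsum_of_isEmpty _

end LPart

variable [GradedAlgebra 𝒱] {e : 𝒱 (2 * n)}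

theorem RV.one_mem_degree : (1 : RV g e) ∈ RV.degree g e 0 :=
  Submodule.subset_span ⟨Empty, inferInstance, KDual.one g, LPart.empty 𝒱 n, Ordering.nil,
    LPart.degree_empty, rfl⟩

theorem RV.mul_mem_degree {j k : ℕ} {x y : RV g e} (hx : x ∈ RV.degree g e j)
    (hy : y ∈ RV.degree g e k) : x * y ∈ RV.degree g e (j + k) := by
  have h := Submodule.mul_mem_mul hx hy
  rw [RV.degree, RV.degree, Submodule.span_mul_span] at h
  refine Submodule.span_mono ?_ h
  rintro _ ⟨_, ⟨S, _, ξ, A, o, rfl, rfl⟩, _, ⟨T, _, η, B, o', rfl, rfl⟩, rfl⟩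
  refine ⟨S ⊕ T, inferInstance, KDual.mul ξ η, A.sum B, o.append o', A.degree_sum B, ?_⟩
  simp only [RV.cls_mul_cls, PP.mul_mk, DetPow.mul_mk]

theorem kappa_mem_degree (x : KGen 𝒱 n g) : kappa e x ∈ RV.degree g e x.degree :=
  Submodule.subset_span ⟨_, inferInstance, _, _, _,
    (LPart.degree_single _ _ _ _).trans (by simp [KGen.degree]), rfl⟩

theorem KRing.one_mem_degree : (1 : KRing g e) ∈ KRing.degree g e 0 :=
  Submodule.subset_span ⟨[], rfl, rfl⟩

theorem KRing.gen_mem_degree (x : KGen 𝒱 n g) : KRing.gen e x ∈ KRing.degree g e x.degree :=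
  Submodule.subset_span ⟨[x], by simp, by simp⟩

theorem KRing.mul_mem_degree {j k : ℕ} {x y : KRing g e} (hx : x ∈ KRing.degree g e j)
    (hy : y ∈ KRing.degree g e k) : x * y ∈ KRing.degree g e (j + k) := by
  have h := Submodule.mul_mem_mul hx hy
  rw [KRing.degree, KRing.degree, Submodule.span_mul_span] at h
  refine Submodule.span_mono ?_ h
  rintro _ ⟨_, ⟨l, rfl, rfl⟩, _, ⟨l', rfl, rfl⟩, rfl⟩
  exact ⟨l ++ l', by simp, by simp⟩

theorem phi_mem_degree (even : ∀ d, Odd d → 𝒱 d = ⊥) {k : ℕ} :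
    ∀ {x : KRing g e}, x ∈ KRing.degree g e k → phi even g e x ∈ RV.degree g e k := by
  suffices h : KRing.degree g e k ≤ (RV.degree g e k).comap (phi even g e).toLinearMap from
    fun _ hx => h hx
  refine Submodule.span_le.2 ?_
  rintro _ ⟨l, rfl, rfl⟩
  change phi even g e _ ∈ RV.degree g e _
  induction l with
  | nil => simpa using RV.one_mem_degree
  | cons a l ih =>
    rw [List.map_cons, List.map_cons, List.sum_cons, List.prod_cons, map_mul, phi_gen]
    exact RV.mul_mem_degree (kappa_mem_degree a) ih

/-- Since `psi` is unital and multiplicative, the composite is an algebra endomorphism of the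
presented ring and need only be checked on generators. This gives injectivity of `phi` without any
bound on g or on the degree. -/
theorem psi_phi (even : ∀ d, Odd d → 𝒱 d = ⊥) (x : KRing g e) :
    psi even g e (phi even g e x) = x := by
  have : (AlgHom.ofLinearMap (psi even g e) (psi_one even) (psi_mul even)).comp (phi even g e) =
      AlgHom.id ℚ _ := by
    refine RingQuot.ringQuot_ext' _ _ _ (FreeAlgebra.hom_ext (funext fun x => ?_))
    exact (congrArg (psi even g e) (phi_gen even x)).trans (psi_kappa even x)
  exact DFunLike.congr_fun this x

end Degrees

/-! ### Surjectivity of the comparison map -/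

section Surjectivity

variable {n g : ℕ} {S T : Type}

/-- The form `⊗ λ(v_s, -)` on `H(g)^{⊗ S}`. -/
def tensorForm (n : ℕ) [Finite S] (v : S → H g) : KDual g S :=
  have := Fintype.ofFinite S
  (MultilinearMap.mkPiAlgebra ℚ S ℚ).compLinearMap fun s => pairing n g (v s)

theorem tensorForm_apply [Fintype S] (v u : S → H g) :
    tensorForm n v u = ∏ s, pairing n g (v s) (u s) := by
  simp only [tensorForm, MultilinearMap.compLinearMap_apply, MultilinearMap.mkPiAlgebra_apply]
  exact Finset.prod_congr (by ext; simp) fun _ _ => rfl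

theorem relabel_tensorForm [Finite S] [Finite T] {r : ℕ} (σ : Fin r ⊕ T ≃ S) (v : S → H g) :
    KDual.relabel σ (tensorForm n v) =
      KDual.mul (dualTensor n fun i => v (σ (.inl i))) (tensorForm n fun t => v (σ (.inr t))) := by
  have := Fintype.ofFinite S
  have := Fintype.ofFinite T
  refine MultilinearMap.ext fun u => ?_
  rw [KDual.relabel_apply, KDual.mul_apply, tensorForm_apply, tensorForm_apply, dualTensor_apply,
    ← σ.prod_comp, Fintype.prod_sum_type]
  simp

theorem sum_pairing_stdBasis (x : H g) :
    ∑ k, pairing n g (stdBasis g k) x • stdDual n g k = x := by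
  obtain ⟨ε, hε⟩ := exists_isDualBases_std n g
  rw [← ε.sum_comp]
  exact sum_pairing_smul hε x

/-- Nonsingularity of λ: expanding the arguments in the dual basis gives ξ = ∑_f ξ(a_f^#) ⊗_s λ(a_{f
s}, -). -/
theorem mem_span_tensorForm [Finite S] (n : ℕ) (ξ : KDual g S) :
    ξ ∈ Submodule.span ℚ (Set.range (tensorForm (g := g) (S := S) n)) := by
  classical
  have := Fintype.ofFinite S
  have : ξ = ∑ f : S → Fin g ⊕ Fin g, ξ (fun s => stdDual n g (f s)) •
      tensorForm n fun s => stdBasis g (f s) := by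
    refine MultilinearMap.ext fun u => ?_
    conv_lhs => rw [← funext fun s => sum_pairing_stdBasis (n := n) (u s)]
    rw [MultilinearMap.map_sum, _root_.sum_apply]
    refine Finset.sum_congr rfl fun f _ => ?_
    rw [MultilinearMap.map_smul_univ, _root_.smul_apply, tensorForm_apply, smul_eq_mul, smul_eq_mul,
      mul_comm]
  rw [this]
  exact Submodule.sum_mem _ fun f _ => Submodule.smul_mem _ _ (Submodule.subset_span ⟨_, rfl⟩)

variable {V : Type*} [CommRing V] [Algebra ℚ V] {𝒱 : ℕ → Submodule ℚ V}

/-- The labelled partition consisting of all parts but one. -/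
def LPart.erase (A : LPart 𝒱 n S) (i : A.I) : LPart 𝒱 n {s // A.part s ≠ i} where
  I := {j // j ≠ i}
  fin := by have := A.fin; infer_instance
  part s := ⟨A.part s, s.2⟩
  deg j := A.deg j
  lab j := A.lab j
  lab_mem j := A.lab_mem j
  pos j := by
    have : Nat.card {s : {s // A.part s ≠ i} // (⟨A.part s, s.2⟩ : {j // j ≠ i}) = j} =
        Nat.card {s // A.part s = j} := Nat.card_congr
      { toFun := fun s => ⟨s.1, congrArg Subtype.val s.2⟩
        invFun := fun s => ⟨⟨s.1, s.2.trans_ne j.2⟩, Subtype.ext s.2⟩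
        left_inv := fun _ => rfl
        right_inv := fun _ => rfl }
    rw [this]
    exact A.pos j

variable [GradedAlgebra 𝒱] {e : 𝒱 (2 * n)}

/-- A pure tensor form splits along S = (one part) ⊔ (the rest), so the class is, up to a scalar, a
class κ times a class with one part fewer. The induction is on the number of parts rather than on
the size of S, because parts may be empty. -/
theorem cls_tensorForm_mem (even : ∀ d, Odd d → 𝒱 d = ⊥) (m : ℕ) :
    ∀ {S : Type} [Finite S] (A : LPart 𝒱 n S) (_ : Nat.card A.I = m) (v : S → H g) (o : Ordering S),
      RV.cls e (tensorForm n v) (PP.mk A) (DetPow.mk n o) ∈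
        (KRing.degree g e A.degree).map (phi even g e).toLinearMap := by
  induction m with
  | zero =>
    intro S _ A hA v o
    have := A.fin
    have hI : IsEmpty A.I := Finite.card_eq_zero_iff.1 hA
    -- Without parts there are no elements either, and the class is the unit.
    have hS : IsEmpty S := A.part.isEmpty
    let σ : Empty ≃ S := Equiv.equivOfIsEmpty _ _
    let φ : (LPart.empty 𝒱 n).I ≃ A.I := (Equiv.equivOfIsEmpty Empty A.I)
    have hdeg : A.degree = 0 := by
      rw [← LPart.degree_empty (𝒱 := 𝒱) (n := n)]
      exact (LPart.degree_congr σ φ (fun s => s.elim) (fun i => Empty.elim i)).symm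
    have h₁ : PP.mk A = PP.relabel σ (PP.mk (LPart.empty 𝒱 n)) := by
      rw [PP.relabel_mk]
      exact (PP.mk_iso ⟨φ, fun s => isEmptyElim s, fun i => Empty.elim i⟩).symm
    have h₂ : DetPow.mk n o = DetPow.relabel n σ (DetPow.mk n Ordering.nil) := by
      rw [DetPow.relabel_mk]
      congr 1
      exact Ordering.ext ((List.eq_nil_iff_forall_not_mem.2 fun s => isEmptyElim s).trans rfl)
    have h₃ : KDual.relabel σ (tensorForm n v) = KDual.one g := by
      have := Fintype.ofFinite S
      refine MultilinearMap.ext fun u => ?_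
      rw [KDual.relabel_apply, tensorForm_apply]
      simp [KDual.one]
    rw [hdeg, h₁, h₂, ← RV.cls_relabel, h₃]
    exact ⟨1, KRing.one_mem_degree, map_one (phi even g e)⟩
  | succ m ih =>
    classical
    intro S _ A hA v o
    have := A.fin
    obtain ⟨i⟩ : Nonempty A.I := (Nat.card_pos_iff.1 (hA ▸ m.succ_pos)).1
    let r := Nat.card {s // A.part s = i}
    let ε : Fin r ≃ {s // A.part s = i} := (Finite.equivFin _).symm
    let σ : Fin r ⊕ {s // A.part s ≠ i} ≃ S :=
      (ε.sumCongr (Equiv.refl _)).trans (Equiv.sumCompl fun s => A.part s = i)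
    have hpos : 2 * n < A.deg i + n * r := A.pos i
    have hpos' : 2 * n < A.deg i + n * Nat.card (Fin r) := by simpa using hpos
    let B := (LPart.single n (Fin r) (A.deg i) (A.lab i) (A.lab_mem i) hpos').sum (A.erase i)
    let φ : Unit ⊕ {j // j ≠ i} ≃ A.I :=
      (((Equiv.ofUnique Unit {j // j = i}).sumCongr (Equiv.refl _)).trans
        (Equiv.sumCompl fun j => j = i))
    have hφ : ∀ z, A.part (σ z) = φ (B.part z) := by
      rintro (z | z)
      · exact (ε z).2
      · rfl
    have hφ' : ∀ z, A.deg (φ z) = B.deg z ∧ A.lab (φ z) = B.lab z := by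
      rintro (z | z) <;> exact ⟨rfl, rfl⟩
    have hdeg : A.degree = (KGen.degree ⟨r, A.deg i, A.lab i, A.lab_mem i,
        fun k => v (σ (.inl k)), hpos⟩ : ℕ) + (A.erase i).degree := by
      rw [← LPart.degree_congr (A := B) σ φ hφ fun z => (hφ' z).1, LPart.degree_sum,
        LPart.degree_single]
      simp [KGen.degree]
    have h₁ : PP.mk A = PP.relabel σ (PP.mk B) := by
      rw [PP.relabel_mk]
      exact (PP.mk_iso ⟨φ, fun s => by
        obtain ⟨z, rfl⟩ := σ.surjective s
        exact (hφ z).trans (congrArg (fun z => φ (B.part z)) (σ.symm_apply_apply z).symm),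
        hφ'⟩).symm
    obtain ⟨l, hl, hl'⟩ := PartEnum.exists_list {s // A.part s ≠ i} fun _ => True
    let o' : Ordering {s // A.part s ≠ i} := ⟨l, hl, fun s => (hl' s).2 trivial⟩
    -- The given ordering need not list the part i first; c is the cost of rearranging it so, and is
    -- harmless for membership in a subspace.
    obtain ⟨c, hc⟩ := DetPow.mk_eq_smul (n := n) o (((Ordering.fin r).append o').relabel σ)
    have hcard : Nat.card (A.erase i).I = m := by
      have := Nat.card_congr φ
      rw [hA, Nat.card_sum, Nat.card_unique, add_comm] at this
      exact Nat.succ_injective this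
    obtain ⟨y, hy, hy'⟩ := ih (A.erase i) hcard (fun t => v (σ (.inr t))) o'
    rw [hdeg, h₁, hc, ← DetPow.relabel_mk, RV.cls_smul_right, ← RV.cls_relabel, relabel_tensorForm,
      ← PP.mul_mk, ← DetPow.mul_mk, ← RV.cls_mul_cls]
    refine Submodule.smul_mem _ _ ⟨_, KRing.mul_mem_degree (KRing.gen_mem_degree _) hy, ?_⟩
    refine (map_mul (phi even g e) _ _).trans (congrArg₂ _ (phi_gen even _) hy')

/-- The class is linear in the form, so pure tensor forms suffice. The degree is tracked so that
preimages can be found in the same degree, as bijectivity in each degree requires. -/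
theorem degree_le_map_phi (even : ∀ d, Odd d → 𝒱 d = ⊥) (k : ℕ) :
    RV.degree g e k ≤ (KRing.degree g e k).map (phi even g e).toLinearMap := by
  refine Submodule.span_le.2 ?_
  rintro _ ⟨S, _, ξ, A, o, rfl, rfl⟩
  suffices h : Submodule.span ℚ (Set.range (tensorForm (g := g) (S := S) n)) ≤
      ((KRing.degree g e A.degree).map (phi even g e).toLinearMap).comap
        (RV.clsMap e (PP.mk A) (DetPow.mk n o)) from h (mem_span_tensorForm n ξ)
  refine Submodule.span_le.2 ?_
  rintro _ ⟨v, rfl⟩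
  exact cls_tensorForm_mem even _ A rfl v o

end Surjectivity

end TorelliRing

end

theorem mainTheorem4 {V : Type*} [CommRing V] [Algebra ℚ V]
    (𝒱 : ℕ → Submodule ℚ V) [GradedAlgebra 𝒱]
    (finite_type : ∀ d, FiniteDimensional ℚ (𝒱 d))
    (even : ∀ d, Odd d → 𝒱 d = ⊥)
    (n : ℕ) (hn : 1 ≤ n) (e : 𝒱 (2 * n)) :
    ∃ φ : ∀ g : ℕ, TorelliRing.KRing g e →ₐ[ℚ] TorelliRing.RV g e,
      (∀ (g : ℕ) (x : TorelliRing.KGen 𝒱 n g),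
        φ g (TorelliRing.KRing.gen e x) = TorelliRing.kappa e x) ∧
      ∀ N : ℕ, ∃ g₀ : ℕ, ∀ g : ℕ, g₀ ≤ g → ∀ k : ℕ, k ≤ N →
        Set.BijOn (φ g) (TorelliRing.KRing.degree g e k : Set (TorelliRing.KRing g e))
          (TorelliRing.RV.degree g e k : Set (TorelliRing.RV g e)) := by
  -- The bound g₀ = 0 works for every N, as `phi` is bijective in each degree for all g.
  refine ⟨fun g => TorelliRing.phi even g e, fun g x => TorelliRing.phi_gen even x,
    fun N => ⟨0, fun g _ k _ => ⟨fun x hx => TorelliRing.phi_mem_degree even hx, ?_, ?_⟩⟩⟩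
  · exact (Function.LeftInverse.injective (TorelliRing.psi_phi even)).injOn
  · intro y hy
    exact TorelliRing.degree_le_map_phi even k hy
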